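/- Let $H$ be a cocommutative Hopf algebra over a field $k$ with antipode $S$, and write $\Delta h=h_{(1)}\otimes h_{(2)}$. Let $V$ be a cocommutative left $H$-module coalgebra, i.e. a cocommutative coalgebra with a left $H$-action $\triangleright$ such that $\Delta(h\triangleright v)=h_{(1)}\triangleright v_{(1)}\otimes h_{(2)}\triangleright v_{(2)}$ and $\epsilon(h\triangleright v)=\epsilon(h)\epsilon(v)$. Let $H^+=\ker\epsilon$, $\pi(h)=h-\epsilon(h)1$, and let $\omega:H^+\to V$ be a map of right $H$-modules, where $H$ acts on $H^+$ by right multiplication and on $V$ by $v\triangleleft h=S(h)\triangleright v$. The dual $V^*$ is a commutative algebra under the convolution product $*$, with left $H$-action $\langle h\triangleright\phi,v\rangle=\langle\phi,S(h)\triangleright v\rangle$. Let $\widetilde H=S(V^*)\rtimes H$ be the cross product algebra by the diagonal action of $H$ on the symmetric algebra $S(V^*)$, so that $h\phi=(h_{(1)}\triangleright\phi)h_{(2)}$, with the tensor product coalgebra structure, the elements of $V^*$ being primitive. It acts from the right on $V^*\oplus V$ by $$(\psi+v)\triangleleft(\phi_1\cdots\phi_n h)=(-1)^nS(h)\triangleright(\phi_1*\cdots*\phi_n*\psi)+\delta_{n,0}\,S(h)\triangleright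 v,$$ and diagonally on the exterior algebra $\Lambda(V^*\oplus V)$. Let $\Omega=\widetilde H\ltimes\Lambda(V^*\oplus V)$ be the space $\widetilde H\otimes\Lambda(V^*\oplus V)$, graded by the degree of forms, with product $(a\otimes\eta)(b\otimes\xi)=ab_{(1)}\otimes(\eta\triangleleft b_{(2)})\wedge\xi$ and with the tensor product coalgebra structure, where $\Lambda(V^*\oplus V)$ carries the super-coproduct for which the elements of $V^*\oplus V$ are primitive. Then $\widetilde H$ is a Hopf algebra, $\Omega$ is an $\mathbb N_0$-graded super-Hopf algebra with $\Omega^0=\widetilde H$, and there is a degree $1$ linear map $\mathrm d:\Omega\to\Omega$ making $\Omega$ a strongly bicovariant differential graded algebra over $\widetilde H$, that is, $\mathrm d^2=0$, $\mathrm d(\xi\eta)=(\mathrm d\xi)\eta+(-1)^{|\xi|}\xi\,\mathrm d\eta$ and $\Delta(\mathrm d\xi)=\mathrm d\xi^{(1)}\otimes\xi^{(2)}+(-1)^{|\xi^{(1)}|}\xi^{(1)}\otimes\mathrm d\xi^{(2)}$. If $\omega$ is surjective, then it is standard, i.e. $\Omega$ is generated as an algebra by $\widetilde H$ and $\mathrm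 d\widetilde H$. With $Sh(p,n-p)$ the set of permutations of $\{1,\dots,n\}$ that are increasing on $\{1,\dots,p\}$ and on $\{p+1,\dots,n\}$, the map $\mathrm d$ is given by $$\mathrm dh=h_{(1)}\otimes\omega(\pi(h_{(2)})),\qquad \mathrm d\phi=1\otimes\phi,$$ $$\mathrm d(\phi_1\cdots\phi_nh)=\sum_{p=0}^{n-1}\sum_{\sigma\in Sh(p,n-p)}(-1)^{n-p-1}\phi_{\sigma(1)}\cdots\phi_{\sigma(p)}h_{(1)}\otimes S(h_{(2)})\triangleright(\phi_{\sigma(p+1)}*\cdots*\phi_{\sigma(n)})+\phi_1\cdots\phi_nh_{(1)}\otimes\omega(\pi(h_{(2)})),$$ and, for $F=f_1\wedge\cdots\wedge f_r\wedge e_1\wedge\cdots\wedge e_s$ with $f_i\in V^*$ and $e_j\in V$, $$\mathrm d(\phi_1\cdots\phi_nh\otimes F)=\phi_1\cdots\phi_nh_{(1)}\otimes\omega(\pi(h_{(2)}))\wedge F+\sum_{p=0}^{n-1}\sum_{\sigma\in Sh(p,n-p)}(-1)^{n-p-1}\phi_{\sigma(1)}\cdots\phi_{\sigma(p)}h_{(1)}\otimes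 S(h_{(2)})\triangleright(\phi_{\sigma(p+1)}*\cdots*\phi_{\sigma(n)})\wedge F.$$ Moreover, for all $\phi_i,\psi_j\in V^*$, $$[\phi_1\cdots\phi_n,\mathrm d(\psi_1\cdots\psi_m)]=\sum_{p=0}^{m-1}\sum_{q=0}^{n-1}\sum_{\sigma\in Sh(p,m-p)}\sum_{\tau\in Sh(q,n-q)}(-1)^{(m-p)+(n-q)}\psi_{\sigma(1)}\cdots\psi_{\sigma(p)}\phi_{\tau(1)}\cdots\phi_{\tau(q)}\otimes\phi_{\tau(q+1)}*\cdots*\phi_{\tau(n)}*\psi_{\sigma(p+1)}*\cdots*\psi_{\sigma(m)},$$ and in particular $[\phi,\mathrm d\psi]=1\otimes\phi*\psi$. -/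

import Mathlib

open scoped TensorProduct

noncomputable section

/-! ## Hopf algebras and super-Hopf algebras given by their structure maps

The cross products below live on tensor products, which already carry another multiplication,
so a (super-)Hopf algebra is presented by its structure maps. -/

/-- Structure maps (without laws) of a bialgebra on a `k`-module `A`. -/
structure HopfOps (k A : Type*) [CommRing k] [AddCommGroup A] [Module k A] where
  /-- multiplication `A × A → A` -/
  mul : A →ₗ[k] A →ₗ[k] A
  /-- unit element -/
  one : A
  /-- comultiplication -/
  comul : A →ₗ[k] A ⊗[k] A
  /-- counit -/
  counit : A →ₗ[k] k

namespace HopfOps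

variable {k A B : Type*} [CommRing k] [AddCommGroup A] [Module k A] [AddCommGroup B] [Module k B]

/-- The multiplication as a map on `A ⊗ A`. -/
def mulT (X : HopfOps k A) : A ⊗[k] A →ₗ[k] A := TensorProduct.lift X.mul

/-- The multiplication of `A ⊗ A` with respect to a flip map `τ` on `A ⊗ A`, as a map
`(A ⊗ A) ⊗ (A ⊗ A) → A ⊗ A`, namely `(m ⊗ m) ∘ (id ⊗ τ ⊗ id)`. -/
def tensorMul (X : HopfOps k A) (τ : A ⊗[k] A →ₗ[k] A ⊗[k] A) :
    (A ⊗[k] A) ⊗[k] (A ⊗[k] A) →ₗ[k] A ⊗[k] A :=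
  TensorProduct.map X.mulT X.mulT
    ∘ₗ (TensorProduct.assoc k A A (A ⊗[k] A)).symm.toLinearMap
    ∘ₗ LinearMap.lTensor A (TensorProduct.assoc k A A A).toLinearMap
    ∘ₗ LinearMap.lTensor A (LinearMap.rTensor A τ)
    ∘ₗ LinearMap.lTensor A (TensorProduct.assoc k A A A).symm.toLinearMap
    ∘ₗ (TensorProduct.assoc k A A (A ⊗[k] A)).toLinearMap

/-- `S` is an antipode: a two-sided convolution inverse of the identity. -/
def IsAntipode (X : HopfOps k A) (S : A →ₗ[k] A) : Prop :=
  (∀ a, X.mulT (LinearMap.rTensor A S (X.comul a)) = X.counit a • X.one) ∧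
  (∀ a, X.mulT (LinearMap.lTensor A S (X.comul a)) = X.counit a • X.one)

/-- The axioms of a Hopf algebra, in the version where the multiplication of `A ⊗ A` is formed
with the flip `τ`. -/
structure IsHopfFor (X : HopfOps k A) (τ : A ⊗[k] A →ₗ[k] A ⊗[k] A) : Prop where
  mul_assoc : ∀ a b c, X.mul (X.mul a b) c = X.mul a (X.mul b c)
  one_mul : ∀ a, X.mul X.one a = a
  mul_one : ∀ a, X.mul a X.one = a
  coassoc : ∀ a, TensorProduct.assoc k A A A (LinearMap.rTensor A X.comul (X.comul a)) =
    LinearMap.lTensor A X.comul (X.comul a)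
  counit_left : ∀ a, TensorProduct.lid k A (LinearMap.rTensor A X.counit (X.comul a)) = a
  counit_right : ∀ a, TensorProduct.rid k A (LinearMap.lTensor A X.counit (X.comul a)) = a
  comul_one : X.comul X.one = X.one ⊗ₜ[k] X.one
  comul_mul : ∀ a b, X.comul (X.mul a b) = X.tensorMul τ (X.comul a ⊗ₜ[k] X.comul b)
  counit_one : X.counit X.one = 1
  counit_mul : ∀ a b, X.counit (X.mul a b) = X.counit a * X.counit b
  exists_antipode : ∃ S : A →ₗ[k] A, X.IsAntipode S

/-- The axioms of an ordinary Hopf algebra. -/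
def IsHopf (X : HopfOps k A) : Prop := X.IsHopfFor (TensorProduct.comm k A A).toLinearMap

section Graded

variable (𝒜 : ℕ → Submodule k A) [DirectSum.Decomposition 𝒜]

/-- The super-flip `x ⊗ y ↦ (-1)^(|x||y|) y ⊗ x` of an `ℕ`-graded module. -/
def superFlip : A ⊗[k] A →ₗ[k] A ⊗[k] A :=
  let e := DirectSum.decomposeLinearEquiv 𝒜
  (TensorProduct.congr e e).symm.toLinearMap
    ∘ₗ (TensorProduct.gradedComm k (fun i => 𝒜 i) (fun i => 𝒜 i)).toLinearMap
    ∘ₗ (TensorProduct.congr e e).toLinearMap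

/-- The degree involution `x ↦ (-1)^|x| x` of an `ℕ`-graded module. -/
def degreeSign : A →ₗ[k] A :=
  DirectSum.toModule k ℕ A (fun i => (-1 : k) ^ i • (𝒜 i).subtype)
    ∘ₗ (DirectSum.decomposeLinearEquiv 𝒜).toLinearMap

/-- The axioms of an `ℕ`-graded super-Hopf algebra; `A` is the direct sum of the `𝒜 i`
by the `DirectSum.Decomposition` instance. -/
structure IsSuperHopf (X : HopfOps k A) : Prop where
  hopf : X.IsHopfFor (superFlip 𝒜)
  one_mem : X.one ∈ 𝒜 0
  mul_mem : ∀ i j, ∀ x ∈ 𝒜 i, ∀ y ∈ 𝒜 j, X.mul x y ∈ 𝒜 (i + j)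
  comul_mem : ∀ n, ∀ x ∈ 𝒜 n, X.comul x ∈ ⨆ p ∈ Finset.HasAntidiagonal.antidiagonal n,
    LinearMap.range (TensorProduct.map (𝒜 p.1).subtype (𝒜 p.2).subtype)
  counit_eq_zero : ∀ n, n ≠ 0 → ∀ x ∈ 𝒜 n, X.counit x = 0
  antipode_mem : ∀ S, X.IsAntipode S → ∀ n, ∀ x ∈ 𝒜 n, S x ∈ 𝒜 n

/-- `A` with grading `𝒜` and differential `d` is a strongly bicovariant differential graded
algebra over the Hopf algebra `B`, the latter being identified through `i` with the part of
degree `0`. -/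
structure IsStronglyBicovariantDGA (Y : HopfOps k B) (X : HopfOps k A) (i : B →ₗ[k] A)
    (d : A →ₗ[k] A) : Prop where
  base_hopf : Y.IsHopf
  super_hopf : X.IsSuperHopf 𝒜
  incl_injective : Function.Injective i
  range_incl : LinearMap.range i = 𝒜 0
  incl_one : i Y.one = X.one
  incl_mul : ∀ a b, i (Y.mul a b) = X.mul (i a) (i b)
  incl_comul : ∀ a, X.comul (i a) = TensorProduct.map i i (Y.comul a)
  incl_counit : ∀ a, X.counit (i a) = Y.counit a
  d_mem : ∀ n, ∀ x ∈ 𝒜 n, d x ∈ 𝒜 (n + 1)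
  d_d : ∀ x, d (d x) = 0
  d_mul : ∀ n, ∀ x ∈ 𝒜 n, ∀ y, d (X.mul x y) = X.mul (d x) y + (-1 : k) ^ n • X.mul x (d y)
  comul_d : ∀ x, X.comul (d x) = LinearMap.rTensor A d (X.comul x) +
    TensorProduct.map (degreeSign 𝒜) d (X.comul x)

end Graded

/-- The standard case: `A` is generated as an algebra by `B` and `d B`. -/
def IsStandard (X : HopfOps k A) (i : B →ₗ[k] A) (d : A →ₗ[k] A) : Prop :=
  ∀ T : Submodule k A, X.one ∈ T → (∀ b, i b ∈ T) → (∀ b, d (i b) ∈ T) →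
    (∀ x ∈ T, ∀ y ∈ T, X.mul x y ∈ T) → T = ⊤

end HopfOps

/-! ## Cross products -/

section Cross

variable {k : Type*} [CommRing k]

/-- The multiplication `(a ⊗ h)(b ⊗ g) = a (h₁ ▷ b) ⊗ h₂ g` of the left cross product of an
algebra `A` by a bialgebra `H` acting on it by `act`. -/
def leftCrossMul {A H : Type*} [Ring A] [Algebra k A] [Ring H] [Bialgebra k H]
    (act : H →ₗ[k] Module.End k A) : (A ⊗[k] H) →ₗ[k] (A ⊗[k] H) →ₗ[k] (A ⊗[k] H) :=
  TensorProduct.lift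
    ((LinearMap.mul k (Module.End k (A ⊗[k] H))).compl₁₂
      (LinearMap.rTensorHom H ∘ₗ LinearMap.mul k A)
      (TensorProduct.homTensorHomMap (.id k) A H A H
        ∘ₗ TensorProduct.map act (LinearMap.mul k H) ∘ₗ Coalgebra.comul))

/-- The multiplication `(a ⊗ x)(b ⊗ y) = a b₁ ⊗ (x ◁ b₂) y` of the right cross product of a
bialgebra `B` with multiplication `mB` and an algebra `L` on which `B` acts from the right by
`x ◁ b = act b x`. -/
def rightCrossMul {B L : Type*} [AddCommGroup B] [Module k B] [Coalgebra k B] [Ring L]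
    [Algebra k L] (mB : B →ₗ[k] B →ₗ[k] B) (act : B →ₗ[k] Module.End k L) :
    (B ⊗[k] L) →ₗ[k] (B ⊗[k] L) →ₗ[k] (B ⊗[k] L) :=
  (TensorProduct.lift
    ((LinearMap.mul k (Module.End k (B ⊗[k] L))).flip.compl₁₂
      (TensorProduct.homTensorHomMap (.id k) B L B L
        ∘ₗ TensorProduct.map mB.flip act ∘ₗ Coalgebra.comul)
      (LinearMap.lTensorHom B ∘ₗ (LinearMap.mul k L).flip))).flip

end Cross

/-! ## Diagonal actions on symmetric and exterior algebras -/

section DiagonalAction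

/-- The action of a cocommutative coalgebra `C` on the symmetric algebra of `M` extending a linear
map `act : C → End M` diagonally:
`c ▷ (w₁ ⋯ wₙ) = (c₁ ▷ w₁) ⋯ (cₙ ▷ wₙ)` and `c ▷ 1 = ε(c) 1`.
It is the transpose of the algebra map from `S(M)` to the convolution algebra `Hom(C, S(M))`
which sends `w` to `c ↦ c ▷ w`. -/
def symDiagonalAct {k C M : Type*} [CommRing k] [AddCommGroup C] [Module k C] [Coalgebra k C]
    [Coalgebra.IsCocomm k C] [AddCommGroup M] [Module k M] (act : C →ₗ[k] Module.End k M) :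
    C →ₗ[k] Module.End k (SymmetricAlgebra k M) :=
  ((WithConv.linearEquiv k (C →ₗ[k] SymmetricAlgebra k M)).toLinearMap ∘ₗ
    (SymmetricAlgebra.lift
      ((WithConv.linearEquiv k (C →ₗ[k] SymmetricAlgebra k M)).symm.toLinearMap ∘ₗ
        (act.compr₂ (SymmetricAlgebra.ι k M)).flip)).toLinearMap).flip

/-- If `f c * f c = 0` for all `c` in a cocommutative coalgebra over a field, then `f` has square
zero for the convolution product. -/
theorem convMul_self_eq_zero {k C A : Type*} [Field k] [AddCommGroup C] [Module k C]
    [Coalgebra k C] [Coalgebra.IsCocomm k C] [Ring A] [Algebra k A] (f : C →ₗ[k] A)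
    (hf : ∀ c, f c * f c = 0) :
    WithConv.toConv f * WithConv.toConv f = 0 := by
  classical
  have hanti : ∀ x y, f x * f y + f y * f x = 0 := by
    intro x y
    have h := hf (x + y)
    simp only [map_add, add_mul, mul_add, hf, zero_add, add_zero] at h
    rw [add_comm]; exact h
  ext c
  change LinearMap.mul' k A (TensorProduct.map f f (Coalgebra.comul c)) = 0
  let b := Module.Basis.ofVectorSpace k C
  let bb := b.tensorProduct b
  set t : C ⊗[k] C := Coalgebra.comul c with ht
  have hsymm : ∀ i j, bb.repr t (i, j) = bb.repr t (j, i) := by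
    have key : ∀ (z : C ⊗[k] C) i j,
        bb.repr (TensorProduct.comm k C C z) (i, j) = bb.repr z (j, i) := by
      intro z i j
      induction z with
      | zero => simp
      | tmul x y => simp [bb, mul_comm]
      | add x y hx hy => simp only [map_add, Finsupp.add_apply, hx, hy]
    intro i j
    rw [← key, ht, Coalgebra.comm_comul]
  rw [← bb.linearCombination_repr t, Finsupp.linearCombination_apply, Finsupp.sum, map_sum,
    map_sum]
  refine Finset.sum_involution (fun p _ => (p.2, p.1)) ?_ ?_ ?_ ?_
  · rintro ⟨i, j⟩ -
    simp only [map_smul, bb, Module.Basis.tensorProduct_apply, TensorProduct.map_tmul,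
      LinearMap.mul'_apply]
    rw [show (b.tensorProduct b).repr t (j, i) = (b.tensorProduct b).repr t (i, j) from hsymm j i,
      ← smul_add, hanti, smul_zero]
  · rintro ⟨i, j⟩ - hne heq
    obtain rfl : j = i := congrArg Prod.fst heq
    exact hne (by simp [bb, hf])
  · rintro ⟨i, j⟩ h
    rw [Finsupp.mem_support_iff] at h ⊢
    rwa [hsymm j i]
  · rintro ⟨i, j⟩ -
    rfl

/-- The map `w ↦ (c ↦ act c w)` from `M` to the convolution algebra `Hom(C, Λ(M))`. -/
def extActAux {k C M : Type*} [Field k] [AddCommGroup C] [Module k C] [Coalgebra k C]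
    [AddCommGroup M] [Module k M] (act : C →ₗ[k] Module.End k M) :
    M →ₗ[k] WithConv (C →ₗ[k] ExteriorAlgebra k M) :=
  (WithConv.linearEquiv k (C →ₗ[k] ExteriorAlgebra k M)).symm.toLinearMap ∘ₗ
    (act.compr₂ (ExteriorAlgebra.ι k)).flip

theorem extActAux_mul_self {k C M : Type*} [Field k] [AddCommGroup C] [Module k C] [Coalgebra k C]
    [Coalgebra.IsCocomm k C] [AddCommGroup M] [Module k M] (act : C →ₗ[k] Module.End k M) (w : M) :
    extActAux act w * extActAux act w = 0 :=
  convMul_self_eq_zero _ fun _ => ExteriorAlgebra.ι_sq_zero _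

/-- The action of a cocommutative coalgebra `C` on the exterior algebra of `M` extending a linear
map `act : C → End M` diagonally:
`(w₁ ∧ ⋯ ∧ wₙ) ◁ c = (w₁ ◁ c₁) ∧ ⋯ ∧ (wₙ ◁ cₙ)` and `1 ◁ c = ε(c) 1`.
It is the transpose of the algebra map from `Λ(M)` to the convolution algebra `Hom(C, Λ(M))`
which sends `w` to `c ↦ w ◁ c`. -/
def extDiagonalAct {k C M : Type*} [Field k] [AddCommGroup C] [Module k C] [Coalgebra k C]
    [Coalgebra.IsCocomm k C] [AddCommGroup M] [Module k M] (act : C →ₗ[k] Module.End k M) :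
    C →ₗ[k] Module.End k (ExteriorAlgebra k M) :=
  ((WithConv.linearEquiv k (C →ₗ[k] ExteriorAlgebra k M)).toLinearMap ∘ₗ
    (ExteriorAlgebra.lift k ⟨extActAux act, extActAux_mul_self act⟩).toLinearMap).flip

end DiagonalAction

/-! ## The super-coalgebra structure of the exterior algebra -/

section Exterior

variable (k M : Type*) [CommRing k] [AddCommGroup M] [Module k M]

/-- The super-coproduct of the exterior algebra: the algebra map from `Λ(M)` to the super
tensor product of `Λ(M)` with itself for which each `w` in `M` is primitive. -/
def extComul : ExteriorAlgebra k M →ₗ[k] ExteriorAlgebra k M ⊗[k] ExteriorAlgebra k M :=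
  let 𝒢 : ℕ → Submodule k (ExteriorAlgebra k M) := fun n => ⋀[k]^n M
  (GradedTensorProduct.of k 𝒢 𝒢).symm.toLinearMap ∘ₗ
    (ExteriorAlgebra.lift k
      ⟨((GradedTensorProduct.includeLeft 𝒢 𝒢).toLinearMap +
          (GradedTensorProduct.includeRight 𝒢 𝒢).toLinearMap) ∘ₗ ExteriorAlgebra.ι k, by
        intro w
        have h1 : ExteriorAlgebra.ι k w ∈ 𝒢 1 := by simp [𝒢]
        have h := GradedTensorProduct.tmul_coe_mul_coe_tmul (R := k) 𝒢 𝒢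
          1 ⟨_, h1⟩ ⟨_, h1⟩ 1
        simp only [LinearMap.comp_apply, LinearMap.add_apply, AlgHom.toLinearMap_apply, mul_add,
          add_mul, ← map_mul, ExteriorAlgebra.ι_sq_zero, map_zero]
        simp only [GradedTensorProduct.includeLeft_apply, GradedTensorProduct.includeRight_apply]
        rw [h]
        have h' := GradedTensorProduct.tmul_one_mul_one_tmul (R := k) 𝒢 𝒢
          (ExteriorAlgebra.ι k w) (ExteriorAlgebra.ι k w)
        rw [h']
        simp⟩).toLinearMap

/-- The degree-`n` part `B ⊗ Λⁿ(M)` of `B ⊗ Λ(M)`. -/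
def extTensorGrading (B : Type*) [AddCommGroup B] [Module k B] (n : ℕ) :
    Submodule k (B ⊗[k] ExteriorAlgebra k M) :=
  LinearMap.range (LinearMap.lTensor B (⋀[k]^n M).subtype)

/-- The surjection of `B ⊗ Λⁿ(M)` onto the degree-`n` part. -/
def extTensorPart (B : Type*) [AddCommGroup B] [Module k B] (n : ℕ) :
    B ⊗[k] (⋀[k]^n M) →ₗ[k] extTensorGrading k M B n :=
  (LinearMap.lTensor B (⋀[k]^n M).subtype).rangeRestrict

/-- The map splitting an element of `B ⊗ Λ(M)` into its homogeneous parts. -/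
def extTensorDecompose (B : Type*) [AddCommGroup B] [Module k B] :
    (B ⊗[k] ExteriorAlgebra k M) →ₗ[k] DirectSum ℕ fun n => extTensorGrading k M B n :=
  DirectSum.lmap (extTensorPart k M B)
    ∘ₗ (TensorProduct.directSumRight k k B (fun n => ⋀[k]^n M)).toLinearMap
    ∘ₗ LinearMap.lTensor B
      (DirectSum.decomposeLinearEquiv (fun n : ℕ => ⋀[k]^n M)).toLinearMap

theorem extTensorDecompose_tmul (B : Type*) [AddCommGroup B] [Module k B] (n : ℕ) (b : B)
    (x : ⋀[k]^n M) :
    extTensorDecompose k M B (b ⊗ₜ[k] (x : ExteriorAlgebra k M)) =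
      DirectSum.lof k ℕ (fun n => extTensorGrading k M B n) n
        (extTensorPart k M B n (b ⊗ₜ[k] x)) := by
  simp only [extTensorDecompose, LinearMap.comp_apply, LinearMap.lTensor_tmul,
    LinearEquiv.coe_coe, DirectSum.decomposeLinearEquiv_apply, DirectSum.decompose_coe]
  rw [← DirectSum.lof_eq_of k, TensorProduct.directSumRight_tmul_lof, DirectSum.lmap_lof]

instance extTensorDecomposition (B : Type*) [AddCommGroup B] [Module k B] :
    DirectSum.Decomposition (extTensorGrading k M B) :=
  DirectSum.Decomposition.ofLinearMap (extTensorGrading k M B) (extTensorDecompose k M B)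
    (by
      refine TensorProduct.ext (LinearMap.ext fun b =>
        DirectSum.decompose_lhom_ext (fun n : ℕ => ⋀[k]^n M) fun n => LinearMap.ext fun x => ?_)
      change DirectSum.coeLinearMap (extTensorGrading k M B)
        (extTensorDecompose k M B (b ⊗ₜ[k] (x : ExteriorAlgebra k M))) = b ⊗ₜ[k] x.1
      rw [extTensorDecompose_tmul, DirectSum.coeLinearMap_lof]
      rfl)
    (by
      refine DirectSum.linearMap_ext k fun n => LinearMap.ext ?_
      rintro ⟨_, y, rfl⟩
      simp only [LinearMap.comp_apply, DirectSum.coeLinearMap_lof, LinearMap.id_apply]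
      change extTensorDecompose k M B (LinearMap.lTensor B (⋀[k]^n M).subtype y) =
        DirectSum.lof k ℕ (fun n => extTensorGrading k M B n) n (extTensorPart k M B n y)
      induction y with
      | zero => simp only [map_zero]
      | tmul b x => exact extTensorDecompose_tmul k M B n b x
      | add y z hy hz => simp only [map_add, hy, hz])

end Exterior

/-! ## The cotangent construction -/

section Cotangent

open Coalgebra

variable (k H V : Type*) [Field k] [Ring H] [HopfAlgebra k H] [IsCocomm k H]
  [AddCommGroup V] [Module k V] [Coalgebra k V] [IsCocomm k V] [Module H V] [IsScalarTower k H V]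

/-- The compatibility of the left `H`-action with the coalgebra structure of `V`: the action
`H ⊗ V → V` is a coalgebra map, i.e. `Δ(h ▷ v) = h₁ ▷ v₁ ⊗ h₂ ▷ v₂`, `ε(h ▷ v) = ε(h) ε(v)`. -/
structure IsModuleCoalgebra : Prop where
  comul_smul : ∀ (h : H) (v : V), comul (R := k) (h • v) =
    TensorProduct.map (TensorProduct.lift (Algebra.lsmul k k V).toLinearMap)
      (TensorProduct.lift (Algebra.lsmul k k V).toLinearMap) (comul (R := k) (h ⊗ₜ[k] v))
  counit_smul : ∀ (h : H) (v : V), counit (R := k) (h • v) = counit (R := k) h * counit (R := k) v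

/-- The augmentation ideal `H⁺ = ker ε`. -/
abbrev Aug : Submodule k H := LinearMap.ker (counit (R := k) (A := H))

/-- The projection `π : H → H⁺`, `π(h) = h - ε(h) 1`. -/
def augProj : H →ₗ[k] Aug k H :=
  LinearMap.codRestrict (Aug k H) (LinearMap.id - Algebra.linearMap k H ∘ₗ counit) fun h => by
    simp

/-- `ω : H⁺ → V` is a map of right `H`-modules, where `H⁺` carries the right multiplication and
`V` the right action `v ◁ h = S(h) ▷ v`. -/
def IsRightModuleMap (ω : Aug k H →ₗ[k] V) : Prop :=
  ∀ (x y : Aug k H) (h : H), (y : H) = x * h → ω y = HopfAlgebra.antipode k h • ω x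

/-- The dual algebra `V*`: the linear dual of the coalgebra `V` with the convolution product
`⟨φ * ψ, v⟩ = ⟨φ, v₁⟩ ⟨ψ, v₂⟩`. -/
abbrev DualAlg : Type _ := WithConv (V →ₗ[k] k)

/-- The left action of `H` on `V*`, `⟨h ▷ φ, v⟩ = ⟨φ, S(h) ▷ v⟩`. -/
def dualAct : H →ₗ[k] Module.End k (DualAlg k V) :=
  LinearMap.compr₂ (LinearMap.compl₂
      ((LinearMap.llcomp k V V k).flip ∘ₗ (Algebra.lsmul k k V).toLinearMap
        ∘ₗ HopfAlgebra.antipode k)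
      (WithConv.linearEquiv k (V →ₗ[k] k)).toLinearMap)
    (WithConv.linearEquiv k (V →ₗ[k] k)).symm.toLinearMap

/-- The underlying space (and coalgebra) `S(V*) ⊗ H` of the cross product `S(V*) ⋊ H`. -/
abbrev CoSpace : Type _ := SymmetricAlgebra k (DualAlg k V) ⊗[k] H

/-- The Hopf algebra structure of `S(V*) ⋊ H`: cross product algebra by the action of `H` on
`S(V*)` induced by the one on `V*`, and tensor product coalgebra. -/
def coHopf : HopfOps k (CoSpace k H V) where
  mul := leftCrossMul (symDiagonalAct (dualAct k H V))
  one := 1 ⊗ₜ 1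
  comul := comul
  counit := counit

/-- The right action of `S(V*) ⋊ H` on `V* ⊕ V`: for `Φ = φ₁ ⋯ φₙ`,
`(ψ + v) ◁ (Φ h) = (-1)ⁿ S(h) ▷ (φ₁ * ⋯ * φₙ * ψ) + ε(Φ) S(h) ▷ v`. -/
def formAct : CoSpace k H V →ₗ[k] Module.End k (DualAlg k V × V) :=
  TensorProduct.lift <|
    ((LinearMap.mul k (Module.End k (DualAlg k V))).flip.compl₁₂
        (LinearMap.mul k (DualAlg k V) ∘ₗ
          (SymmetricAlgebra.lift ((-1 : k) • (LinearMap.id : DualAlg k V →ₗ[k] DualAlg k V))).toLinearMap)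
        (dualAct k H V ∘ₗ HopfAlgebra.antipode k)).compr₂
      (LinearMap.llcomp k _ _ _ (LinearMap.inl k (DualAlg k V) V) ∘ₗ
        (LinearMap.llcomp k _ _ _).flip (LinearMap.fst k (DualAlg k V) V)) +
    ((LinearMap.lsmul k (Module.End k V)).compl₁₂ (counit (R := k))
        ((Algebra.lsmul k k V).toLinearMap ∘ₗ HopfAlgebra.antipode k)).compr₂
      (LinearMap.llcomp k _ _ _ (LinearMap.inr k (DualAlg k V) V) ∘ₗ
        (LinearMap.llcomp k _ _ _).flip (LinearMap.snd k (DualAlg k V) V))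

/-- The exterior algebra `Λ(V* ⊕ V)`. -/
abbrev Forms : Type _ := ExteriorAlgebra k (DualAlg k V × V)

/-- The underlying space of `(S(V*) ⋊ H) ⋉ Λ(V* ⊕ V)`. -/
abbrev OmegaSpace : Type _ := CoSpace k H V ⊗[k] Forms k V

/-- The super-Hopf algebra structure of `(S(V*) ⋊ H) ⋉ Λ(V* ⊕ V)`: cross product algebra by the
right action on forms, and tensor product of the coalgebra `S(V*) ⊗ H` (which has degree `0`)
with the super-coalgebra `Λ(V* ⊕ V)`. -/
def omegaHopf : HopfOps k (OmegaSpace k H V) where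
  mul := rightCrossMul (coHopf k H V).mul (extDiagonalAct (formAct k H V))
  one := (coHopf k H V).one ⊗ₜ 1
  comul := (TensorProduct.tensorTensorTensorComm k _ _ _ _).toLinearMap ∘ₗ
    TensorProduct.map (coHopf k H V).comul (extComul k (DualAlg k V × V))
  counit := TensorProduct.lift ((LinearMap.mul k k).compl₁₂ (coHopf k H V).counit
    (ExteriorAlgebra.algebraMapInv (R := k) (M := DualAlg k V × V)).toLinearMap)

/-- The grading of `(S(V*) ⋊ H) ⋉ Λ(V* ⊕ V)` by the degree of forms. -/
abbrev omegaGrading : ℕ → Submodule k (OmegaSpace k H V) :=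
  extTensorGrading k (DualAlg k V × V) (CoSpace k H V)

/-- The inclusion `a ↦ a ⊗ 1` of `S(V*) ⋊ H`. -/
def omegaIncl : CoSpace k H V →ₗ[k] OmegaSpace k H V :=
  (TensorProduct.mk k (CoSpace k H V) (Forms k V)).flip 1

variable {k H V}

/-- The element `Φ h ⊗ η`, for `Φ` in `S(V*)`, `h` in `H` and `η` in `Λ(V* ⊕ V)`. -/
def omegaElt (Φ : SymmetricAlgebra k (DualAlg k V)) (h : H) (η : Forms k V) : OmegaSpace k H V :=
  (Φ ⊗ₜ[k] h) ⊗ₜ[k] η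

/-- The form in `Λ¹` given by `φ` in `V*`. -/
def coForm (φ : DualAlg k V) : Forms k V := ExteriorAlgebra.ι k (φ, 0)

/-- The form in `Λ¹` given by `v` in `V`. -/
def vForm (v : V) : Forms k V := ExteriorAlgebra.ι k (0, v)

/-- The product `∏ φᵢ` in `S(V*)` over a finite set of indices. -/
def symProd {n : ℕ} (φ : Fin n → DualAlg k V) (s : Finset (Fin n)) :
    SymmetricAlgebra k (DualAlg k V) :=
  ∏ i ∈ s, SymmetricAlgebra.ι k (DualAlg k V) (φ i)

/-- The commutator in `(S(V*) ⋊ H) ⋉ Λ(V* ⊕ V)`. -/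
def omegaComm (x y : OmegaSpace k H V) : OmegaSpace k H V :=
  (omegaHopf k H V).mul x y - (omegaHopf k H V).mul y x

end Cotangent

/-- The `(p, n - p)`-shuffles: permutations that are increasing on the first `p` and on the last
`n - p` indices. -/
def shuffles (p n : ℕ) : Finset (Equiv.Perm (Fin n)) :=
  open Classical in
  {σ : Equiv.Perm (Fin n) |
    (∀ i j : Fin n, i < j → (j : ℕ) < p → σ i < σ j) ∧
    (∀ i j : Fin n, i < j → p ≤ (i : ℕ) → σ i < σ j)}

/-- The first `p` indices. -/
def firstIdx (p n : ℕ) : Finset (Fin n) := {i : Fin n | (i : ℕ) < p}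

/-- The last `n - p` indices. -/
def lastIdx (p n : ℕ) : Finset (Fin n) := {i : Fin n | p ≤ (i : ℕ)}

end

/-!
# The cotangent calculus on `S(V*) ⋊ H`

Write `B = S(V*) ⋊ H` and `W = V* ⊕ V`. Everything rests on two facts: the coalgebra `B` is
cocommutative, and there is a linear map `θ : B → W` satisfying the cocycle identity
`θ(a b) = θ(a) ◁ b + ε(a) θ(b)`. The differential is `d(b ⊗ η) = b₁ ⊗ θ(b₂) ∧ η`.

For a cocommutative Hopf algebra `B` acting on a vector space `W` from the right, such a `θ` always
gives a strongly bicovariant calculus on `B ⋉ Λ(W)`: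

* `d² = 0`, because `θ(b₁) ∧ θ(b₂)` is antisymmetric in the two factors of the symmetric tensor
  `b₁ ⊗ b₂` (`cocycleDiff_cocycleDiff`);
* the Leibniz rule is the cocycle identity, applied to right multiplication by `b ⊗ 1`, since
  right multiplication by `1 ⊗ ξ` commutes with `d` (`cocycleDiff_rightAct`, `cocycleDiff_mul`);
* compatibility of `d` with the coproduct holds because the forms of degree one are primitive
  (`comul_cocycleDiff`);
* `1 ⊗ θ(b) = S(b₁) d(b₂)`, so the calculus is standard if `θ` is onto (`isStandard`).

In the cotangent case, `V*` is a right `B`-module with a distinguished element, the unit `1` of the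
convolution product, and the `V*`-component of `θ` is the coboundary `ε(b) 1 - 1 ◁ b`. Its
`V`-component is `Φ h ↦ ε(Φ) ω(π(h))`, for which the cocycle identity says that `ω` is a module map
(`cotangentCocycle_mul`). That `B` acts on `W` at all uses `S(h₂) ▷ ((h₁ ▷ x) y) = x (S(h) ▷ y)`
(`antipode_act_mul`), and hence that the antipode of a cocommutative Hopf algebra is a coalgebra map
(`comul_antipode`).

The Hopf algebra axioms for the two cross products are proved in general: associativity and
compatibility with the coproduct amount to the equivariance of the multiplication and of the
coproduct under diagonal actions (`leftCrossOps_isHopf`, `IsRightAction.isSuperHopf`).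

The explicit formulas expand the coproduct `Δ(φ₁ ⋯ φₙ) = ∑ φ_s ⊗ φ_{sᶜ}` over the subsets `s` of the
indices, where subsets with `p` elements are the same as `(p, n - p)`-shuffles (`sum_shuffles`).
-/

set_option linter.unusedSectionVars false

noncomputable section

open TensorProduct Coalgebra

namespace Cotangent

/-! ### Diagonal actions of a coalgebra on tensor products -/

section TensorAct

variable {k C D M N P Q M' N' : Type*} [CommRing k] [AddCommGroup C] [Module k C]
  [AddCommGroup D] [Module k D] [AddCommGroup M] [Module k M] [AddCommGroup N] [Module k N]
  [AddCommGroup P] [Module k P] [AddCommGroup Q] [Module k Q]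
  [AddCommGroup M'] [Module k M'] [AddCommGroup N'] [Module k N']

/-- The external tensor product `c ⊗ d ↦ f c ⊗ g d` of two families of linear maps. -/
def pairMap (f : C →ₗ[k] M →ₗ[k] M') (g : D →ₗ[k] N →ₗ[k] N') :
    C ⊗[k] D →ₗ[k] M ⊗[k] N →ₗ[k] M' ⊗[k] N' :=
  homTensorHomMap (.id k) M N M' N' ∘ₗ map f g

@[simp]
theorem pairMap_tmul (f : C →ₗ[k] M →ₗ[k] M') (g : D →ₗ[k] N →ₗ[k] N') (c : C) (d : D) :
    pairMap f g (c ⊗ₜ d) = map (f c) (g d) := rfl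

theorem pairMap_apply_tmul (f : C →ₗ[k] M →ₗ[k] M') (g : D →ₗ[k] N →ₗ[k] N') (t : C ⊗[k] D)
    (x : M) (y : N) : pairMap f g t (x ⊗ₜ y) = map (f.flip x) (g.flip y) t := by
  induction t with
  | zero => simp
  | tmul c d => simp
  | add s t hs ht => simp only [map_add, LinearMap.add_apply, hs, ht]

/-- If `T` and `U` intertwine two families of endomorphisms, then so does `T ⊗ U`. -/
theorem map_pairMap {a : C →ₗ[k] Module.End k M} {a' : C →ₗ[k] Module.End k M'}
    {b : D →ₗ[k] Module.End k N} {b' : D →ₗ[k] Module.End k N'}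
    {T : M →ₗ[k] M'} {U : N →ₗ[k] N'} (hT : ∀ c x, T (a c x) = a' c (T x))
    (hU : ∀ c x, U (b c x) = b' c (U x)) (t : C ⊗[k] D) (x : M ⊗[k] N) :
    map T U (pairMap a b t x) = pairMap a' b' t (map T U x) := by
  induction t with
  | zero => simp
  | add s t hs ht => simp only [map_add, LinearMap.add_apply, hs, ht]
  | tmul c d =>
    induction x with
    | zero => simp
    | add x y hx hy => simp only [map_add, hx, hy]
    | tmul m n => simp [hT, hU]

theorem pairMap_map₂ {m : C →ₗ[k] C →ₗ[k] C} {n : D →ₗ[k] D →ₗ[k] D}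
    {a : C →ₗ[k] Module.End k M} {b : D →ₗ[k] Module.End k N}
    (ha : ∀ c d, a (m c d) = a c ∘ₗ a d) (hb : ∀ c d, b (n c d) = b c ∘ₗ b d)
    (s t : C ⊗[k] D) :
    pairMap a b (map₂ m n s t) = pairMap a b s ∘ₗ pairMap a b t := by
  induction s with
  | zero => simp
  | add s s' hs hs' => simp only [map_add, LinearMap.add_apply, LinearMap.add_comp, hs, hs']
  | tmul c d =>
    induction t with
    | zero => simp
    | add s s' hs hs' => simp only [map_add, LinearMap.comp_add, hs, hs']
    | tmul c' d' => simp [ha, hb, map_comp]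

theorem tensorTensorTensorComm_pairMap (a : C →ₗ[k] Module.End k M) (b : C →ₗ[k] Module.End k N)
    (a' : C →ₗ[k] Module.End k P) (b' : C →ₗ[k] Module.End k Q)
    (t : (C ⊗[k] C) ⊗[k] (C ⊗[k] C)) (x : (M ⊗[k] N) ⊗[k] (P ⊗[k] Q)) :
    tensorTensorTensorComm k M N P Q (pairMap (pairMap a b) (pairMap a' b') t x) =
      pairMap (pairMap a a') (pairMap b b') (tensorTensorTensorComm k C C C C t)
        (tensorTensorTensorComm k M N P Q x) := by
  suffices h : ((LinearMap.llcomp k _ _ _ (tensorTensorTensorComm k M N P Q).toLinearMap) ∘ₗ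
      pairMap (pairMap a b) (pairMap a' b') :
        (C ⊗[k] C) ⊗[k] (C ⊗[k] C) →ₗ[k] (M ⊗[k] N) ⊗[k] (P ⊗[k] Q) →ₗ[k] _) =
      (pairMap (pairMap a a') (pairMap b b') ∘ₗ
        (tensorTensorTensorComm k C C C C).toLinearMap).compl₂
          (tensorTensorTensorComm k M N P Q).toLinearMap from
    LinearMap.congr_fun (LinearMap.congr_fun h t) x
  ext c d c' d' m n p q
  rfl

theorem assoc_pairMap (a : C →ₗ[k] Module.End k M) (b : C →ₗ[k] Module.End k N)
    (a' : C →ₗ[k] Module.End k P) (t : (C ⊗[k] C) ⊗[k] C) (x : (M ⊗[k] N) ⊗[k] P) :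
    TensorProduct.assoc k M N P (pairMap (pairMap a b) a' t x) =
      pairMap a (pairMap b a') (TensorProduct.assoc k C C C t)
        (TensorProduct.assoc k M N P x) := by
  suffices h : ((LinearMap.llcomp k _ _ _ (TensorProduct.assoc k M N P).toLinearMap) ∘ₗ
      pairMap (pairMap a b) a' : (C ⊗[k] C) ⊗[k] C →ₗ[k] (M ⊗[k] N) ⊗[k] P →ₗ[k] _) =
      (pairMap a (pairMap b a') ∘ₗ (TensorProduct.assoc k C C C).toLinearMap).compl₂
          (TensorProduct.assoc k M N P).toLinearMap from
    LinearMap.congr_fun (LinearMap.congr_fun h t) x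
  ext c d c' m n p
  rfl

variable [Coalgebra k C]

/-- The diagonal action `c ↦ f c₁ ⊗ g c₂` on a tensor product. -/
def tensorAct (f : C →ₗ[k] M →ₗ[k] M') (g : C →ₗ[k] N →ₗ[k] N') :
    C →ₗ[k] M ⊗[k] N →ₗ[k] M' ⊗[k] N' :=
  pairMap f g ∘ₗ comul

theorem tensorAct_apply (f : C →ₗ[k] M →ₗ[k] M') (g : C →ₗ[k] N →ₗ[k] N') (c : C) :
    tensorAct f g c = pairMap f g (comul c) := rfl

theorem map_tensorAct {a : C →ₗ[k] Module.End k M} {a' : C →ₗ[k] Module.End k M'}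
    {b : C →ₗ[k] Module.End k N} {b' : C →ₗ[k] Module.End k N'}
    {T : M →ₗ[k] M'} {U : N →ₗ[k] N'} (hT : ∀ c x, T (a c x) = a' c (T x))
    (hU : ∀ c x, U (b c x) = b' c (U x)) (c : C) (x : M ⊗[k] N) :
    map T U (tensorAct a b c x) = tensorAct a' b' c (map T U x) :=
  map_pairMap hT hU _ x

theorem tensorAct_mul {m : C →ₗ[k] C →ₗ[k] C}
    (hm : ∀ c d, comul (R := k) (m c d) = map₂ m m (comul c) (comul d))
    {a : C →ₗ[k] Module.End k M} {b : C →ₗ[k] Module.End k N}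
    (ha : ∀ c d, a (m c d) = a c ∘ₗ a d) (hb : ∀ c d, b (m c d) = b c ∘ₗ b d) (c d : C) :
    tensorAct a b (m c d) = tensorAct a b c ∘ₗ tensorAct a b d := by
  rw [tensorAct_apply, hm, pairMap_map₂ ha hb]; rfl

theorem pairMap_comul_comul (f : C →ₗ[k] M →ₗ[k] M') (g : C →ₗ[k] N →ₗ[k] N')
    (f' : C →ₗ[k] P →ₗ[k] P) (g' : C →ₗ[k] Q →ₗ[k] Q) (t : C ⊗[k] C) :
    pairMap (tensorAct f g) (tensorAct f' g') t =
      pairMap (pairMap f g) (pairMap f' g') (map comul comul t) := by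
  induction t with
  | zero => simp
  | tmul c d => rfl
  | add s t hs ht => simp only [map_add, hs, ht]

theorem tensorTensorTensorComm_comul_comul [IsCocomm k C] (c : C) :
    tensorTensorTensorComm k C C C C (map comul comul (comul (R := k) c)) =
      map comul comul (comul (R := k) c) :=
  (LinearMap.congr_fun (comulCoalgHom k C).map_comp_comul c).symm

/-- Over a cocommutative coalgebra, exchanging the two middle factors of a fourfold tensor product
is equivariant. -/
theorem tensorTensorTensorComm_tensorAct [IsCocomm k C] (a : C →ₗ[k] Module.End k M)
    (b : C →ₗ[k] Module.End k N) (a' : C →ₗ[k] Module.End k P) (b' : C →ₗ[k] Module.End k Q)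
    (c : C) (x : (M ⊗[k] N) ⊗[k] (P ⊗[k] Q)) :
    tensorTensorTensorComm k M N P Q (tensorAct (tensorAct a b) (tensorAct a' b') c x) =
      tensorAct (tensorAct a a') (tensorAct b b') c (tensorTensorTensorComm k M N P Q x) := by
  rw [tensorAct_apply, tensorAct_apply, pairMap_comul_comul, pairMap_comul_comul,
    tensorTensorTensorComm_pairMap, tensorTensorTensorComm_comul_comul]

theorem pairMap_tensorAct_left (f : C →ₗ[k] Module.End k M) (g : C →ₗ[k] Module.End k N)
    (f' : D →ₗ[k] Module.End k P) (t : C ⊗[k] D) :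
    pairMap (tensorAct f g) f' t = pairMap (pairMap f g) f' (LinearMap.rTensor D comul t) := by
  induction t with
  | zero => simp
  | tmul c d => rfl
  | add s t hs ht => simp only [map_add, hs, ht]

theorem pairMap_tensorAct_right (f : D →ₗ[k] Module.End k M) (g : C →ₗ[k] Module.End k N)
    (f' : C →ₗ[k] Module.End k P) (t : D ⊗[k] C) :
    pairMap f (tensorAct g f') t = pairMap f (pairMap g f') (LinearMap.lTensor D comul t) := by
  induction t with
  | zero => simp
  | tmul c d => rfl
  | add s t hs ht => simp only [map_add, hs, ht]

theorem assoc_tensorAct (a : C →ₗ[k] Module.End k M) (b : C →ₗ[k] Module.End k N)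
    (a' : C →ₗ[k] Module.End k P) (c : C) (x : (M ⊗[k] N) ⊗[k] P) :
    TensorProduct.assoc k M N P (tensorAct (tensorAct a b) a' c x) =
      tensorAct a (tensorAct b a') c (TensorProduct.assoc k M N P x) := by
  rw [tensorAct_apply, tensorAct_apply, pairMap_tensorAct_left, pairMap_tensorAct_right,
    assoc_pairMap, coassoc_apply]

/-- In a cocommutative coalgebra, `c₁ ⊗ c₂ ⊗ c₃` is invariant under exchanging the last two
factors. -/
theorem rightComm_comul [IsCocomm k C] (c : C) :
    TensorProduct.rightComm k C C C (LinearMap.rTensor C comul (comul (R := k) c)) =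
      LinearMap.rTensor C comul (comul (R := k) c) := by
  apply (TensorProduct.assoc k C C C).injective
  have h : ∀ t : (C ⊗[k] C) ⊗[k] C,
      TensorProduct.assoc k C C C (TensorProduct.rightComm k C C C t) =
        LinearMap.lTensor C (TensorProduct.comm k C C).toLinearMap
          (TensorProduct.assoc k C C C t) := by
    intro t
    have : (TensorProduct.assoc k C C C).toLinearMap ∘ₗ
        (TensorProduct.rightComm k C C C).toLinearMap =
        LinearMap.lTensor C (TensorProduct.comm k C C).toLinearMap ∘ₗ
          (TensorProduct.assoc k C C C).toLinearMap := by
      ext; rfl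
    exact LinearMap.congr_fun this t
  rw [h, coassoc_apply, ← LinearMap.comp_apply, ← LinearMap.lTensor_comp]
  congr 2
  ext d
  exact comm_comul k d

end TensorAct

/-! ### Module algebras -/

section ModuleAlgebra

variable {k C A : Type*} [CommRing k] [AddCommGroup C] [Module k C] [Coalgebra k C]
  [Ring A] [Algebra k A]

/-- `act` makes `A` a module algebra over the coalgebra `C` with multiplication `m` and unit `e`.
A right module algebra is a left one for the opposite multiplication `m.flip`. -/
structure IsModuleAlg (m : C →ₗ[k] C →ₗ[k] C) (e : C) (act : C →ₗ[k] Module.End k A) : Prop where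
  act_one : act e = LinearMap.id
  act_mul : ∀ c d, act (m c d) = act c ∘ₗ act d
  map_one : ∀ c, act c 1 = counit (R := k) c • (1 : A)
  map_mul : ∀ c x, act c (LinearMap.mul' k A x) = LinearMap.mul' k A (tensorAct act act c x)

/-- The action of a coalgebra `C` on `A` which is the transpose of an algebra map from `A` to the
convolution algebra `Hom(C, A)`. -/
def transposeAct (ρ : A →ₐ[k] WithConv (C →ₗ[k] A)) : C →ₗ[k] Module.End k A :=
  ((WithConv.linearEquiv k (C →ₗ[k] A)).toLinearMap ∘ₗ ρ.toLinearMap).flip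

theorem transposeAct_apply (ρ : A →ₐ[k] WithConv (C →ₗ[k] A)) (c : C) (x : A) :
    transposeAct ρ c x = (ρ x).ofConv c := rfl

theorem transposeAct_one (ρ : A →ₐ[k] WithConv (C →ₗ[k] A)) (c : C) :
    transposeAct ρ c 1 = counit (R := k) c • (1 : A) := by
  rw [transposeAct_apply, map_one, LinearMap.convOne_apply, Algebra.algebraMap_eq_smul_one]

theorem transposeAct_mul' (ρ : A →ₐ[k] WithConv (C →ₗ[k] A)) (c : C) (x : A ⊗[k] A) :
    transposeAct ρ c (LinearMap.mul' k A x) =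
      LinearMap.mul' k A (tensorAct (transposeAct ρ) (transposeAct ρ) c x) := by
  induction x with
  | zero => simp
  | add x y hx hy => simp only [map_add, hx, hy]
  | tmul x y =>
    rw [LinearMap.mul'_apply, transposeAct_apply, map_mul, LinearMap.convMul_apply,
      tensorAct_apply, pairMap_apply_tmul]
    rfl

/-- The elements on which a compatible `act` satisfies the law of an action are closed under
multiplication. -/
theorem act_mul_of_mul {m : C →ₗ[k] C →ₗ[k] C}
    (hm : ∀ c d, comul (R := k) (m c d) = map₂ m m (comul c) (comul d))
    {act : C →ₗ[k] Module.End k A}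
    (hact : ∀ c x, act c (LinearMap.mul' k A x) = LinearMap.mul' k A (tensorAct act act c x))
    {x y : A} (hx : ∀ c d, act (m c d) x = act c (act d x))
    (hy : ∀ c d, act (m c d) y = act c (act d y)) (c d : C) :
    act (m c d) (x * y) = act c (act d (x * y)) := by
  have key : ∀ s t : C ⊗[k] C, pairMap act act (map₂ m m s t) (x ⊗ₜ y) =
      pairMap act act s (pairMap act act t (x ⊗ₜ y)) := by
    intro s t
    induction s with
    | zero => simp
    | add s s' hs hs' => simp only [map_add, LinearMap.add_apply, hs, hs']
    | tmul c d =>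
      induction t with
      | zero => simp
      | add s s' hs hs' => simp only [map_add, LinearMap.add_apply, hs, hs']
      | tmul c' d' => simp [hx, hy]
  rw [← LinearMap.mul'_apply (R := k), hact, hact, hact, tensorAct_apply, hm, key]
  rfl

end ModuleAlgebra

/-! ### Left cross products -/

/-- For the ordinary flip, `HopfOps.tensorMul` is the componentwise multiplication. -/
theorem tensorMul_comm {k A : Type*} [CommRing k] [AddCommGroup A] [Module k A]
    (X : HopfOps k A) (u v : A ⊗[k] A) :
    X.tensorMul (TensorProduct.comm k A A).toLinearMap (u ⊗ₜ v) = map₂ X.mul X.mul u v := by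
  induction u with
  | zero => simp
  | add u u' h h' => simp only [add_tmul, map_add, LinearMap.add_apply, h, h']
  | tmul a b =>
    induction v with
    | zero => simp
    | add u u' h h' => simp only [tmul_add, map_add, h, h']
    | tmul c d => rfl

theorem isAntipode_of_tmul {k A B : Type*} [CommRing k] [AddCommGroup A] [Module k A]
    [AddCommGroup B] [Module k B] {X : HopfOps k (A ⊗[k] B)} {S : A ⊗[k] B →ₗ[k] A ⊗[k] B}
    (h₁ : ∀ a b, X.mulT (LinearMap.rTensor _ S (X.comul (a ⊗ₜ b))) = X.counit (a ⊗ₜ b) • X.one)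
    (h₂ : ∀ a b, X.mulT (LinearMap.lTensor _ S (X.comul (a ⊗ₜ b))) = X.counit (a ⊗ₜ b) • X.one) :
    X.IsAntipode S := by
  constructor
  · intro x
    induction x with
    | zero => simp
    | add x y hx hy => simp only [map_add, hx, hy, add_smul]
    | tmul a b => exact h₁ a b
  · intro x
    induction x with
    | zero => simp
    | add x y hx hy => simp only [map_add, hx, hy, add_smul]
    | tmul a b => exact h₂ a b

section LeftCross

variable {k A H : Type*} [CommRing k] [Ring A] [Bialgebra k A] [Ring H]

theorem mul_eq_map₂ {B C : Type*} [Ring B] [Algebra k B] [Ring C] [Algebra k C]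
    (u v : B ⊗[k] C) : u * v = map₂ (LinearMap.mul k B) (LinearMap.mul k C) u v := by
  induction u with
  | zero => simp
  | add u u' h h' => simp only [add_mul, map_add, LinearMap.add_apply, h, h']
  | tmul a b =>
    induction v with
    | zero => simp
    | add u u' h h' => simp only [mul_add, map_add, h, h']
    | tmul c d => simp

theorem bialgebra_comul_mul [Bialgebra k H] (g h : H) :
    comul (R := k) (LinearMap.mul k H g h) =
      map₂ (LinearMap.mul k H) (LinearMap.mul k H) (comul g) (comul h) :=
  (Bialgebra.comul_mul g h).trans (mul_eq_map₂ _ _)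

section Bialgebra

variable [Bialgebra k H] (act : H →ₗ[k] Module.End k A)

/-- The left cross product `A ⋊ H` with the tensor product coalgebra structure. -/
def leftCrossOps : HopfOps k (A ⊗[k] H) where
  mul := leftCrossMul act
  one := 1 ⊗ₜ 1
  comul := comul
  counit := counit

/-- Left multiplication by `1 ⊗ h` in the cross product, the diagonal action of `h`. -/
abbrev crossAct : H →ₗ[k] Module.End k (A ⊗[k] H) := tensorAct act (LinearMap.mul k H)

theorem leftCrossMul_tmul (s : A) (h : H) (x : A ⊗[k] H) :
    leftCrossMul act (s ⊗ₜ h) x =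
      LinearMap.rTensor H (LinearMap.mulLeft k s) (crossAct act h x) := rfl

variable {act} (hact : IsModuleAlg (LinearMap.mul k H) 1 act)
include hact

theorem crossAct_mul (g h : H) : crossAct act (g * h) = crossAct act g ∘ₗ crossAct act h :=
  tensorAct_mul bialgebra_comul_mul hact.act_mul
    (fun c d => LinearMap.ext fun x => mul_assoc c d x) g h

theorem crossAct_one : crossAct act 1 = LinearMap.id := by
  rw [crossAct, tensorAct_apply, Bialgebra.comul_one, Algebra.TensorProduct.one_def, pairMap_tmul,
    hact.act_one]
  ext
  simp

theorem crossAct_one_tmul (g h : H) :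
    crossAct act g (1 ⊗ₜ h) = (1 : A) ⊗ₜ[k] (g * h) := by
  have key : ∀ t : H ⊗[k] H, pairMap act (LinearMap.mul k H) t (1 ⊗ₜ[k] h) =
      (1 : A) ⊗ₜ (TensorProduct.lid k H (LinearMap.rTensor H counit t) * h) := by
    intro t
    induction t with
    | zero => simp
    | add s t hs ht => simp only [map_add, LinearMap.add_apply, hs, ht, add_mul, tmul_add]
    | tmul c d => simp [hact.map_one, smul_tmul']
  rw [tensorAct_apply, key, rTensor_counit_comul]
  simp

/-- Left multiplication by `1 ⊗ h` commutes with right multiplications. This is the essential case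
of associativity. -/
theorem leftCrossMul_crossAct (h : H) (y z : A ⊗[k] H) :
    leftCrossMul act (crossAct act h y) z = crossAct act h (leftCrossMul act y z) := by
  let μ : A ⊗[k] (A ⊗[k] H) →ₗ[k] A ⊗[k] H :=
    map (LinearMap.mul' k A) LinearMap.id ∘ₗ (TensorProduct.assoc k A A H).symm.toLinearMap
  have hμ : ∀ (t : A) (z : A ⊗[k] H),
      μ (t ⊗ₜ z) = LinearMap.rTensor H (LinearMap.mulLeft k t) z := by
    intro t z
    induction z with
    | zero => simp
    | add x y hx hy => simp only [tmul_add, map_add, hx, hy]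
    | tmul u f => rfl
  have hμ' : ∀ (h : H) (x : A ⊗[k] (A ⊗[k] H)),
      μ (tensorAct act (crossAct act) h x) = crossAct act h (μ x) := by
    intro h x
    obtain ⟨x, rfl⟩ := (TensorProduct.assoc k A A H).surjective x
    rw [← assoc_tensorAct]
    simp only [μ, LinearMap.comp_apply, LinearEquiv.coe_coe, LinearEquiv.symm_apply_apply]
    exact (map_tensorAct (fun c x => (hact.map_mul c x).symm) (fun _ _ => rfl) h x)
  induction y with
  | zero => simp
  | add x y hx hy => simp only [map_add, LinearMap.add_apply, hx, hy]
  | tmul t g =>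
    rw [leftCrossMul_tmul, ← hμ, ← hμ', tensorAct_apply, tensorAct_apply]
    generalize comul (R := k) h = w
    induction w with
    | zero => simp
    | add x y hx hy => simp only [map_add, LinearMap.add_apply, hx, hy]
    | tmul c d =>
      simp only [pairMap_tmul, map_tmul, leftCrossMul_tmul, hμ, LinearMap.mul_apply']
      rw [crossAct_mul hact, LinearMap.comp_apply]

theorem leftCrossMul_assoc (x y z : A ⊗[k] H) :
    leftCrossMul act (leftCrossMul act x y) z = leftCrossMul act x (leftCrossMul act y z) := by
  induction x with
  | zero => simp
  | add x y hx hy => simp only [map_add, LinearMap.add_apply, hx, hy]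
  | tmul s h =>
    have hP : ∀ y, leftCrossMul act (LinearMap.rTensor H (LinearMap.mulLeft k s) y) z =
        LinearMap.rTensor H (LinearMap.mulLeft k s) (leftCrossMul act y z) := by
      intro y
      induction y with
      | zero => simp
      | add x y hx hy => simp only [map_add, LinearMap.add_apply, hx, hy]
      | tmul t g =>
        rw [LinearMap.rTensor_tmul, leftCrossMul_tmul, leftCrossMul_tmul, LinearMap.mulLeft_apply,
          LinearMap.mulLeft_mul, LinearMap.rTensor_comp, LinearMap.comp_apply]
    rw [leftCrossMul_tmul, leftCrossMul_tmul, hP, leftCrossMul_crossAct hact]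

theorem leftCrossMul_one_left (x : A ⊗[k] H) : leftCrossMul act (1 ⊗ₜ 1) x = x := by
  rw [leftCrossMul_tmul, crossAct_one hact, LinearMap.mulLeft_one, LinearMap.rTensor_id]
  rfl

theorem leftCrossMul_tmul_one_tmul (s : A) (h g : H) :
    leftCrossMul act (s ⊗ₜ h) (1 ⊗ₜ g) = s ⊗ₜ (h * g) := by
  rw [leftCrossMul_tmul, crossAct_one_tmul hact]
  simp

theorem leftCrossMul_one_right (x : A ⊗[k] H) : leftCrossMul act x (1 ⊗ₜ 1) = x := by
  induction x with
  | zero => simp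
  | add x y hx hy => simp only [map_add, LinearMap.add_apply, hx, hy]
  | tmul s h => rw [leftCrossMul_tmul_one_tmul hact, mul_one]

theorem leftCrossMul_tmul_tmul_one (s t : A) (g : H) :
    leftCrossMul act (s ⊗ₜ 1) (t ⊗ₜ g) = (s * t) ⊗ₜ[k] g := by
  rw [leftCrossMul_tmul, crossAct_one hact]
  simp

omit hact

theorem tensor_comul_apply (x : A ⊗[k] H) : comul (R := k) x =
    tensorTensorTensorComm k A A H H (map comul comul x) := by
  rw [TensorProduct.comul_def]
  rfl

theorem comul_crossAct [IsCocomm k H]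
    (hcomul : ∀ h x, comul (R := k) (act h x) = tensorAct act act h (comul x))
    (h : H) (x : A ⊗[k] H) :
    comul (R := k) (crossAct act h x) =
      tensorAct (crossAct act) (crossAct act) h (comul x) := by
  rw [tensor_comul_apply, tensor_comul_apply, ← tensorTensorTensorComm_tensorAct]
  congr 1
  refine map_tensorAct hcomul (fun c d => (bialgebra_comul_mul c d).trans ?_) h x
  rw [tensorAct_apply]
  rfl

theorem tensorTensorTensorComm_tensorTensorTensorComm {k A B C D : Type*} [CommRing k]
    [AddCommGroup A]
    [AddCommGroup B] [AddCommGroup C] [AddCommGroup D] [Module k A] [Module k B] [Module k C]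
    [Module k D] (x : (A ⊗[k] B) ⊗[k] (C ⊗[k] D)) :
    tensorTensorTensorComm k A C B D (tensorTensorTensorComm k A B C D x) = x :=
  (tensorTensorTensorComm k A B C D).symm_apply_apply x

theorem comul_leftCrossMul [IsCocomm k H]
    (hcomul : ∀ h x, comul (R := k) (act h x) = tensorAct act act h (comul x))
    (x y : A ⊗[k] H) :
    comul (R := k) (leftCrossMul act x y) =
      map₂ (leftCrossMul act) (leftCrossMul act) (comul x) (comul y) := by
  induction x with
  | zero => simp
  | add x y hx hy => simp only [map_add, LinearMap.add_apply, hx, hy]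
  | tmul s h =>
    have h1 : ∀ z : A ⊗[k] H, comul (R := k) (LinearMap.rTensor H (LinearMap.mulLeft k s) z) =
        tensorTensorTensorComm k A A H H (LinearMap.rTensor _ (LinearMap.mulLeft k (comul s))
          (tensorTensorTensorComm k A H A H (comul z))) := by
      intro z
      induction z with
      | zero => simp
      | add x y hx hy => simp only [map_add, hx, hy]
      | tmul t g =>
        simp only [tensor_comul_apply, tensorTensorTensorComm_tensorTensorTensorComm,
          LinearMap.rTensor_tmul,
          map_tmul, LinearMap.mulLeft_apply, Bialgebra.comul_mul]
    have h2 : ∀ (D : A ⊗[k] A) (E : H ⊗[k] H) (v : (A ⊗[k] H) ⊗[k] (A ⊗[k] H)),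
        map₂ (leftCrossMul act) (leftCrossMul act) (tensorTensorTensorComm k A A H H (D ⊗ₜ E)) v =
        tensorTensorTensorComm k A A H H (LinearMap.rTensor _ (LinearMap.mulLeft k D)
          (tensorTensorTensorComm k A H A H (pairMap (crossAct act) (crossAct act) E v))) := by
      intro D E v
      induction D with
      | zero => simp
      | add x y hx hy =>
        have hadd : LinearMap.mulLeft k (x + y) = LinearMap.mulLeft k x + LinearMap.mulLeft k y :=
          map_add (LinearMap.mul k (A ⊗[k] A)) x y
        simp only [add_tmul, map_add, LinearMap.add_apply, hx, hy, LinearMap.rTensor_add, hadd]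
      | tmul s s' =>
        induction E with
        | zero => simp
        | add x y hx hy => simp only [tmul_add, map_add, LinearMap.add_apply, hx, hy]
        | tmul h h' =>
          induction v with
          | zero => simp
          | add x y hx hy => simp only [map_add, hx, hy]
          | tmul p q =>
            rw [tensorTensorTensorComm_tmul, map₂_apply_tmul, map_tmul, pairMap_tmul, map_tmul,
              leftCrossMul_tmul, leftCrossMul_tmul]
            generalize crossAct act h p = p
            generalize crossAct act h' q = q
            induction p with
            | zero => simp
            | add x y hx hy => simp only [map_add, add_tmul, hx, hy]
            | tmul p p' =>
              induction q with
              | zero => simp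
              | add x y hx hy => simp only [map_add, tmul_add, hx, hy]
              | tmul q q' => simp
    rw [leftCrossMul_tmul, h1, comul_crossAct hcomul, tensor_comul_apply (s ⊗ₜ h), map_tmul, h2]
    rfl

theorem counit_leftCrossMul
    (hcounit : ∀ h x, counit (R := k) (act h x) = counit (R := k) h * counit (R := k) x)
    (x y : A ⊗[k] H) :
    counit (R := k) (leftCrossMul act x y) = counit (R := k) x * counit (R := k) y := by
  induction x with
  | zero => simp
  | add x y hx hy => simp only [map_add, LinearMap.add_apply, hx, hy, add_mul]
  | tmul s h =>
    induction y with
    | zero => simp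
    | add x y hx hy => simp only [map_add, hx, hy, mul_add]
    | tmul t g =>
      have key : ∀ w : H ⊗[k] H, counit (R := k) (LinearMap.rTensor H (LinearMap.mulLeft k s)
          (pairMap act (LinearMap.mul k H) w (t ⊗ₜ g))) =
          counit (R := k) s * counit (R := k) t * counit (R := k) g *
            counit (R := k) (TensorProduct.lid k H (LinearMap.rTensor H counit w)) := by
        intro w
        induction w with
        | zero => simp
        | add x y hx hy => simp only [map_add, LinearMap.add_apply, hx, hy, mul_add]
        | tmul c d =>
          simp [hcounit]
          ring
      rw [leftCrossMul_tmul, tensorAct_apply, key, rTensor_counit_comul]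
      simp
      ring

end Bialgebra

section Antipode

variable [HopfAlgebra k H] (act : H →ₗ[k] Module.End k A) (S : A →ₗ[k] A)

/-- The antipode `s ⊗ h ↦ (1 ⊗ S h)(S s ⊗ 1)` of the left cross product. -/
def leftCrossAntipode : A ⊗[k] H →ₗ[k] A ⊗[k] H :=
  TensorProduct.lift ((crossAct act ∘ₗ HopfAlgebra.antipode k).flip ∘ₗ
    (TensorProduct.mk k A H).flip 1 ∘ₗ S)

theorem leftCrossAntipode_tmul (s : A) (h : H) :
    leftCrossAntipode act S (s ⊗ₜ h) = crossAct act (HopfAlgebra.antipode k h) (S s ⊗ₜ 1) := rfl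

variable {act S} (hact : IsModuleAlg (LinearMap.mul k H) 1 act)
include hact

theorem leftCrossAntipode_left
    (hS : ∀ a, LinearMap.mul' k A (LinearMap.rTensor A S (comul a)) = counit (R := k) a • (1 : A))
    (s : A) (h : H) :
    TensorProduct.lift (leftCrossMul act)
      (LinearMap.rTensor _ (leftCrossAntipode act S) (comul (R := k) (s ⊗ₜ[k] h))) =
      counit (R := k) (s ⊗ₜ[k] h) • ((1 : A) ⊗ₜ[k] (1 : H)) := by
  have hs := hS s
  have hh := HopfAlgebra.mul_antipode_rTensor_comul_apply (R := k) h
  rw [tensor_comul_apply, map_tmul]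
  rw [← (ℛ k s).eq] at hs ⊢
  rw [← (ℛ k h).eq] at hh ⊢
  simp only [map_sum, LinearMap.rTensor_tmul, LinearMap.mul'_apply] at hs hh
  have key : ∀ i j, leftCrossMul act (leftCrossAntipode act S ((ℛ k s).left i ⊗ₜ (ℛ k h).left j))
      ((ℛ k s).right i ⊗ₜ (ℛ k h).right j) =
      crossAct act (HopfAlgebra.antipode k ((ℛ k h).left j))
        ((S ((ℛ k s).left i) * (ℛ k s).right i) ⊗ₜ (ℛ k h).right j) := by
    intro i j
    rw [leftCrossAntipode_tmul, leftCrossMul_crossAct hact, leftCrossMul_tmul_tmul_one hact]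
  simp only [sum_tmul, tmul_sum, map_sum, tensorTensorTensorComm_tmul, LinearMap.rTensor_tmul,
    lift.tmul, key]
  simp only [← map_sum, ← sum_tmul, hs, ← smul_tmul', map_smul, crossAct_one_tmul hact]
  rw [← Finset.smul_sum, ← tmul_sum, hh, Algebra.algebraMap_eq_smul_one, tmul_smul, smul_smul,
    TensorProduct.counit_tmul, smul_eq_mul, mul_comm]

theorem leftCrossAntipode_right
    (hS : ∀ a, LinearMap.mul' k A (LinearMap.lTensor A S (comul a)) = counit (R := k) a • (1 : A))
    (s : A) (h : H) :
    TensorProduct.lift (leftCrossMul act)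
      (LinearMap.lTensor _ (leftCrossAntipode act S) (comul (R := k) (s ⊗ₜ[k] h))) =
      counit (R := k) (s ⊗ₜ[k] h) • ((1 : A) ⊗ₜ[k] (1 : H)) := by
  have hs := hS s
  have hh := HopfAlgebra.mul_antipode_lTensor_comul_apply (R := k) h
  rw [tensor_comul_apply, map_tmul]
  rw [← (ℛ k s).eq] at hs ⊢
  rw [← (ℛ k h).eq] at hh ⊢
  simp only [map_sum, LinearMap.lTensor_tmul, LinearMap.mul'_apply] at hs hh
  have key : ∀ i j, leftCrossMul act ((ℛ k s).left i ⊗ₜ (ℛ k h).left j)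
      (leftCrossAntipode act S ((ℛ k s).right i ⊗ₜ (ℛ k h).right j)) =
      LinearMap.rTensor H (LinearMap.mulLeft k ((ℛ k s).left i))
        (crossAct act ((ℛ k h).left j * HopfAlgebra.antipode k ((ℛ k h).right j))
          (S ((ℛ k s).right i) ⊗ₜ 1)) := by
    intro i j
    rw [leftCrossAntipode_tmul, leftCrossMul_tmul, crossAct_mul hact, LinearMap.comp_apply]
  simp only [sum_tmul, tmul_sum, map_sum, tensorTensorTensorComm_tmul, LinearMap.lTensor_tmul,
    lift.tmul, key]
  rw [Finset.sum_comm]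
  simp only [← map_sum, ← LinearMap.sum_apply, hh, Algebra.algebraMap_eq_smul_one, map_smul,
    crossAct_one hact, LinearMap.smul_apply, LinearMap.id_apply, LinearMap.rTensor_tmul,
    LinearMap.mulLeft_apply]
  rw [← Finset.smul_sum, ← sum_tmul, hs, ← smul_tmul', smul_smul,
    TensorProduct.counit_tmul, smul_eq_mul]

omit hact in
theorem leftCrossOps_comul_mul [IsCocomm k H]
    (hcomul : ∀ h x, comul (R := k) (act h x) = tensorAct act act h (comul x))
    (a b : A ⊗[k] H) :
    (leftCrossOps act).comul ((leftCrossOps act).mul a b) =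
      (leftCrossOps act).tensorMul (TensorProduct.comm k _ _).toLinearMap
        ((leftCrossOps act).comul a ⊗ₜ[k] (leftCrossOps act).comul b) := by
  rw [tensorMul_comm]
  dsimp only [leftCrossOps]
  exact comul_leftCrossMul hcomul a b

/-- The left cross product of a Hopf algebra `A` by a cocommutative Hopf algebra `H`, acting on
`A` as on a module algebra and module coalgebra, is a Hopf algebra. -/
theorem leftCrossOps_isHopf [IsCocomm k H]
    (hcomul : ∀ h x, comul (R := k) (act h x) = tensorAct act act h (comul x))
    (hcounit : ∀ h x, counit (R := k) (act h x) = counit (R := k) h * counit (R := k) x)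
    (hS : ∀ a, LinearMap.mul' k A (LinearMap.rTensor A S (comul a)) = counit (R := k) a • (1 : A))
    (hS' : ∀ a, LinearMap.mul' k A (LinearMap.lTensor A S (comul a)) =
      counit (R := k) a • (1 : A)) :
    (leftCrossOps act).IsHopf where
  mul_assoc := leftCrossMul_assoc hact
  one_mul := leftCrossMul_one_left hact
  mul_one := leftCrossMul_one_right hact
  coassoc := coassoc_apply
  counit_left a := by
    change TensorProduct.lid k _ (LinearMap.rTensor _ counit (comul a)) = a
    rw [rTensor_counit_comul]
    simp
  counit_right a := by
    change TensorProduct.rid k _ (LinearMap.lTensor _ counit (comul a)) = a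
    rw [lTensor_counit_comul]
    simp
  comul_one := by
    change comul (R := k) ((1 : A) ⊗ₜ[k] (1 : H)) = _
    rw [tensor_comul_apply, map_tmul, Bialgebra.comul_one, Bialgebra.comul_one]
    rfl
  comul_mul := leftCrossOps_comul_mul hcomul
  counit_one := by
    change counit (R := k) ((1 : A) ⊗ₜ[k] (1 : H)) = _
    simp
  counit_mul := counit_leftCrossMul hcounit
  exists_antipode := by
    refine ⟨leftCrossAntipode act S, isAntipode_of_tmul ?_ ?_⟩
    · intro s h
      dsimp only [leftCrossOps, HopfOps.mulT]
      exact leftCrossAntipode_left hact hS s h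
    · intro s h
      dsimp only [leftCrossOps, HopfOps.mulT]
      exact leftCrossAntipode_right hact hS' s h

end Antipode

end LeftCross

/-! ### Module algebras generated by a submodule -/

section Generators

variable {k C A : Type*} [CommRing k] [AddCommGroup C] [Module k C] [Coalgebra k C]
  [Ring A] [Algebra k A]

/-- The multiplication `m` with unit `e` is compatible with the coalgebra structure of `C`. -/
structure IsBialgMul (m : C →ₗ[k] C →ₗ[k] C) (e : C) : Prop where
  comul_mul : ∀ c d, comul (R := k) (m c d) = map₂ m m (comul c) (comul d)
  counit_mul : ∀ c d, counit (R := k) (m c d) = counit (R := k) c * counit (R := k) d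
  comul_one : comul (R := k) e = e ⊗ₜ e
  counit_one : counit (R := k) e = 1

omit [Coalgebra k C] in
theorem map₂_flip_flip (m : C →ₗ[k] C →ₗ[k] C) (s t : C ⊗[k] C) :
    map₂ m.flip m.flip s t = map₂ m m t s := by
  induction s with
  | zero => simp
  | add s s' h h' => simp only [map_add, LinearMap.add_apply, h, h']
  | tmul c d =>
    induction t with
    | zero => simp
    | add s s' h h' => simp only [map_add, LinearMap.add_apply, h, h']
    | tmul c' d' => rfl

theorem IsBialgMul.flip {m : C →ₗ[k] C →ₗ[k] C} {e : C} (h : IsBialgMul m e) :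
    IsBialgMul m.flip e where
  comul_mul c d := by rw [map₂_flip_flip]; exact h.comul_mul d c
  counit_mul c d := (h.counit_mul d c).trans (mul_comm _ _)
  comul_one := h.comul_one
  counit_one := h.counit_one

/-- A transposed action is a module algebra structure as soon as it satisfies the laws of an
action on generators. -/
theorem isModuleAlg_transposeAct {m : C →ₗ[k] C →ₗ[k] C} {e : C} (h : IsBialgMul m e)
    (ρ : A →ₐ[k] WithConv (C →ₗ[k] A)) {s : Set A} (hs : Algebra.adjoin k s = ⊤)
    (hone : ∀ x ∈ s, transposeAct ρ e x = x)
    (hmul : ∀ x ∈ s, ∀ c d, transposeAct ρ (m c d) x = transposeAct ρ c (transposeAct ρ d x)) :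
    IsModuleAlg m e (transposeAct ρ) where
  act_one := by
    ext x
    have hx : x ∈ Algebra.adjoin k s := hs ▸ Algebra.mem_top
    induction hx using Algebra.adjoin_induction with
    | mem x hx => exact hone x hx
    | algebraMap r =>
      rw [Algebra.algebraMap_eq_smul_one, map_smul, transposeAct_one, h.counit_one, one_smul]
      rfl
    | add x y _ _ hx hy => rw [map_add, hx, hy, map_add]
    | mul x y _ _ hx hy =>
      rw [← LinearMap.mul'_apply (R := k), transposeAct_mul', tensorAct_apply, h.comul_one,
        pairMap_tmul, TensorProduct.map_tmul, hx, hy]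
      rfl
  act_mul c d := by
    ext x
    have hx : x ∈ Algebra.adjoin k s := hs ▸ Algebra.mem_top
    induction hx using Algebra.adjoin_induction generalizing c d with
    | mem x hx => exact hmul x hx c d
    | algebraMap r =>
      simp only [Algebra.algebraMap_eq_smul_one, map_smul, transposeAct_one, h.counit_mul,
        LinearMap.comp_apply, smul_smul]
      congr 1
      ring
    | add x y _ _ hx hy => rw [map_add, hx, hy, map_add]
    | mul x y _ _ hx hy => exact act_mul_of_mul h.comul_mul (transposeAct_mul' ρ) hx hy c d
  map_one := transposeAct_one ρ
  map_mul := transposeAct_mul' ρ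

/-- Over a cocommutative coalgebra, maps whose values commute up to a scalar commute up to that
scalar for the convolution product. -/
theorem convMul_comm_smul [IsCocomm k C] (f g : WithConv (C →ₗ[k] A)) (u : k)
    (h : ∀ c d, f c * g d = u • (g d * f c)) : f * g = u • (g * f) := by
  ext c
  have key : ∀ t : C ⊗[k] C, LinearMap.mul' k A (map f.ofConv g.ofConv t) =
      u • LinearMap.mul' k A (map g.ofConv f.ofConv (TensorProduct.comm k C C t)) := by
    intro t
    induction t with
    | zero => simp
    | add s t hs ht => simp only [map_add, hs, ht, smul_add]
    | tmul c d => simpa using h c d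
  rw [LinearMap.convMul_apply, key, comm_comul]
  rfl

/-- Post-composition with an algebra map is an algebra map of convolution algebras. -/
def convPostcomp {B : Type*} [Ring B] [Algebra k B] (f : A →ₐ[k] B) :
    WithConv (C →ₗ[k] A) →ₐ[k] WithConv (C →ₗ[k] B) :=
  AlgHom.ofLinearMap
    ((WithConv.linearEquiv k (C →ₗ[k] B)).symm.toLinearMap ∘ₗ
      LinearMap.llcomp k C A B f.toLinearMap ∘ₗ
      (WithConv.linearEquiv k (C →ₗ[k] A)).toLinearMap)
    (by ext c; simp [LinearMap.convOne_def])
    (fun x y => WithConv.ofConv_injective (LinearMap.algHom_comp_convMul_distrib f x y))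

end Generators

/-! ### The super-Hopf algebra structure of the exterior algebra -/

section Exterior

variable {k M : Type*} [CommRing k] [AddCommGroup M] [Module k M]

local notation "Λ" => ExteriorAlgebra k M

variable (k M) in
/-- The degree involution of the exterior algebra, which is also its antipode. -/
def gradeInvol : ExteriorAlgebra k M →ₐ[k] ExteriorAlgebra k M :=
  ExteriorAlgebra.map (-LinearMap.id)

@[simp]
theorem gradeInvol_ι (w : M) :
    gradeInvol k M (ExteriorAlgebra.ι k w) = -ExteriorAlgebra.ι k w := by
  simp [gradeInvol]

@[simp]
theorem gradeInvol_gradeInvol (x : ExteriorAlgebra k M) :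
    gradeInvol k M (gradeInvol k M x) = x := by
  have : (gradeInvol k M).comp (gradeInvol k M) = AlgHom.id k _ := by
    apply ExteriorAlgebra.hom_ext
    ext w
    simp
  exact DFunLike.congr_fun this x

theorem gradeInvol_of_mem {n : ℕ} {x : ExteriorAlgebra k M} (hx : x ∈ ⋀[k]^n M) :
    gradeInvol k M x = (-1 : k) ^ n • x := by
  induction hx using Submodule.pow_induction_on_left' with
  | algebraMap r => simp
  | add x y i hx hy h h' => rw [map_add, h, h', smul_add]
  | mem_mul m hm i x hx h =>
    obtain ⟨w, rfl⟩ := hm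
    rw [map_mul, h, gradeInvol_ι, pow_succ]
    simp

/-- Supercommutativity with a form of degree one. -/
theorem mul_ι_eq (x : ExteriorAlgebra k M) (w : M) :
    x * ExteriorAlgebra.ι k w = ExteriorAlgebra.ι k w * gradeInvol k M x := by
  induction x using CliffordAlgebra.left_induction with
  | algebraMap r =>
    change algebraMap k (ExteriorAlgebra k M) r * _ = _ * gradeInvol k M (algebraMap k _ r)
    rw [AlgHom.commutes, Algebra.commutes]
  | add x y hx hy => rw [add_mul, hx, hy, map_add, mul_add]
  | ι_mul x v hx =>
    change ExteriorAlgebra.ι k v * x * _ = _ * gradeInvol k M (ExteriorAlgebra.ι k v * x)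
    have h : ExteriorAlgebra.ι k v * ExteriorAlgebra.ι k w =
        -(ExteriorAlgebra.ι k w * ExteriorAlgebra.ι k v) :=
      eq_neg_of_add_eq_zero_left (ExteriorAlgebra.ι_add_mul_swap v w)
    rw [mul_assoc, hx, ← mul_assoc, h, map_mul, gradeInvol_ι]
    simp [mul_assoc]

/-- The super-coproduct as an algebra map into the graded tensor product. -/
theorem exists_extComul_algHom (k M : Type*) [CommRing k] [AddCommGroup M] [Module k M] :
    ∃ F : ExteriorAlgebra k M →ₐ[k] GradedTensorProduct k (fun n : ℕ => ⋀[k]^n M)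
        (fun n : ℕ => ⋀[k]^n M),
      (∀ x, extComul k M x = (GradedTensorProduct.of k _ _).symm (F x)) ∧
      ∀ w, F (ExteriorAlgebra.ι k w) =
        GradedTensorProduct.includeLeft _ _ (ExteriorAlgebra.ι k w) +
        GradedTensorProduct.includeRight _ _ (ExteriorAlgebra.ι k w) := by
  let 𝒢 : ℕ → Submodule k (ExteriorAlgebra k M) := fun n => ⋀[k]^n M
  obtain ⟨h, hF⟩ : ∃ h, extComul k M = (GradedTensorProduct.of k 𝒢 𝒢).symm.toLinearMap ∘ₗ
      (ExteriorAlgebra.lift k ⟨((GradedTensorProduct.includeLeft 𝒢 𝒢).toLinearMap +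
        (GradedTensorProduct.includeRight 𝒢 𝒢).toLinearMap) ∘ₗ ExteriorAlgebra.ι k,
          h⟩).toLinearMap :=
    ⟨_, rfl⟩
  exact ⟨_, LinearMap.congr_fun hF, fun w => ExteriorAlgebra.lift_ι_apply k _ h w⟩

theorem extComul_one : extComul k M 1 = 1 ⊗ₜ 1 := by
  obtain ⟨F, hF, -⟩ := exists_extComul_algHom k M
  rw [hF, map_one]
  rfl

theorem negOne_units_smul {N : Type*} [AddCommGroup N] [Module k N] (n : ℕ) (x : N) :
    ((-1 : ℤˣ) ^ n) • x = (-1 : k) ^ n • x := by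
  rcases Nat.even_or_odd n with h | h <;> simp [h]

variable (k) in
/-- Left multiplication by the primitive element `w` on `Λ ⊗ Λ`. -/
def primMul (w : M) : Λ ⊗[k] Λ →ₗ[k] Λ ⊗[k] Λ :=
  LinearMap.rTensor _ (LinearMap.mulLeft k (ExteriorAlgebra.ι k w)) +
    map (gradeInvol k M).toLinearMap (LinearMap.mulLeft k (ExteriorAlgebra.ι k w))

theorem primMul_tmul (w : M) (x y : Λ) : primMul k w (x ⊗ₜ y) =
    (ExteriorAlgebra.ι k w * x) ⊗ₜ y + gradeInvol k M x ⊗ₜ (ExteriorAlgebra.ι k w * y) := rfl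

theorem extComul_ι_mul (w : M) (x : Λ) :
    extComul k M (ExteriorAlgebra.ι k w * x) = primMul k w (extComul k M x) := by
  obtain ⟨F, hF, hι⟩ := exists_extComul_algHom k M
  rw [hF, hF, map_mul, hι]
  generalize F x = u
  change (GradedTensorProduct.of k _ _).symm _ = primMul k w ((GradedTensorProduct.of k _ _).symm u)
  obtain ⟨u, rfl⟩ := (GradedTensorProduct.of k (fun n : ℕ => ⋀[k]^n M)
    (fun n : ℕ => ⋀[k]^n M)).surjective u
  rw [LinearEquiv.symm_apply_apply]
  induction u with
  | zero => simp
  | add u v hu hv => simp only [map_add, mul_add, hu, hv]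
  | tmul x y =>
    rw [primMul_tmul, add_mul, map_add]
    congr 1
    · induction x using DirectSum.Decomposition.inductionOn (fun n : ℕ => ⋀[k]^n M) with
      | zero => simp
      | add x x' h h' => simp only [add_tmul, map_add, mul_add, h, h']
      | homogeneous x =>
        rw [GradedTensorProduct.includeLeft_apply, GradedTensorProduct.tmul_one_mul_coe_tmul]
        rfl
    · induction x using DirectSum.Decomposition.inductionOn (fun n : ℕ => ⋀[k]^n M) with
      | zero => simp
      | add x x' h h' => simp only [add_tmul, map_add, mul_add, h, h']
      | @homogeneous i x =>
        have hw : ExteriorAlgebra.ι k w ∈ ⋀[k]^1 M := by simp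
        rw [GradedTensorProduct.includeRight_apply, gradeInvol_of_mem x.2]
        refine (congrArg _ (GradedTensorProduct.tmul_coe_mul_coe_tmul
          (fun n : ℕ => ⋀[k]^n M) (fun n : ℕ => ⋀[k]^n M) 1 ⟨_, hw⟩ x y)).trans ?_
        rw [negOne_units_smul (k := k), map_smul, one_mul, one_mul, ← smul_tmul']
        rfl

/-- The exterior algebra is spanned by the elements obtained from `1` by left multiplication by
forms of degree one. -/
theorem extAlg_induction {P : Λ → Prop} (one : P 1) (smul : ∀ (r : k) x, P x → P (r • x))
    (add : ∀ x y, P x → P y → P (x + y))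
    (ι_mul : ∀ w x, P x → P (ExteriorAlgebra.ι k w * x)) (x : Λ) : P x := by
  induction x using CliffordAlgebra.left_induction with
  | algebraMap r =>
    change P (algebraMap k Λ r)
    rw [Algebra.algebraMap_eq_smul_one]
    exact smul _ _ one
  | add x y hx hy => exact add x y hx hy
  | ι_mul x v hx => exact ι_mul v x hx

theorem extComul_gradeInvol (x : Λ) : extComul k M (gradeInvol k M x) =
    map (gradeInvol k M).toLinearMap (gradeInvol k M).toLinearMap (extComul k M x) := by
  induction x using extAlg_induction with
  | one => simp [extComul_one]
  | smul r x h => simp only [map_smul, h]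
  | add x y hx hy => simp only [map_add, hx, hy]
  | ι_mul w x h =>
    rw [map_mul, gradeInvol_ι, neg_mul, map_neg, extComul_ι_mul, h, extComul_ι_mul]
    generalize extComul k M x = u
    induction u with
    | zero => simp
    | add u v hu hv =>
      simp only [map_add, neg_add, hu, hv]
    | tmul x y =>
      simp [primMul_tmul]
      rw [neg_tmul, tmul_neg]
      abel

theorem extComul_coassoc (x : Λ) :
    TensorProduct.assoc k Λ Λ Λ (LinearMap.rTensor Λ (extComul k M) (extComul k M x)) =
      LinearMap.lTensor Λ (extComul k M) (extComul k M x) := by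
  induction x using extAlg_induction with
  | one => simp [extComul_one]
  | smul r x h => simp only [map_smul, h]
  | add x y hx hy => simp only [map_add, hx, hy]
  | ι_mul w x h =>
    rw [extComul_ι_mul]
    -- the action of `w` on `Λ ⊗ Λ ⊗ Λ`
    let T : Λ ⊗[k] (Λ ⊗[k] Λ) →ₗ[k] Λ ⊗[k] (Λ ⊗[k] Λ) :=
      LinearMap.rTensor _ (LinearMap.mulLeft k (ExteriorAlgebra.ι k w)) +
        map (gradeInvol k M).toLinearMap (primMul k w)
    have h1 : ∀ u : Λ ⊗[k] Λ, TensorProduct.assoc k Λ Λ Λ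
        (LinearMap.rTensor Λ (extComul k M) (primMul k w u)) =
        T (TensorProduct.assoc k Λ Λ Λ (LinearMap.rTensor Λ (extComul k M) u)) := by
      intro u
      induction u with
      | zero => simp
      | add u v hu hv => simp only [map_add, hu, hv]
      | tmul x y =>
        simp only [primMul_tmul, map_add, LinearMap.rTensor_tmul, extComul_ι_mul,
          extComul_gradeInvol]
        generalize extComul k M x = u
        induction u with
        | zero => simp
        | add u v hu hv =>
          simp only [map_add, add_tmul] at hu hv ⊢
          rw [← hu, ← hv]
          abel
        | tmul x z =>
          simp [T, primMul_tmul, add_tmul, tmul_add]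
          abel
    have h2 : ∀ u : Λ ⊗[k] Λ, LinearMap.lTensor Λ (extComul k M) (primMul k w u) =
        T (LinearMap.lTensor Λ (extComul k M) u) := by
      intro u
      induction u with
      | zero => simp
      | add u v hu hv => simp only [map_add, hu, hv]
      | tmul x y => simp [T, primMul_tmul, extComul_ι_mul]
    rw [h1, h2, h]

theorem algebraMapInv_ι_mul (w : M) (x : Λ) :
    ExteriorAlgebra.algebraMapInv (ExteriorAlgebra.ι k w * x) = 0 := by
  simp [ExteriorAlgebra.algebraMapInv]

@[simp]
theorem algebraMapInv_ι (w : M) :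
    ExteriorAlgebra.algebraMapInv (ExteriorAlgebra.ι k w) = 0 := by
  simpa using algebraMapInv_ι_mul w (1 : Λ)

theorem algebraMapInv_gradeInvol (x : Λ) :
    ExteriorAlgebra.algebraMapInv (gradeInvol k M x) = ExteriorAlgebra.algebraMapInv x := by
  induction x using extAlg_induction with
  | one => simp
  | smul r x h => simp only [map_smul, h]
  | add x y hx hy => simp only [map_add, hx, hy]
  | ι_mul w x h => rw [map_mul, gradeInvol_ι, neg_mul, map_neg, algebraMapInv_ι_mul,
      algebraMapInv_ι_mul, neg_zero]

variable (k M) in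
/-- The counit of the exterior algebra. -/
abbrev extCounit : Λ →ₗ[k] k := (ExteriorAlgebra.algebraMapInv (R := k) (M := M)).toLinearMap

theorem extComul_counit_left (x : Λ) :
    LinearMap.rTensor Λ (extCounit k M) (extComul k M x) = 1 ⊗ₜ x := by
  induction x using extAlg_induction with
  | one => simp [extComul_one]
  | smul r x h => simp only [map_smul, h, tmul_smul]
  | add x y hx hy => simp only [map_add, hx, hy, tmul_add]
  | ι_mul w x h =>
    have h1 : ∀ u : Λ ⊗[k] Λ, LinearMap.rTensor Λ (extCounit k M) (primMul k w u) =
        LinearMap.lTensor k (LinearMap.mulLeft k (ExteriorAlgebra.ι k w))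
          (LinearMap.rTensor Λ (extCounit k M) u) := by
      intro u
      induction u with
      | zero => simp
      | add u v hu hv => simp only [map_add, hu, hv]
      | tmul x y => simp [primMul_tmul, algebraMapInv_gradeInvol]
    rw [extComul_ι_mul, h1, h]
    rfl

theorem extComul_counit_right (x : Λ) :
    LinearMap.lTensor Λ (extCounit k M) (extComul k M x) = x ⊗ₜ 1 := by
  induction x using extAlg_induction with
  | one => simp [extComul_one]
  | smul r x h => simp only [map_smul, h, smul_tmul']
  | add x y hx hy => simp only [map_add, hx, hy, add_tmul]
  | ι_mul w x h =>
    have h1 : ∀ u : Λ ⊗[k] Λ, LinearMap.lTensor Λ (extCounit k M) (primMul k w u) =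
        LinearMap.rTensor k (LinearMap.mulLeft k (ExteriorAlgebra.ι k w))
          (LinearMap.lTensor Λ (extCounit k M) u) := by
      intro u
      induction u with
      | zero => simp
      | add u v hu hv => simp only [map_add, hu, hv]
      | tmul x y => simp [primMul_tmul]
    rw [extComul_ι_mul, h1, h]
    rfl

variable (k M) in
/-- The exterior algebra as a coalgebra, by the super-coproduct. -/
@[reducible]
def extCoalgebra : Coalgebra k (ExteriorAlgebra k M) where
  comul := extComul k M
  counit := extCounit k M
  coassoc := LinearMap.ext extComul_coassoc
  rTensor_counit_comp_comul := LinearMap.ext extComul_counit_left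
  lTensor_counit_comp_comul := LinearMap.ext extComul_counit_right

theorem gradeInvol_mul_comul (x : Λ) : LinearMap.mul' k Λ
    (LinearMap.rTensor Λ (gradeInvol k M).toLinearMap (extComul k M x)) =
      extCounit k M x • (1 : Λ) := by
  induction x using extAlg_induction with
  | one => simp [extComul_one]
  | smul r x h => simp only [map_smul, h, smul_assoc]
  | add x y hx hy => simp only [map_add, hx, hy, add_smul]
  | ι_mul w x h =>
    rw [extComul_ι_mul, AlgHom.toLinearMap_apply, algebraMapInv_ι_mul, zero_smul]
    generalize extComul k M x = u
    induction u with
    | zero => simp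
    | add u v hu hv => simp only [map_add, hu, hv, add_zero]
    | tmul x y =>
      simp only [primMul_tmul, map_add, LinearMap.rTensor_tmul, LinearMap.mul'_apply,
        AlgHom.toLinearMap_apply, map_mul, gradeInvol_ι, gradeInvol_gradeInvol]
      rw [← mul_assoc, mul_ι_eq x w, neg_mul, neg_mul, neg_add_cancel]

theorem mul_gradeInvol_comul (x : Λ) : LinearMap.mul' k Λ
    (LinearMap.lTensor Λ (gradeInvol k M).toLinearMap (extComul k M x)) =
      extCounit k M x • (1 : Λ) := by
  induction x using extAlg_induction with
  | one => simp [extComul_one]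
  | smul r x h => simp only [map_smul, h, smul_assoc]
  | add x y hx hy => simp only [map_add, hx, hy, add_smul]
  | ι_mul w x h =>
    rw [extComul_ι_mul, AlgHom.toLinearMap_apply, algebraMapInv_ι_mul, zero_smul]
    generalize extComul k M x = u
    induction u with
    | zero => simp
    | add u v hu hv => simp only [map_add, hu, hv, add_zero]
    | tmul x y =>
      simp only [primMul_tmul, map_add, LinearMap.lTensor_tmul, LinearMap.mul'_apply,
        AlgHom.toLinearMap_apply, map_mul, gradeInvol_ι]
      rw [neg_mul, mul_neg, ← mul_assoc (gradeInvol k M x), mul_ι_eq, gradeInvol_gradeInvol,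
        add_neg_cancel]

end Exterior

/-! ### The diagonal action on the exterior algebra -/

section ExtAction

variable {k B W : Type*} [Field k] [AddCommGroup B] [Module k B] [Coalgebra k B]
  [IsCocomm k B] [AddCommGroup W] [Module k W]

/-- The algebra map from the exterior algebra to the convolution algebra whose transpose is the
diagonal action. -/
def extActHom (act : B →ₗ[k] Module.End k W) :
    ExteriorAlgebra k W →ₐ[k] WithConv (B →ₗ[k] ExteriorAlgebra k W) :=
  ExteriorAlgebra.lift k ⟨extActAux act, extActAux_mul_self act⟩

theorem extDiagonalAct_eq (act : B →ₗ[k] Module.End k W) :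
    extDiagonalAct act = transposeAct (extActHom act) := rfl

variable (act : B →ₗ[k] Module.End k W)

theorem extDiagonalAct_ι (b : B) (w : W) :
    extDiagonalAct act b (ExteriorAlgebra.ι k w) = ExteriorAlgebra.ι k (act b w) := by
  rw [extDiagonalAct_eq, transposeAct_apply, extActHom, ExteriorAlgebra.lift_ι_apply]
  rfl

theorem extDiagonalAct_one (b : B) :
    extDiagonalAct act b 1 = counit (R := k) b • (1 : ExteriorAlgebra k W) :=
  transposeAct_one _ b

theorem extDiagonalAct_mul' (b : B) (x : ExteriorAlgebra k W ⊗[k] ExteriorAlgebra k W) :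
    extDiagonalAct act b (LinearMap.mul' k _ x) =
      LinearMap.mul' k _ (tensorAct (extDiagonalAct act) (extDiagonalAct act) b x) :=
  transposeAct_mul' _ b x

theorem exteriorPower_succ (n : ℕ) :
    ⋀[k]^(n + 1) W = LinearMap.range (ExteriorAlgebra.ι k (M := W)) * ⋀[k]^n W :=
  pow_succ' _ _

theorem extDiagonalAct_mem (b : B) {n : ℕ} {x : ExteriorAlgebra k W} (hx : x ∈ ⋀[k]^n W) :
    extDiagonalAct act b x ∈ ⋀[k]^n W := by
  induction hx using Submodule.pow_induction_on_left' generalizing b with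
  | algebraMap r =>
    rw [Algebra.algebraMap_eq_smul_one, map_smul, extDiagonalAct_one]
    exact Submodule.smul_mem _ _ (Submodule.smul_mem _ _ (SetLike.one_mem_graded _))
  | add x y i hx hy h h' => rw [map_add]; exact Submodule.add_mem _ (h b) (h' b)
  | mem_mul m hm i x hx h =>
    obtain ⟨w, rfl⟩ := hm
    rw [← LinearMap.mul'_apply (R := k), extDiagonalAct_mul', tensorAct_apply]
    generalize comul (R := k) b = t
    induction t with
    | zero => simp
    | add s t hs ht =>
      simp only [map_add, LinearMap.add_apply]
      exact Submodule.add_mem _ hs ht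
    | tmul c d =>
      rw [pairMap_tmul, map_tmul, extDiagonalAct_ι, LinearMap.mul'_apply, exteriorPower_succ]
      exact Submodule.mul_mem_mul ⟨_, rfl⟩ (h d)

theorem isModuleAlg_extDiagonalAct {m : B →ₗ[k] B →ₗ[k] B} {e : B} (h : IsBialgMul m e)
    (hone : act e = LinearMap.id) (hmul : ∀ c d, act (m c d) = act c ∘ₗ act d) :
    IsModuleAlg m e (extDiagonalAct act) := by
  refine isModuleAlg_transposeAct h (extActHom act) (s := Set.range (ExteriorAlgebra.ι k))
    (CliffordAlgebra.adjoin_range_ι (Q := 0)) ?_ ?_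
  · rintro _ ⟨w, rfl⟩
    rw [← extDiagonalAct_eq, extDiagonalAct_ι, hone]
    rfl
  · rintro _ ⟨w, rfl⟩ c d
    rw [← extDiagonalAct_eq, extDiagonalAct_ι, extDiagonalAct_ι, extDiagonalAct_ι, hmul]
    rfl

theorem extCounit_extDiagonalAct (b : B) (x : ExteriorAlgebra k W) :
    extCounit k W (extDiagonalAct act b x) = counit (R := k) b * extCounit k W x := by
  induction x using extAlg_induction with
  | one => simp [extDiagonalAct_one]
  | smul r x h => simp only [map_smul, h, smul_eq_mul]; ring
  | add x y hx hy => simp only [map_add, hx, hy, mul_add]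
  | ι_mul w x h =>
    rw [AlgHom.toLinearMap_apply, AlgHom.toLinearMap_apply, algebraMapInv_ι_mul, mul_zero,
      ← LinearMap.mul'_apply (R := k), extDiagonalAct_mul', tensorAct_apply]
    generalize comul (R := k) b = t
    induction t with
    | zero => simp
    | add s t hs ht => simp only [map_add, LinearMap.add_apply, hs, ht, add_zero]
    | tmul c d =>
      rw [pairMap_tmul, map_tmul, extDiagonalAct_ι, LinearMap.mul'_apply, algebraMapInv_ι_mul]

/-- The super-coproduct of the exterior algebra is equivariant for the diagonal action: both sides
come from algebra maps to the convolution algebra of maps to the graded tensor square, and these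
agree on generators. -/
theorem extComul_extDiagonalAct (b : B) (x : ExteriorAlgebra k W) :
    extComul k W (extDiagonalAct act b x) =
      tensorAct (extDiagonalAct act) (extDiagonalAct act) b (extComul k W x) := by
  obtain ⟨F, hF, hι⟩ := exists_extComul_algHom k W
  let 𝒢 : ℕ → Submodule k (ExteriorAlgebra k W) := fun n => ⋀[k]^n W
  let iL := GradedTensorProduct.includeLeft (R := k) 𝒢 𝒢
  let iR := GradedTensorProduct.includeRight (R := k) 𝒢 𝒢
  let ρ := extActHom act
  let D : GradedTensorProduct k 𝒢 𝒢 →ₐ[k] WithConv (B →ₗ[k] GradedTensorProduct k 𝒢 𝒢) :=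
    GradedTensorProduct.lift 𝒢 𝒢 ((convPostcomp iL).comp ρ) ((convPostcomp iR).comp ρ) (by
      intro i j x y
      rw [negOne_units_smul (k := k)]
      refine convMul_comm_smul _ _ _ fun c d => ?_
      have hx : extDiagonalAct act c x ∈ 𝒢 i := extDiagonalAct_mem act c x.2
      have hy : extDiagonalAct act d y ∈ 𝒢 j := extDiagonalAct_mem act d y.2
      change iL (extDiagonalAct act c x) * iR (extDiagonalAct act d y) =
        _ • (iR (extDiagonalAct act d y) * iL (extDiagonalAct act c x))
      generalize extDiagonalAct act c x = x at hx
      generalize extDiagonalAct act d y = y at hy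
      have h := GradedTensorProduct.tmul_coe_mul_coe_tmul (R := k) 𝒢 𝒢 1 ⟨y, hy⟩ ⟨x, hx⟩ 1
      have h' := GradedTensorProduct.tmul_one_mul_one_tmul (R := k) 𝒢 𝒢 x y
      simp only [iL, iR, GradedTensorProduct.includeLeft_apply,
        GradedTensorProduct.includeRight_apply]
      rw [h', h, negOne_units_smul (k := k), smul_smul, ← mul_pow]
      simp)
  have hD : ∀ (u : ExteriorAlgebra k W ⊗[k] ExteriorAlgebra k W) (b : B),
      (D (GradedTensorProduct.of k 𝒢 𝒢 u)).ofConv b = GradedTensorProduct.of k 𝒢 𝒢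
        (tensorAct (extDiagonalAct act) (extDiagonalAct act) b u) := by
    intro u b
    induction u with
    | zero => simp
    | add u v hu hv =>
      simp only [map_add, WithConv.ofConv_add, LinearMap.add_apply, hu, hv]
    | tmul x y =>
      rw [tensorAct_apply]
      change (D (GradedTensorProduct.tmul k x y)).ofConv b = _
      rw [GradedTensorProduct.lift_tmul, LinearMap.convMul_apply]
      generalize comul (R := k) b = t
      induction t with
      | zero => simp
      | add s t hs ht => simp only [map_add, LinearMap.add_apply, hs, ht]
      | tmul c d =>
        exact GradedTensorProduct.tmul_one_mul_one_tmul (R := k) 𝒢 𝒢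
          (extDiagonalAct act c x) (extDiagonalAct act d y)
  have hcomp : (convPostcomp F).comp ρ = D.comp F := by
    apply ExteriorAlgebra.hom_ext
    ext w b
    change F (extDiagonalAct act b (ExteriorAlgebra.ι k w)) =
      (D (F (ExteriorAlgebra.ι k w))).ofConv b
    rw [extDiagonalAct_ι, hι, hι, map_add, WithConv.ofConv_add, LinearMap.add_apply,
      ← extDiagonalAct_ι]
    congr 1
    · change _ = (D (GradedTensorProduct.tmul k _ 1)).ofConv b
      rw [GradedTensorProduct.lift_tmul, map_one, mul_one]
      rfl
    · change _ = (D (GradedTensorProduct.tmul k 1 _)).ofConv b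
      rw [GradedTensorProduct.lift_tmul, map_one, one_mul]
      rfl
  have h := congrArg WithConv.ofConv (DFunLike.congr_fun hcomp x)
  have h := LinearMap.congr_fun h b
  change F (extDiagonalAct act b x) = (D (F x)).ofConv b at h
  rw [hF, hF, h]
  have h2 := hD ((GradedTensorProduct.of k 𝒢 𝒢).symm (F x)) b
  rw [LinearEquiv.apply_symm_apply] at h2
  rw [h2]
  rfl

end ExtAction

/-! ### Gradings and signs -/

section Graded

variable {k A : Type*} [CommRing k] [AddCommGroup A] [Module k A] (𝒜 : ℕ → Submodule k A)
  [DirectSum.Decomposition 𝒜]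

theorem superFlip_tmul {i j : ℕ} {x y : A} (hx : x ∈ 𝒜 i) (hy : y ∈ 𝒜 j) :
    HopfOps.superFlip 𝒜 (x ⊗ₜ[k] y) = (-1 : k) ^ (j * i) • y ⊗ₜ[k] x := by
  simp only [HopfOps.superFlip, LinearMap.comp_apply, LinearEquiv.coe_coe, congr_tmul,
    DirectSum.decomposeLinearEquiv_apply]
  rw [DirectSum.decompose_of_mem _ hx, DirectSum.decompose_of_mem _ hy]
  have h := gradedComm_of_tmul_of k (fun i => 𝒜 i) (fun i => 𝒜 i) i j ⟨x, hx⟩ ⟨y, hy⟩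
  rw [DirectSum.lof_eq_of, DirectSum.lof_eq_of] at h
  rw [h, negOne_units_smul (k := k), map_smul, congr_symm_tmul,
    DirectSum.decomposeLinearEquiv_symm_apply, DirectSum.decomposeLinearEquiv_symm_apply,
    DirectSum.decompose_symm_of, DirectSum.decompose_symm_of]

theorem degreeSign_of_mem {i : ℕ} {x : A} (hx : x ∈ 𝒜 i) :
    HopfOps.degreeSign 𝒜 x = (-1 : k) ^ i • x := by
  simp only [HopfOps.degreeSign, LinearMap.comp_apply, LinearEquiv.coe_coe,
    DirectSum.decomposeLinearEquiv_apply]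
  rw [DirectSum.decompose_of_mem _ hx, ← DirectSum.lof_eq_of k, DirectSum.toModule_lof]
  rfl

theorem tensorMul_tmul_of_flip {X : HopfOps k A} {τ : A ⊗[k] A →ₗ[k] A ⊗[k] A} {p q p' q' : A}
    {u : k} (h : τ (q ⊗ₜ p') = u • p' ⊗ₜ[k] q) :
    X.tensorMul τ ((p ⊗ₜ q) ⊗ₜ (p' ⊗ₜ q')) = u • (X.mul p p') ⊗ₜ[k] (X.mul q q') := by
  simp only [HopfOps.tensorMul, LinearMap.comp_apply, LinearEquiv.coe_coe, assoc_tmul,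
    LinearMap.lTensor_tmul, assoc_symm_tmul, LinearMap.rTensor_tmul, h]
  simp only [← smul_tmul', map_smul, tmul_smul, assoc_tmul, assoc_symm_tmul, map_tmul]
  rfl

end Graded

/-- The antipode is unique, as an inverse of the identity for the convolution product. -/
theorem isAntipode_unique {k A : Type*} [CommRing k] [AddCommGroup A] [Module k A]
    {X : HopfOps k A} {τ : A ⊗[k] A →ₗ[k] A ⊗[k] A} (hX : X.IsHopfFor τ) {S S' : A →ₗ[k] A}
    (hS : X.IsAntipode S) (hS' : X.IsAntipode S') : S = S' := by
  let : Ring A :=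
    { (inferInstance : AddCommGroup A) with
      mul := fun a b => X.mul a b
      one := X.one
      mul_assoc := hX.mul_assoc
      one_mul := hX.one_mul
      mul_one := hX.mul_one
      left_distrib := fun a b c => map_add (X.mul a) b c
      right_distrib := fun a b c => LinearMap.map_add₂ X.mul a b c
      zero_mul := fun a => LinearMap.map_zero₂ X.mul a
      mul_zero := fun a => map_zero (X.mul a) }
  let : Algebra k A := Algebra.ofModule (fun r x y => LinearMap.map_smul₂ X.mul r x y)
    (fun r x y => map_smul (X.mul x) r y)
  let : Coalgebra k A :=
    { comul := X.comul
      counit := X.counit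
      coassoc := LinearMap.ext hX.coassoc
      rTensor_counit_comp_comul := LinearMap.ext fun a => by
        apply (TensorProduct.lid k A).injective
        exact (hX.counit_left a).trans (by simp)
      lTensor_counit_comp_comul := LinearMap.ext fun a => by
        apply (TensorProduct.rid k A).injective
        exact (hX.counit_right a).trans (by simp) }
  have hmul : LinearMap.mul' k A = X.mulT := TensorProduct.ext' fun a b => rfl
  have h1 : WithConv.toConv S * WithConv.toConv (LinearMap.id : A →ₗ[k] A) = 1 := by
    ext a
    rw [LinearMap.convMul_apply, hmul]
    refine (hS.1 a).trans ?_
    rw [LinearMap.convOne_apply, Algebra.algebraMap_eq_smul_one]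
    rfl
  have h2 : WithConv.toConv (LinearMap.id : A →ₗ[k] A) * WithConv.toConv S' = 1 := by
    ext a
    rw [LinearMap.convMul_apply, hmul]
    refine (hS'.2 a).trans ?_
    rw [LinearMap.convOne_apply, Algebra.algebraMap_eq_smul_one]
    rfl
  exact WithConv.toConv_injective (left_inv_eq_right_inv h1 h2)

section ExtTensorGrading

variable {k M B : Type*} [CommRing k] [AddCommGroup M] [Module k M] [AddCommGroup B] [Module k B]

theorem tmul_mem_extTensorGrading (b : B) {n : ℕ} {x : ExteriorAlgebra k M} (hx : x ∈ ⋀[k]^n M) :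
    b ⊗ₜ x ∈ extTensorGrading k M B n :=
  ⟨b ⊗ₜ ⟨x, hx⟩, rfl⟩

theorem extTensorGrading_induction {n : ℕ}
    {P : ∀ x : B ⊗[k] ExteriorAlgebra k M, x ∈ extTensorGrading k M B n → Prop}
    (zero : P 0 (Submodule.zero_mem _))
    (add : ∀ x y hx hy, P x hx → P y hy → P (x + y) (Submodule.add_mem _ hx hy))
    (tmul : ∀ (b : B) (x : ExteriorAlgebra k M) (hx : x ∈ ⋀[k]^n M),
      P (b ⊗ₜ x) (tmul_mem_extTensorGrading b hx))
    {x : B ⊗[k] ExteriorAlgebra k M} (hx : x ∈ extTensorGrading k M B n) : P x hx := by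
  obtain ⟨y, rfl⟩ := hx
  have key : ∀ (z) (hz : LinearMap.lTensor B (⋀[k]^n M).subtype y = z), P z ⟨y, hz⟩ := by
    induction y with
    | zero => rintro z rfl; simpa using zero
    | add u v hu hv =>
      rintro z rfl
      simpa only [map_add] using add _ _ ⟨u, rfl⟩ ⟨v, rfl⟩ (hu _ rfl) (hv _ rfl)
    | tmul b x => rintro z rfl; exact tmul b x x.2
  exact key _ rfl

/-- The degree involution of `B ⊗ Λ(M)`. -/
theorem degreeSign_extTensorGrading :
    HopfOps.degreeSign (extTensorGrading k M B) =
      LinearMap.lTensor B (gradeInvol k M).toLinearMap := by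
  ext1
  ext1 b
  refine DirectSum.decompose_lhom_ext (fun n : ℕ => ⋀[k]^n M) fun n => LinearMap.ext fun x => ?_
  change HopfOps.degreeSign (extTensorGrading k M B) (b ⊗ₜ (x : ExteriorAlgebra k M)) =
    b ⊗ₜ gradeInvol k M x
  rw [degreeSign_of_mem _ (tmul_mem_extTensorGrading b x.2), gradeInvol_of_mem x.2, tmul_smul]

variable (k M) in
/-- The degree-`n` part of `Λ(M) ⊗ Λ(M)`. -/
def extTensorDegree (n : ℕ) : Submodule k (ExteriorAlgebra k M ⊗[k] ExteriorAlgebra k M) :=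
  ⨆ p ∈ Finset.HasAntidiagonal.antidiagonal n,
    LinearMap.range (map (⋀[k]^p.1 M).subtype (⋀[k]^p.2 M).subtype)

theorem tmul_mem_iSup_range {N : Type*} [AddCommGroup N] [Module k N] {𝒜 : ℕ → Submodule k N}
    {i j n : ℕ} (h : i + j = n) {x y : N} (hx : x ∈ 𝒜 i) (hy : y ∈ 𝒜 j) :
    x ⊗ₜ[k] y ∈ ⨆ p ∈ Finset.HasAntidiagonal.antidiagonal n,
      LinearMap.range (map (𝒜 p.1).subtype (𝒜 p.2).subtype) :=
  Submodule.mem_iSup_of_mem (i, j)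
    (Submodule.mem_iSup_of_mem (Finset.HasAntidiagonal.mem_antidiagonal.2 h)
      ⟨⟨x, hx⟩ ⊗ₜ ⟨y, hy⟩, rfl⟩)

theorem extTensorDegree_le {n : ℕ} {T : Submodule k (ExteriorAlgebra k M ⊗[k] ExteriorAlgebra k M)}
    (h : ∀ i j, i + j = n → ∀ x ∈ ⋀[k]^i M, ∀ y ∈ ⋀[k]^j M, x ⊗ₜ y ∈ T) :
    extTensorDegree k M n ≤ T := by
  refine iSup₂_le fun p hp => ?_
  rintro _ ⟨u, rfl⟩
  induction u with
  | zero => simp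
  | add u v hu hv => rw [map_add]; exact Submodule.add_mem _ hu hv
  | tmul x y => exact h p.1 p.2 (Finset.HasAntidiagonal.mem_antidiagonal.1 hp) x x.2 y y.2

theorem gradeInvol_mem {n : ℕ} {x : ExteriorAlgebra k M} (hx : x ∈ ⋀[k]^n M) :
    gradeInvol k M x ∈ ⋀[k]^n M := by
  rw [gradeInvol_of_mem hx]
  exact Submodule.smul_mem _ _ hx

theorem extComul_mem {n : ℕ} {x : ExteriorAlgebra k M} (hx : x ∈ ⋀[k]^n M) :
    extComul k M x ∈ extTensorDegree k M n := by
  induction hx using Submodule.pow_induction_on_left' with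
  | algebraMap r =>
    rw [Algebra.algebraMap_eq_smul_one, map_smul, extComul_one]
    exact Submodule.smul_mem _ _ (tmul_mem_iSup_range (𝒜 := fun n => ⋀[k]^n M) (add_zero 0)
      (SetLike.one_mem_graded (fun n : ℕ => ⋀[k]^n M))
      (SetLike.one_mem_graded (fun n : ℕ => ⋀[k]^n M)))
  | add x y i hx hy h h' => rw [map_add]; exact Submodule.add_mem _ h h'
  | mem_mul m hm i x hx h =>
    obtain ⟨w, rfl⟩ := hm
    have hι : ∀ {j : ℕ} {y : ExteriorAlgebra k M}, y ∈ ⋀[k]^j M →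
        ExteriorAlgebra.ι k w * y ∈ ⋀[k]^(j + 1) M := by
      intro j y hy
      have := SetLike.mul_mem_graded (A := fun n : ℕ => ⋀[k]^n M) (i := 1) (j := j)
        (show ExteriorAlgebra.ι k w ∈ ⋀[k]^1 M by simp) hy
      rwa [add_comm] at this
    rw [extComul_ι_mul]
    suffices hle : extTensorDegree k M i ≤ (extTensorDegree k M (i + 1)).comap (primMul k w) from
      hle h
    refine extTensorDegree_le fun a b hab x hx y hy => ?_
    rw [Submodule.mem_comap, primMul_tmul]
    refine Submodule.add_mem _ ?_ ?_
    · exact tmul_mem_iSup_range (𝒜 := fun n => ⋀[k]^n M) (by omega) (hι hx) hy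
    · exact tmul_mem_iSup_range (𝒜 := fun n => ⋀[k]^n M) (by omega) (gradeInvol_mem hx) (hι hy)

end ExtTensorGrading

/-! ### Right cross products with an exterior algebra -/

section RightCross

variable {k B W : Type*} [Field k] [AddCommGroup B] [Module k B] [Coalgebra k B]
  [IsCocomm k B] [AddCommGroup W] [Module k W]

local notation "Λ" => ExteriorAlgebra k W

/-- Right multiplication `v ↦ v Ξ` by `Ξ` in the super tensor product `Λ ⊗ Λ`. -/
def superMulRight : Λ ⊗[k] Λ →ₗ[k] Λ ⊗[k] Λ →ₗ[k] Λ ⊗[k] Λ :=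
  let e := GradedTensorProduct.of k (fun n : ℕ => ⋀[k]^n W) (fun n : ℕ => ⋀[k]^n W)
  ((LinearMap.mul k _).flip.compl₁₂ e.toLinearMap e.toLinearMap).compr₂ e.symm.toLinearMap

theorem extComul_mul (x y : Λ) :
    extComul k W (x * y) = superMulRight (extComul k W y) (extComul k W x) := by
  obtain ⟨F, hF, -⟩ := exists_extComul_algHom k W
  rw [hF, hF, hF, map_mul]
  rfl

theorem superMulRight_tmul {i j : ℕ} {ξ ζ : Λ} (hξ : ξ ∈ ⋀[k]^i W) (hζ : ζ ∈ ⋀[k]^j W)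
    (θ η : Λ) : superMulRight (ξ ⊗ₜ[k] θ) (η ⊗ₜ[k] ζ) =
      (-1 : k) ^ (i * j) • (η * ξ) ⊗ₜ[k] (ζ * θ) := by
  have h := GradedTensorProduct.tmul_coe_mul_coe_tmul (R := k) (fun n : ℕ => ⋀[k]^n W)
    (fun n : ℕ => ⋀[k]^n W) η ⟨ζ, hζ⟩ ⟨ξ, hξ⟩ θ
  rw [negOne_units_smul (k := k), mul_comm j i] at h
  exact congrArg (GradedTensorProduct.of k (fun n : ℕ => ⋀[k]^n W)
    (fun n : ℕ => ⋀[k]^n W)).symm h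

variable (Y : HopfOps k B) (act₀ : B →ₗ[k] Module.End k W)

/-- The cross product `B ⋉ Λ(W)` with the super tensor product coalgebra structure. -/
def rightCrossOps : HopfOps k (B ⊗[k] Λ) where
  mul := rightCrossMul Y.mul (extDiagonalAct act₀)
  one := Y.one ⊗ₜ 1
  comul := (tensorTensorTensorComm k _ _ _ _).toLinearMap ∘ₗ map Y.comul (extComul k W)
  counit := TensorProduct.lift ((LinearMap.mul k k).compl₁₂ Y.counit
    (ExteriorAlgebra.algebraMapInv (R := k) (M := W)).toLinearMap)

/-- Right multiplication by `b ⊗ 1` in the cross product. -/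
abbrev rightAct : B →ₗ[k] Module.End k (B ⊗[k] Λ) :=
  tensorAct Y.mul.flip (extDiagonalAct act₀)

variable (k B) in
/-- Right multiplication by `1 ⊗ ξ` in the cross product. -/
abbrev formMul (ξ : Λ) : B ⊗[k] Λ →ₗ[k] B ⊗[k] Λ :=
  LinearMap.lTensor B (LinearMap.mulRight k ξ)

theorem formMul_mul (η ξ : Λ) (x : B ⊗[k] Λ) :
    formMul k B (η * ξ) x = formMul k B ξ (formMul k B η x) := by
  rw [formMul, LinearMap.mulRight_mul, LinearMap.lTensor_comp, LinearMap.comp_apply]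

theorem rightCrossMul_tmul (x : B ⊗[k] Λ) (b : B) (ξ : Λ) :
    rightCrossMul Y.mul (extDiagonalAct act₀) x (b ⊗ₜ ξ) =
      formMul k B ξ (rightAct Y act₀ b x) := rfl

/-- The data of a cross product: `Y` is a Hopf algebra structure on the coalgebra `B` which acts
on `W` from the right by `w ◁ b = act₀ b w`. -/
structure IsRightAction : Prop where
  hopf : Y.IsHopf
  comul_eq : Y.comul = comul
  counit_eq : Y.counit = counit
  act_one : act₀ Y.one = LinearMap.id
  act_mul : ∀ a b, act₀ (Y.mul a b) = act₀ b ∘ₗ act₀ a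

variable {Y act₀} (h : IsRightAction Y act₀)
include h

namespace IsRightAction

theorem isBialgMul : IsBialgMul Y.mul Y.one where
  comul_mul c d := by
    rw [← h.comul_eq, h.hopf.comul_mul, tensorMul_comm]
  counit_mul c d := by
    rw [← h.counit_eq, h.hopf.counit_mul]
  comul_one := by rw [← h.comul_eq, h.hopf.comul_one]
  counit_one := by rw [← h.counit_eq, h.hopf.counit_one]

theorem isModuleAlg : IsModuleAlg Y.mul.flip Y.one (extDiagonalAct act₀) :=
  isModuleAlg_extDiagonalAct act₀ h.isBialgMul.flip h.act_one (fun c d => h.act_mul d c)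

theorem rightAct_mul (a b : B) :
    rightAct Y act₀ (Y.mul a b) = rightAct Y act₀ b ∘ₗ rightAct Y act₀ a :=
  tensorAct_mul (m := Y.mul.flip) h.isBialgMul.flip.comul_mul
    (fun c d => LinearMap.ext fun x => (h.hopf.mul_assoc x d c).symm) h.isModuleAlg.act_mul b a

theorem rightAct_one : rightAct Y act₀ Y.one = LinearMap.id := by
  rw [rightAct, tensorAct_apply, h.isBialgMul.comul_one, pairMap_tmul, h.isModuleAlg.act_one]
  ext1
  ext b x
  simp [h.hopf.mul_one]

theorem rightAct_tmul_one (b c : B) :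
    rightAct Y act₀ b (c ⊗ₜ 1) = Y.mul c b ⊗ₜ 1 := by
  have key : ∀ t : B ⊗[k] B, pairMap Y.mul.flip (extDiagonalAct act₀) t (c ⊗ₜ[k] (1 : Λ)) =
      Y.mul c (TensorProduct.rid k B (LinearMap.lTensor B counit t)) ⊗ₜ 1 := by
    intro t
    induction t with
    | zero => simp
    | add s t hs ht => simp only [map_add, LinearMap.add_apply, hs, ht, add_tmul]
    | tmul c d => simp [extDiagonalAct_one, smul_tmul']
  rw [tensorAct_apply, key, lTensor_counit_comul]
  simp

/-- The multiplication map `(B ⊗ Λ) ⊗ Λ → B ⊗ Λ` is equivariant. -/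
theorem exists_rightAct_formMul : ∃ μ : (B ⊗[k] Λ) ⊗[k] Λ →ₗ[k] B ⊗[k] Λ,
    (∀ x η, μ (x ⊗ₜ η) = formMul k B η x) ∧
    ∀ b x, μ (tensorAct (rightAct Y act₀) (extDiagonalAct act₀) b x) =
      rightAct Y act₀ b (μ x) := by
  refine ⟨map LinearMap.id (LinearMap.mul' k Λ) ∘ₗ (TensorProduct.assoc k B Λ Λ).toLinearMap,
    fun x η => ?_, fun b x => ?_⟩
  · induction x with
    | zero => simp
    | add x y hx hy => simp only [add_tmul, map_add, hx, hy]
    | tmul c ζ => rfl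
  · simp only [LinearMap.comp_apply, LinearEquiv.coe_coe]
    rw [assoc_tensorAct]
    exact map_tensorAct (fun _ _ => rfl) (fun b x => (h.isModuleAlg.map_mul b x).symm) b _

/-- The essential case `x (y (b ⊗ 1)) = (x y) (b ⊗ 1)` of associativity. -/
theorem mul_rightAct (x y : B ⊗[k] Λ) (b : B) :
    rightCrossMul Y.mul (extDiagonalAct act₀) x (rightAct Y act₀ b y) =
      rightAct Y act₀ b (rightCrossMul Y.mul (extDiagonalAct act₀) x y) := by
  obtain ⟨μ, hμ, hμ'⟩ := h.exists_rightAct_formMul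
  induction y with
  | zero => simp
  | add y z hy hz => simp only [map_add, hy, hz]
  | tmul c η =>
    rw [rightCrossMul_tmul, ← hμ, ← hμ', tensorAct_apply, tensorAct_apply]
    generalize comul (R := k) b = w
    induction w with
    | zero => simp
    | add y z hy hz => simp only [map_add, LinearMap.add_apply, hy, hz]
    | tmul d e =>
      simp only [pairMap_tmul, map_tmul, LinearMap.flip_apply, rightCrossMul_tmul, hμ]
      rw [h.rightAct_mul, LinearMap.comp_apply]

omit h in
theorem mul_formMul (x y : B ⊗[k] Λ) (ξ : Λ) :
    rightCrossMul Y.mul (extDiagonalAct act₀) x (formMul k B ξ y) =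
      formMul k B ξ (rightCrossMul Y.mul (extDiagonalAct act₀) x y) := by
  induction y with
  | zero => simp
  | add y z hy hz => simp only [map_add, hy, hz]
  | tmul c η =>
    rw [LinearMap.lTensor_tmul, rightCrossMul_tmul, rightCrossMul_tmul, LinearMap.mulRight_apply,
      formMul_mul]

theorem mul_assoc' (x y z : B ⊗[k] Λ) :
    rightCrossMul Y.mul (extDiagonalAct act₀) (rightCrossMul Y.mul (extDiagonalAct act₀) x y) z =
      rightCrossMul Y.mul (extDiagonalAct act₀) x
        (rightCrossMul Y.mul (extDiagonalAct act₀) y z) := by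
  induction z with
  | zero => simp
  | add y z hy hz => simp only [map_add, hy, hz]
  | tmul b ξ =>
    rw [rightCrossMul_tmul, rightCrossMul_tmul, mul_formMul, h.mul_rightAct]

theorem mul_one' (x : B ⊗[k] Λ) :
    rightCrossMul Y.mul (extDiagonalAct act₀) x (Y.one ⊗ₜ 1) = x := by
  rw [rightCrossMul_tmul, h.rightAct_one, formMul, LinearMap.mulRight_one, LinearMap.lTensor_id]
  rfl

theorem tmul_one_mul (a b : B) (ξ : Λ) :
    rightCrossMul Y.mul (extDiagonalAct act₀) (a ⊗ₜ 1) (b ⊗ₜ ξ) = Y.mul a b ⊗ₜ ξ := by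
  rw [rightCrossMul_tmul, h.rightAct_tmul_one]
  simp

theorem mul_one_tmul (x : B ⊗[k] Λ) (ξ : Λ) :
    rightCrossMul Y.mul (extDiagonalAct act₀) x (Y.one ⊗ₜ ξ) = formMul k B ξ x := by
  rw [rightCrossMul_tmul, h.rightAct_one]
  rfl

theorem one_mul' (x : B ⊗[k] Λ) :
    rightCrossMul Y.mul (extDiagonalAct act₀) (Y.one ⊗ₜ 1) x = x := by
  induction x with
  | zero => simp
  | add x y hx hy => simp only [map_add, hx, hy]
  | tmul b ξ => rw [h.tmul_one_mul, h.hopf.one_mul]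

omit h in
theorem rightAct_mem (b : B) {n : ℕ} {x : B ⊗[k] Λ} (hx : x ∈ extTensorGrading k W B n) :
    rightAct Y act₀ b x ∈ extTensorGrading k W B n := by
  induction hx using extTensorGrading_induction with
  | zero => simp
  | add x y _ _ hx hy => rw [map_add]; exact Submodule.add_mem _ hx hy
  | tmul c ξ hξ =>
    rw [tensorAct_apply]
    generalize comul (R := k) b = t
    induction t with
    | zero => simp
    | add s t hs ht => simp only [map_add, LinearMap.add_apply]; exact Submodule.add_mem _ hs ht
    | tmul d e => exact tmul_mem_extTensorGrading _ (extDiagonalAct_mem act₀ e hξ)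

omit h in
theorem formMul_mem {i j : ℕ} {ξ : Λ} (hξ : ξ ∈ ⋀[k]^j W) {x : B ⊗[k] Λ}
    (hx : x ∈ extTensorGrading k W B i) : formMul k B ξ x ∈ extTensorGrading k W B (i + j) := by
  induction hx using extTensorGrading_induction with
  | zero => simp
  | add x y _ _ hx hy => rw [map_add]; exact Submodule.add_mem _ hx hy
  | tmul c η hη =>
    exact tmul_mem_extTensorGrading _ (SetLike.mul_mem_graded (A := fun n : ℕ => ⋀[k]^n W) hη hξ)

omit h in
theorem mul_mem {i j : ℕ} {x y : B ⊗[k] Λ} (hx : x ∈ extTensorGrading k W B i)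
    (hy : y ∈ extTensorGrading k W B j) :
    rightCrossMul Y.mul (extDiagonalAct act₀) x y ∈ extTensorGrading k W B (i + j) := by
  induction hy using extTensorGrading_induction with
  | zero => simp
  | add x y _ _ hx hy => rw [map_add]; exact Submodule.add_mem _ hx hy
  | tmul c ξ hξ => exact formMul_mem hξ (rightAct_mem c hx)

omit h in
theorem rightCrossOps_comul_tmul (b : B) (ξ : Λ) : (rightCrossOps Y act₀).comul (b ⊗ₜ ξ) =
    tensorTensorTensorComm k B B Λ Λ (Y.comul b ⊗ₜ extComul k W ξ) := rfl

/-- The coproduct is a module map for right multiplication by `b ⊗ 1`; this is where the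
cocommutativity of `B` enters. -/
theorem comul_rightAct (b : B) (x : B ⊗[k] Λ) :
    (rightCrossOps Y act₀).comul (rightAct Y act₀ b x) =
      tensorAct (rightAct Y act₀) (rightAct Y act₀) b ((rightCrossOps Y act₀).comul x) := by
  have hR : ∀ c a, Y.comul (Y.mul.flip c a) = tensorAct Y.mul.flip Y.mul.flip c (Y.comul a) := by
    intro c a
    rw [h.comul_eq]
    refine (h.isBialgMul.flip.comul_mul c a).trans ?_
    rw [tensorAct_apply]
    rfl
  change tensorTensorTensorComm k B B Λ Λ (map Y.comul (extComul k W) (rightAct Y act₀ b x)) =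
    tensorAct _ _ b (tensorTensorTensorComm k B B Λ Λ (map Y.comul (extComul k W) x))
  rw [← tensorTensorTensorComm_tensorAct]
  congr 1
  exact map_tensorAct hR (extComul_extDiagonalAct act₀) b x

omit h in
theorem comul_formMul (ξ : Λ) (x : B ⊗[k] Λ) :
    (rightCrossOps Y act₀).comul (formMul k B ξ x) =
      tensorTensorTensorComm k B B Λ Λ (LinearMap.lTensor _ (superMulRight (extComul k W ξ))
        (tensorTensorTensorComm k B Λ B Λ ((rightCrossOps Y act₀).comul x))) := by
  induction x with
  | zero => simp
  | add x y hx hy => simp only [map_add, hx, hy]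
  | tmul b η =>
    rw [LinearMap.lTensor_tmul, LinearMap.mulRight_apply, rightCrossOps_comul_tmul, extComul_mul,
      rightCrossOps_comul_tmul, tensorTensorTensorComm_tensorTensorTensorComm]
    rfl

omit h in
/-- The super tensor product multiplication by homogeneous forms. -/
theorem lTensor_superMulRight {i j : ℕ} {ξ : Λ} (hξ : ξ ∈ ⋀[k]^i W) (θ : Λ) (p : B ⊗[k] Λ)
    {q : B ⊗[k] Λ} (hq : q ∈ extTensorGrading k W B j) :
    tensorTensorTensorComm k B B Λ Λ (LinearMap.lTensor _ (superMulRight (ξ ⊗ₜ θ))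
        (tensorTensorTensorComm k B Λ B Λ (p ⊗ₜ q))) =
      (-1 : k) ^ (i * j) • formMul k B ξ p ⊗ₜ[k] formMul k B θ q := by
  induction hq using extTensorGrading_induction with
  | zero => simp
  | add x y _ _ hx hy => simp only [tmul_add, map_add, hx, hy, smul_add]
  | tmul c ζ hζ =>
    induction p with
    | zero => simp
    | add x y hx hy => simp only [add_tmul, map_add, hx, hy, smul_add]
    | tmul b η =>
      rw [tensorTensorTensorComm_tmul, LinearMap.lTensor_tmul, superMulRight_tmul hξ hζ, tmul_smul,
        map_smul]
      rfl

omit h in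
/-- In the super tensor product `Ω ⊗ Ω`, right multiplication by `(c ⊗ ξ) ⊗ (e ⊗ θ)` is the action
of `c ⊗ e` followed by the super tensor product multiplication by `ξ ⊗ θ`. -/
theorem tensorMul_superFlip (u : (B ⊗[k] Λ) ⊗[k] (B ⊗[k] Λ)) (D : B ⊗[k] B) (Ξ : Λ ⊗[k] Λ) :
    (rightCrossOps Y act₀).tensorMul (HopfOps.superFlip (extTensorGrading k W B))
        (u ⊗ₜ tensorTensorTensorComm k B B Λ Λ (D ⊗ₜ Ξ)) =
      tensorTensorTensorComm k B B Λ Λ (LinearMap.lTensor _ (superMulRight Ξ)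
        (tensorTensorTensorComm k B Λ B Λ
          (pairMap (rightAct Y act₀) (rightAct Y act₀) D u))) := by
  induction D with
  | zero => simp
  | add x y hx hy => simp only [add_tmul, tmul_add, map_add, LinearMap.add_apply, hx, hy]
  | tmul c e =>
    induction Ξ with
    | zero => simp
    | add x y hx hy =>
      simp only [tmul_add, map_add, LinearMap.lTensor_add, LinearMap.add_apply, hx, hy]
    | tmul ξ θ =>
      induction ξ using DirectSum.Decomposition.inductionOn (fun n : ℕ => ⋀[k]^n W) with
      | zero => simp
      | add x y hx hy =>
        simp only [tmul_add, add_tmul, map_add, LinearMap.lTensor_add, LinearMap.add_apply, hx, hy]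
      | @homogeneous i ξ =>
        induction u with
        | zero => simp
        | add x y hx hy => simp only [add_tmul, map_add, hx, hy]
        | tmul p q =>
          induction q using DirectSum.Decomposition.inductionOn (extTensorGrading k W B) with
          | zero => simp
          | add x y hx hy => simp only [tmul_add, add_tmul, map_add, hx, hy]
          | @homogeneous j q =>
            rw [tensorTensorTensorComm_tmul, pairMap_tmul, map_tmul,
              lTensor_superMulRight ξ.2 θ _ (rightAct_mem e q.2)]
            exact tensorMul_tmul_of_flip
              (superFlip_tmul _ q.2 (tmul_mem_extTensorGrading c ξ.2))

theorem comul_mul (x y : B ⊗[k] Λ) :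
    (rightCrossOps Y act₀).comul ((rightCrossOps Y act₀).mul x y) =
      (rightCrossOps Y act₀).tensorMul (HopfOps.superFlip (extTensorGrading k W B))
        ((rightCrossOps Y act₀).comul x ⊗ₜ (rightCrossOps Y act₀).comul y) := by
  induction y with
  | zero => simp
  | add y z hy hz => simp only [map_add, tmul_add, hy, hz]
  | tmul b ξ =>
    rw [rightCrossOps_comul_tmul, tensorMul_superFlip, h.comul_eq]
    refine (comul_formMul ξ (rightAct Y act₀ b x)).trans ?_
    rw [h.comul_rightAct]
    rfl

omit h in
theorem rightCrossOps_counit_tmul (b : B) (ξ : Λ) :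
    (rightCrossOps Y act₀).counit (b ⊗ₜ ξ) = Y.counit b * extCounit k W ξ := rfl

theorem counit_mul (x y : B ⊗[k] Λ) :
    (rightCrossOps Y act₀).counit ((rightCrossOps Y act₀).mul x y) =
      (rightCrossOps Y act₀).counit x * (rightCrossOps Y act₀).counit y := by
  induction y with
  | zero => simp
  | add y z hy hz => simp only [map_add, mul_add, hy, hz]
  | tmul b ξ =>
    induction x with
    | zero => simp
    | add y z hy hz => simp only [map_add, LinearMap.add_apply, add_mul, hy, hz]
    | tmul a η =>
      change (rightCrossOps Y act₀).counit (formMul k B ξ (rightAct Y act₀ b (a ⊗ₜ η))) = _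
      have key : ∀ t : B ⊗[k] B, (rightCrossOps Y act₀).counit (formMul k B ξ
          (pairMap Y.mul.flip (extDiagonalAct act₀) t (a ⊗ₜ η))) =
          Y.counit a * extCounit k W η * extCounit k W ξ *
            Y.counit (TensorProduct.rid k B (LinearMap.lTensor B counit t)) := by
        intro t
        induction t with
        | zero => simp
        | add s t hs ht => simp only [map_add, LinearMap.add_apply, hs, ht, mul_add]
        | tmul c d =>
          rw [pairMap_tmul, map_tmul, LinearMap.lTensor_tmul, rightCrossOps_counit_tmul,
            LinearMap.flip_apply, h.hopf.counit_mul, LinearMap.mulRight_apply,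
            AlgHom.toLinearMap_apply, map_mul, ← AlgHom.toLinearMap_apply,
            extCounit_extDiagonalAct, LinearMap.lTensor_tmul, rid_tmul, map_smul, smul_eq_mul,
            ← AlgHom.toLinearMap_apply]
          ring
      rw [tensorAct_apply, key, lTensor_counit_comul, rightCrossOps_counit_tmul,
        rightCrossOps_counit_tmul, rid_tmul, one_smul]
      ring

/-- The coalgebra axioms of `B ⊗ Λ(W)` are those of a tensor product of coalgebras. -/
theorem coalgebra_laws (x : B ⊗[k] Λ) :
    TensorProduct.assoc k _ _ _ (LinearMap.rTensor _ (rightCrossOps Y act₀).comul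
      ((rightCrossOps Y act₀).comul x)) =
      LinearMap.lTensor _ (rightCrossOps Y act₀).comul ((rightCrossOps Y act₀).comul x) ∧
    LinearMap.rTensor _ (rightCrossOps Y act₀).counit ((rightCrossOps Y act₀).comul x) =
      (1 : k) ⊗ₜ[k] x ∧
    LinearMap.lTensor _ (rightCrossOps Y act₀).counit ((rightCrossOps Y act₀).comul x) =
      x ⊗ₜ[k] (1 : k) := by
  let _ := extCoalgebra k W
  have h1 : (rightCrossOps Y act₀).comul = comul := by
    rw [TensorProduct.comul_def, ← h.comul_eq]
    rfl
  have h2 : (rightCrossOps Y act₀).counit = counit := by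
    refine TensorProduct.ext' fun b ξ => ?_
    rw [TensorProduct.counit_tmul, ← h.counit_eq, smul_eq_mul, mul_comm]
    rfl
  rw [h1, h2]
  exact ⟨coassoc_apply x, rTensor_counit_comul x, lTensor_counit_comul x⟩

omit h in
/-- The antipode `a ⊗ η ↦ (1 ⊗ S η)(S a ⊗ 1)` of the cross product. -/
def crossAntipode (S : B →ₗ[k] B) : B ⊗[k] Λ →ₗ[k] B ⊗[k] Λ :=
  TensorProduct.lift ((rightAct Y act₀ ∘ₗ S).compl₂
    (TensorProduct.mk k B Λ Y.one ∘ₗ (gradeInvol k W).toLinearMap))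

omit h in
theorem crossAntipode_tmul (S : B →ₗ[k] B) (a : B) (η : Λ) :
    crossAntipode (Y := Y) (act₀ := act₀) S (a ⊗ₜ η) =
      rightAct Y act₀ (S a) (Y.one ⊗ₜ gradeInvol k W η) := rfl

theorem isAntipode {S : B →ₗ[k] B} (hS : Y.IsAntipode S) :
    (rightCrossOps Y act₀).IsAntipode (crossAntipode (Y := Y) (act₀ := act₀) S) := by
  let _ := extCoalgebra k W
  apply isAntipode_of_tmul
  · intro a η
    have ha := hS.1 a
    have hη := gradeInvol_mul_comul η
    rw [rightCrossOps_comul_tmul]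
    rw [h.comul_eq] at ha ⊢
    rw [← (ℛ k a).eq] at ha ⊢
    change LinearMap.mul' k Λ (LinearMap.rTensor Λ _ (comul η)) = _ at hη
    change (rightCrossOps Y act₀).mulT (LinearMap.rTensor _ _
      (tensorTensorTensorComm k B B Λ Λ (_ ⊗ₜ[k] (comul η : Λ ⊗[k] Λ)))) = _
    rw [← (ℛ k η).eq] at hη ⊢
    simp only [map_sum, LinearMap.rTensor_tmul, LinearMap.mul'_apply] at ha hη
    have key : ∀ i j, (rightCrossOps Y act₀).mulT
        (crossAntipode (Y := Y) (act₀ := act₀) S ((ℛ k a).left i ⊗ₜ (ℛ k η).left j) ⊗ₜ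
          ((ℛ k a).right i ⊗ₜ (ℛ k η).right j)) =
        formMul k B ((ℛ k η).right j)
          (rightAct Y act₀ (Y.mul (S ((ℛ k a).left i)) ((ℛ k a).right i))
            (Y.one ⊗ₜ gradeInvol k W ((ℛ k η).left j))) := by
      intro i j
      rw [h.rightAct_mul]
      rfl
    simp only [sum_tmul, tmul_sum, map_sum, tensorTensorTensorComm_tmul, LinearMap.rTensor_tmul,
      key]
    simp only [← map_sum, ← LinearMap.sum_apply]
    have ha' : ∑ x ∈ (ℛ k a).index, Y.mul (S ((ℛ k a).left x)) ((ℛ k a).right x) =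
      Y.counit a • Y.one := ha
    simp only [ha', map_smul, h.rightAct_one, LinearMap.smul_apply, LinearMap.id_apply,
      LinearMap.lTensor_tmul, LinearMap.mulRight_apply]
    rw [← Finset.smul_sum, ← tmul_sum, rightCrossOps_counit_tmul]
    simp only [AlgHom.toLinearMap_apply] at hη
    rw [hη, tmul_smul, smul_smul]
    rfl
  · intro a η
    have ha := hS.2 a
    have hη := mul_gradeInvol_comul η
    rw [rightCrossOps_comul_tmul]
    rw [h.comul_eq] at ha ⊢
    rw [← (ℛ k a).eq] at ha ⊢
    change LinearMap.mul' k Λ (LinearMap.lTensor Λ _ (comul η)) = _ at hη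
    change (rightCrossOps Y act₀).mulT (LinearMap.lTensor _ _
      (tensorTensorTensorComm k B B Λ Λ (_ ⊗ₜ[k] (comul η : Λ ⊗[k] Λ)))) = _
    rw [← (ℛ k η).eq] at hη ⊢
    simp only [map_sum, LinearMap.lTensor_tmul, LinearMap.mul'_apply] at ha hη
    have key : ∀ i j, (rightCrossOps Y act₀).mulT
        (((ℛ k a).left i ⊗ₜ (ℛ k η).left j) ⊗ₜ
          crossAntipode (Y := Y) (act₀ := act₀) S ((ℛ k a).right i ⊗ₜ (ℛ k η).right j)) =
        rightAct Y act₀ (S ((ℛ k a).right i)) ((ℛ k a).left i ⊗ₜ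
          ((ℛ k η).left j * gradeInvol k W ((ℛ k η).right j))) := by
      intro i j
      rw [crossAntipode_tmul]
      refine (h.mul_rightAct _ _ _).trans ?_
      rw [h.mul_one_tmul]
      rfl
    simp only [sum_tmul, tmul_sum, map_sum, tensorTensorTensorComm_tmul, LinearMap.lTensor_tmul,
      key]
    rw [Finset.sum_comm]
    simp only [← map_sum, ← tmul_sum]
    simp only [AlgHom.toLinearMap_apply] at hη
    simp only [hη, tmul_smul, map_smul, h.rightAct_tmul_one]
    rw [← Finset.smul_sum, ← sum_tmul, rightCrossOps_counit_tmul]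
    have ha' : ∑ x ∈ (ℛ k a).index, Y.mul ((ℛ k a).left x) (S ((ℛ k a).right x)) =
      Y.counit a • Y.one := ha
    rw [ha', ← smul_tmul', smul_smul, mul_comm]
    rfl

theorem isHopfFor :
    (rightCrossOps Y act₀).IsHopfFor (HopfOps.superFlip (extTensorGrading k W B)) where
  mul_assoc := h.mul_assoc'
  one_mul := h.one_mul'
  mul_one := h.mul_one'
  coassoc x := (h.coalgebra_laws x).1
  counit_left x := by rw [(h.coalgebra_laws x).2.1]; simp
  counit_right x := by rw [(h.coalgebra_laws x).2.2]; simp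
  comul_one := by
    refine (rightCrossOps_comul_tmul Y.one 1).trans ?_
    rw [h.hopf.comul_one, extComul_one]
    rfl
  comul_mul := h.comul_mul
  counit_one := by
    refine (rightCrossOps_counit_tmul Y.one 1).trans ?_
    rw [h.hopf.counit_one]
    simp
  counit_mul := h.counit_mul
  exists_antipode := by
    obtain ⟨S, hS⟩ := h.hopf.exists_antipode
    exact ⟨_, h.isAntipode hS⟩

theorem isSuperHopf : (rightCrossOps Y act₀).IsSuperHopf (extTensorGrading k W B) where
  hopf := h.isHopfFor
  one_mem := tmul_mem_extTensorGrading _ (SetLike.one_mem_graded (fun n : ℕ => ⋀[k]^n W))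
  mul_mem _ _ _ hx _ hy := mul_mem hx hy
  comul_mem n x hx := by
    induction hx using extTensorGrading_induction with
    | zero => simp
    | add x y _ _ hx hy => rw [map_add]; exact Submodule.add_mem _ hx hy
    | tmul b ξ hξ =>
      rw [rightCrossOps_comul_tmul]
      generalize Y.comul b = D
      induction D with
      | zero => simp
      | add D E hD hE => rw [add_tmul, map_add]; exact Submodule.add_mem _ hD hE
      | tmul c e =>
        let T := ⨆ p ∈ Finset.HasAntidiagonal.antidiagonal n,
          LinearMap.range (map (extTensorGrading k W B p.1).subtype
            (extTensorGrading k W B p.2).subtype)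
        suffices hle : extTensorDegree k W n ≤ T.comap
            ((tensorTensorTensorComm k B B Λ Λ).toLinearMap ∘ₗ
              TensorProduct.mk k _ _ (c ⊗ₜ e)) from hle (extComul_mem hξ)
        refine extTensorDegree_le fun i j hij x hx y hy => ?_
        exact tmul_mem_iSup_range hij (tmul_mem_extTensorGrading c hx)
          (tmul_mem_extTensorGrading e hy)
  counit_eq_zero n hn x hx := by
    induction hx using extTensorGrading_induction with
    | zero => simp
    | add x y _ _ hx hy => rw [map_add, hx, hy, add_zero]
    | tmul b ξ hξ =>
      have : extCounit k W ξ = 0 := by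
        obtain ⟨n, rfl⟩ := Nat.exists_eq_succ_of_ne_zero hn
        rw [Nat.succ_eq_add_one, exteriorPower_succ] at hξ
        induction hξ using Submodule.mul_induction_on' with
        | mem_mul_mem x hx y hy =>
          obtain ⟨w, rfl⟩ := hx
          exact algebraMapInv_ι_mul w y
        | add x _ y _ hx hy => rw [map_add, hx, hy, add_zero]
      rw [rightCrossOps_counit_tmul, this, mul_zero]
  antipode_mem S hS n x hx := by
    obtain ⟨S', hS'⟩ := h.hopf.exists_antipode
    rw [isAntipode_unique h.isHopfFor hS (h.isAntipode hS')]
    induction hx using extTensorGrading_induction with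
    | zero => simp
    | add x y _ _ hx hy => rw [map_add]; exact Submodule.add_mem _ hx hy
    | tmul b ξ hξ =>
      rw [crossAntipode_tmul]
      exact rightAct_mem _ (tmul_mem_extTensorGrading _ (gradeInvol_mem hξ))

end IsRightAction

end RightCross

/-! ### The differential defined by a cocycle -/

section Differential

variable {k B W : Type*} [Field k] [AddCommGroup B] [Module k B] [Coalgebra k B]
  [IsCocomm k B] [AddCommGroup W] [Module k W]

local notation "Λ" => ExteriorAlgebra k W

variable (B W) in
/-- Left multiplication by forms of degree one, `(b ⊗ w) ⊗ η ↦ b ⊗ (w ∧ η)`. -/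
def wedgeLeft : (B ⊗[k] W) ⊗[k] Λ →ₗ[k] B ⊗[k] Λ :=
  LinearMap.lTensor B (LinearMap.mul' k Λ ∘ₗ LinearMap.rTensor Λ (ExteriorAlgebra.ι k)) ∘ₗ
    (TensorProduct.assoc k B W Λ).toLinearMap

@[simp]
theorem wedgeLeft_tmul (b : B) (w : W) (η : Λ) :
    wedgeLeft B W ((b ⊗ₜ[k] w) ⊗ₜ η) = b ⊗ₜ (ExteriorAlgebra.ι k w * η) := rfl

/-- The coaction `b ↦ b₁ ⊗ θ(b₂)`. -/
def cocycleCoaction (θ : B →ₗ[k] W) : B →ₗ[k] B ⊗[k] W := LinearMap.lTensor B θ ∘ₗ comul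

/-- The map `b ⊗ η ↦ b₁ ⊗ (θ(b₂) ∧ η)`. -/
def cocycleDiff (θ : B →ₗ[k] W) : B ⊗[k] Λ →ₗ[k] B ⊗[k] Λ :=
  wedgeLeft B W ∘ₗ LinearMap.rTensor Λ (cocycleCoaction θ)

variable (θ : B →ₗ[k] W)

theorem cocycleDiff_tmul (b : B) (η : Λ) :
    cocycleDiff θ (b ⊗ₜ η) = wedgeLeft B W (LinearMap.lTensor B θ (comul b) ⊗ₜ η) := rfl

theorem cocycleDiff_tmul_repr {b : B} {ι : Type*} (r : Coalgebra.Repr k b ι) (η : Λ) :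
    cocycleDiff θ (b ⊗ₜ η) =
      ∑ i ∈ r.index, r.left i ⊗ₜ (ExteriorAlgebra.ι k (θ (r.right i)) * η) := by
  rw [cocycleDiff_tmul, ← r.eq]
  simp [sum_tmul]

theorem ι_mul_mem (w : W) {n : ℕ} {η : Λ} (hη : η ∈ ⋀[k]^n W) :
    ExteriorAlgebra.ι k w * η ∈ ⋀[k]^(n + 1) W := by
  rw [exteriorPower_succ]
  exact Submodule.mul_mem_mul ⟨w, rfl⟩ hη

theorem cocycleDiff_mem {n : ℕ} {x : B ⊗[k] Λ} (hx : x ∈ extTensorGrading k W B n) :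
    cocycleDiff θ x ∈ extTensorGrading k W B (n + 1) := by
  induction hx using extTensorGrading_induction with
  | zero => simp
  | add x y _ _ hx hy => rw [map_add]; exact Submodule.add_mem _ hx hy
  | tmul b η hη =>
    rw [cocycleDiff_tmul_repr θ (ℛ k b)]
    exact Submodule.sum_mem _ fun i _ => tmul_mem_extTensorGrading _ (ι_mul_mem _ hη)

/-- `d² = 0` because `θ(b₁) ∧ θ(b₂) = 0` in the cocommutative coalgebra `B`. -/
theorem cocycleDiff_cocycleDiff (x : B ⊗[k] Λ) : cocycleDiff θ (cocycleDiff θ x) = 0 := by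
  induction x with
  | zero => simp
  | add x y hx hy => simp only [map_add, hx, hy, add_zero]
  | tmul b η =>
    let f : B →ₗ[k] Λ := ExteriorAlgebra.ι k ∘ₗ θ
    have hf : LinearMap.mul' k Λ ∘ₗ map f f ∘ₗ comul = 0 := congrArg WithConv.ofConv
      (convMul_self_eq_zero f fun c => ExteriorAlgebra.ι_sq_zero _)
    let F : B ⊗[k] (B ⊗[k] B) →ₗ[k] B ⊗[k] Λ :=
      LinearMap.lTensor B (LinearMap.mulRight k η ∘ₗ LinearMap.mul' k Λ ∘ₗ map f f)
    have h1 : ∀ t : B ⊗[k] B, cocycleDiff θ (wedgeLeft B W (LinearMap.lTensor B θ t ⊗ₜ η)) =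
        F (TensorProduct.assoc k B B B (LinearMap.rTensor B comul t)) := by
      intro t
      induction t with
      | zero => simp
      | add s t hs ht => simp only [map_add, add_tmul, hs, ht]
      | tmul c d =>
        rw [LinearMap.lTensor_tmul, wedgeLeft_tmul, cocycleDiff_tmul, LinearMap.rTensor_tmul]
        generalize comul (R := k) c = s
        induction s with
        | zero => simp
        | add s t hs ht => simp only [map_add, add_tmul, hs, ht]
        | tmul p q => simp [F, f, mul_assoc]
    have h2 : F ∘ₗ LinearMap.lTensor B comul = 0 := by
      rw [← LinearMap.lTensor_comp, LinearMap.comp_assoc, LinearMap.comp_assoc, hf]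
      simp
    rw [cocycleDiff_tmul, h1, coassoc_apply, ← LinearMap.comp_apply, h2]
    rfl

theorem cocycleDiff_formMul (ξ : Λ) (x : B ⊗[k] Λ) :
    cocycleDiff θ (formMul k B ξ x) = formMul k B ξ (cocycleDiff θ x) := by
  induction x with
  | zero => simp
  | add x y hx hy => simp only [map_add, hx, hy]
  | tmul b η =>
    rw [LinearMap.lTensor_tmul, cocycleDiff_tmul_repr θ (ℛ k b), cocycleDiff_tmul_repr θ (ℛ k b),
      map_sum]
    simp [mul_assoc]

theorem formMul_one (x : B ⊗[k] Λ) : formMul k B 1 x = x := by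
  rw [formMul, LinearMap.mulRight_one, LinearMap.lTensor_id]
  rfl

variable {Y : HopfOps k B} {act₀ : B →ₗ[k] Module.End k W} (h : IsRightAction Y act₀)
include h

namespace IsRightAction

theorem rightAct_wedgeLeft (b : B) (x : (B ⊗[k] W) ⊗[k] Λ) :
    wedgeLeft B W (tensorAct (tensorAct Y.mul.flip act₀) (extDiagonalAct act₀) b x) =
      rightAct Y act₀ b (wedgeLeft B W x) := by
  simp only [wedgeLeft, LinearMap.comp_apply, LinearEquiv.coe_coe]
  rw [assoc_tensorAct]
  refine map_tensorAct (fun _ _ => rfl) (fun b y => ?_) b _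
  rw [LinearMap.comp_apply, LinearMap.comp_apply, h.isModuleAlg.map_mul]
  congr 1
  exact map_tensorAct (fun b w => (extDiagonalAct_ι act₀ b w).symm) (fun _ _ => rfl) b y

variable {θ} (hθ : ∀ a b, θ (Y.mul a b) = act₀ b (θ a) + counit (R := k) a • θ b)
include hθ

/-- The cocycle identity for the coaction `b ↦ b₁ ⊗ θ(b₂)`. -/
theorem cocycleCoaction_mul (a c : B) : cocycleCoaction θ (Y.mul a c) =
    tensorAct Y.mul.flip act₀ c (cocycleCoaction θ a) + map (Y.mul a) θ (comul c) := by
  have key : ∀ s t : B ⊗[k] B, LinearMap.lTensor B θ (map₂ Y.mul Y.mul s t) =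
      pairMap Y.mul.flip act₀ t (LinearMap.lTensor B θ s) +
        map (Y.mul (TensorProduct.rid k B (LinearMap.lTensor B counit s))) θ t := by
    intro s t
    induction s with
    | zero => simp
    | add s s' hs hs' =>
      simp only [map_add, LinearMap.add_apply, hs, hs', map_add_left]
      abel
    | tmul p q =>
      induction t with
      | zero => simp
      | add s s' hs hs' =>
        simp only [map_add, LinearMap.add_apply, hs, hs']
        abel
      | tmul p' q' => simp [hθ, tmul_add, smul_tmul']
  rw [cocycleCoaction, LinearMap.comp_apply, h.isBialgMul.comul_mul, key, lTensor_counit_comul]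
  simp [tensorAct_apply]

/-- The Leibniz rule for right multiplication by `b ⊗ 1`. Moving `θ(b₃)` past the form `η ◁ b₂`
gives the sign, and cocommutativity allows exchanging `b₂` and `b₃`. -/
theorem cocycleDiff_rightAct (b : B) {n : ℕ} {x : B ⊗[k] Λ}
    (hx : x ∈ extTensorGrading k W B n) :
    cocycleDiff θ (rightAct Y act₀ b x) = rightAct Y act₀ b (cocycleDiff θ x) +
      (-1 : k) ^ n • rightCrossMul Y.mul (extDiagonalAct act₀) x (cocycleDiff θ (b ⊗ₜ 1)) := by
  induction hx using extTensorGrading_induction with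
  | zero => simp
  | add x y _ _ hx hy =>
    simp only [map_add, LinearMap.add_apply, hx, hy, smul_add]
    abel
  | tmul a η hη =>
    -- both correction terms are functions of `b₁ ⊗ b₂ ⊗ b₃`, differing in the order of the factors
    let G : (B ⊗[k] B) ⊗[k] B →ₗ[k] B ⊗[k] Λ :=
      wedgeLeft B W ∘ₗ map (map (Y.mul a) θ) ((extDiagonalAct act₀).flip η)
    let G' : (B ⊗[k] B) ⊗[k] B →ₗ[k] B ⊗[k] Λ :=
      LinearMap.lTensor B (LinearMap.mul' k Λ) ∘ₗ (TensorProduct.assoc k B Λ Λ).toLinearMap ∘ₗ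
        map (map (Y.mul a) ((extDiagonalAct act₀).flip η)) (ExteriorAlgebra.ι k ∘ₗ θ)
    have hG : ∀ s, G (TensorProduct.rightComm k B B B s) = (-1 : k) ^ n • G' s := by
      have : G ∘ₗ (TensorProduct.rightComm k B B B).toLinearMap = (-1 : k) ^ n • G' := by
        ext p q r
        change (Y.mul a p) ⊗ₜ[k] (ExteriorAlgebra.ι k (θ r) * extDiagonalAct act₀ q η) =
          (-1 : k) ^ n • (Y.mul a p) ⊗ₜ[k] (extDiagonalAct act₀ q η * ExteriorAlgebra.ι k (θ r))
        rw [mul_ι_eq, gradeInvol_of_mem (extDiagonalAct_mem act₀ q hη), mul_smul_comm, tmul_smul,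
          smul_smul, ← mul_pow]
        simp
      exact fun s => LinearMap.congr_fun this s
    have h1 : ∀ t : B ⊗[k] B, cocycleDiff θ (pairMap Y.mul.flip (extDiagonalAct act₀) t (a ⊗ₜ η)) =
        wedgeLeft B W (pairMap (tensorAct Y.mul.flip act₀) (extDiagonalAct act₀) t
          (cocycleCoaction θ a ⊗ₜ η)) + G (LinearMap.rTensor B comul t) := by
      intro t
      induction t with
      | zero => simp
      | add s t hs ht =>
        simp only [map_add, LinearMap.add_apply, hs, ht]
        abel
      | tmul c d =>
        change wedgeLeft B W (cocycleCoaction θ (Y.mul a c) ⊗ₜ _) = _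
        rw [h.cocycleCoaction_mul hθ, add_tmul, map_add]
        rfl
    have h2 : ∀ t : B ⊗[k] B, rightCrossMul Y.mul (extDiagonalAct act₀) (a ⊗ₜ η)
        (wedgeLeft B W (LinearMap.lTensor B θ t ⊗ₜ 1)) = G' (LinearMap.rTensor B comul t) := by
      intro t
      induction t with
      | zero => simp
      | add s t hs ht => simp only [map_add, add_tmul, hs, ht]
      | tmul c d =>
        rw [LinearMap.lTensor_tmul, wedgeLeft_tmul, mul_one, rightCrossMul_tmul, tensorAct_apply,
          LinearMap.rTensor_tmul]
        generalize comul (R := k) c = s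
        induction s with
        | zero => simp
        | add s t hs ht => simp only [map_add, LinearMap.add_apply, add_tmul, hs, ht]
        | tmul p q => rfl
    rw [tensorAct_apply, h1, cocycleDiff_tmul θ a, cocycleDiff_tmul θ b, h2, ← hG, rightComm_comul]
    congr 1
    exact h.rightAct_wedgeLeft b _

theorem cocycleDiff_mul {n : ℕ} {x : B ⊗[k] Λ} (hx : x ∈ extTensorGrading k W B n)
    (y : B ⊗[k] Λ) :
    cocycleDiff θ (rightCrossMul Y.mul (extDiagonalAct act₀) x y) =
      rightCrossMul Y.mul (extDiagonalAct act₀) (cocycleDiff θ x) y +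
        (-1 : k) ^ n • rightCrossMul Y.mul (extDiagonalAct act₀) x (cocycleDiff θ y) := by
  induction y with
  | zero => simp
  | add y z hy hz =>
    simp only [map_add, hy, hz, smul_add]
    abel
  | tmul b ξ =>
    have hb : (b ⊗ₜ ξ : B ⊗[k] Λ) = formMul k B ξ (b ⊗ₜ 1) := by simp
    rw [hb, mul_formMul, mul_formMul, cocycleDiff_formMul, cocycleDiff_formMul, mul_formMul,
      rightCrossMul_tmul, rightCrossMul_tmul, formMul_one, formMul_one,
      h.cocycleDiff_rightAct hθ b hx, map_add, map_smul]

omit hθ in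
/-- Compatibility of the differential with the coproduct: forms of degree one are primitive. -/
theorem comul_cocycleDiff (x : B ⊗[k] Λ) :
    (rightCrossOps Y act₀).comul (cocycleDiff θ x) =
      LinearMap.rTensor _ (cocycleDiff θ) ((rightCrossOps Y act₀).comul x) +
        map (HopfOps.degreeSign (extTensorGrading k W B)) (cocycleDiff θ)
          ((rightCrossOps Y act₀).comul x) := by
  induction x with
  | zero => simp
  | add x y hx hy =>
    simp only [map_add, hx, hy]
    abel
  | tmul b η =>
    rw [degreeSign_extTensorGrading, rightCrossOps_comul_tmul, h.comul_eq]
    let P : W →ₗ[k] Module.End k (Λ ⊗[k] Λ) := (LinearMap.rTensorHom Λ ∘ₗ LinearMap.mul k Λ +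
      mapBilinear (.id k) Λ Λ Λ Λ (gradeInvol k W).toLinearMap ∘ₗ LinearMap.mul k Λ) ∘ₗ
        ExteriorAlgebra.ι k
    -- `A (c ⊗ d) (x ⊗ y)` is the coproduct of `c ⊗ θ(d) ∧ ζ` if `x ⊗ y` is the coproduct of `ζ`
    let A : B ⊗[k] B →ₗ[k] Λ ⊗[k] Λ →ₗ[k] (B ⊗[k] Λ) ⊗[k] (B ⊗[k] Λ) := TensorProduct.lift
      ((LinearMap.llcomp k _ _ _).compl₁₂
        (curry (tensorTensorTensorComm k B B Λ Λ).toLinearMap ∘ₗ comul) (P ∘ₗ θ))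
    have hA : ∀ t, (rightCrossOps Y act₀).comul (wedgeLeft B W (LinearMap.lTensor B θ t ⊗ₜ η)) =
        A t (extComul k W η) := by
      intro t
      induction t with
      | zero => simp
      | add s t hs ht => simp only [map_add, add_tmul, LinearMap.add_apply, hs, ht]
      | tmul c d =>
        rw [LinearMap.lTensor_tmul, wedgeLeft_tmul, rightCrossOps_comul_tmul, extComul_ι_mul,
          h.comul_eq]
        rfl
    rw [cocycleDiff_tmul, hA]
    generalize extComul k W η = E
    induction E with
    | zero => simp
    | add x y hx hy =>
      simp only [map_add, tmul_add, hx, hy]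
      abel
    | tmul x y =>
      let U : (B ⊗[k] B) ⊗[k] B →ₗ[k] (B ⊗[k] Λ) ⊗[k] (B ⊗[k] Λ) :=
        map (wedgeLeft B W ∘ₗ (TensorProduct.mk k _ _).flip x ∘ₗ LinearMap.lTensor B θ)
          ((TensorProduct.mk k _ _).flip y)
      let U' : B ⊗[k] (B ⊗[k] B) →ₗ[k] (B ⊗[k] Λ) ⊗[k] (B ⊗[k] Λ) :=
        map ((TensorProduct.mk k _ _).flip (gradeInvol k W x))
          (wedgeLeft B W ∘ₗ (TensorProduct.mk k _ _).flip y ∘ₗ LinearMap.lTensor B θ)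
      have h1 : ∀ t, A t (x ⊗ₜ y) =
          U (TensorProduct.rightComm k B B B (LinearMap.rTensor B comul t)) +
            U' (TensorProduct.assoc k B B B (LinearMap.rTensor B comul t)) := by
        intro t
        induction t with
        | zero => simp
        | add s t hs ht =>
          simp only [map_add, LinearMap.add_apply, hs, ht]
          abel
        | tmul c d =>
          change tensorTensorTensorComm k B B Λ Λ (comul c ⊗ₜ primMul k (θ d) (x ⊗ₜ y)) = _
          rw [primMul_tmul, LinearMap.rTensor_tmul]
          generalize comul (R := k) c = s
          induction s with
          | zero => simp
          | add s t hs ht =>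
            simp only [map_add, add_tmul, hs, ht]
            abel
          | tmul p q => rw [tmul_add, map_add]; rfl
      have h2 : ∀ t, LinearMap.rTensor _ (cocycleDiff θ)
            (tensorTensorTensorComm k B B Λ Λ (t ⊗ₜ (x ⊗ₜ y))) =
          U (LinearMap.rTensor B comul t) := by
        intro t
        induction t with
        | zero => simp
        | add s t hs ht => simp only [map_add, add_tmul, hs, ht]
        | tmul c d => rfl
      have h3 : ∀ t, map (LinearMap.lTensor B (gradeInvol k W).toLinearMap) (cocycleDiff θ)
            (tensorTensorTensorComm k B B Λ Λ (t ⊗ₜ (x ⊗ₜ y))) =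
          U' (LinearMap.lTensor B comul t) := by
        intro t
        induction t with
        | zero => simp
        | add s t hs ht => simp only [map_add, add_tmul, hs, ht]
        | tmul c d => rfl
      rw [h1, h2, h3, rightComm_comul, coassoc_apply]

omit h hθ in
theorem range_incl :
    LinearMap.range ((TensorProduct.mk k B Λ).flip 1) = extTensorGrading k W B 0 := by
  apply le_antisymm
  · rintro _ ⟨b, rfl⟩
    exact tmul_mem_extTensorGrading _ (SetLike.one_mem_graded (fun n : ℕ => ⋀[k]^n W))
  · intro x hx
    induction hx using extTensorGrading_induction with
    | zero => exact Submodule.zero_mem _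
    | add x y _ _ hx hy => exact Submodule.add_mem _ hx hy
    | tmul b ξ hξ =>
      change ξ ∈ LinearMap.range (ExteriorAlgebra.ι k : W →ₗ[k] Λ) ^ 0 at hξ
      rw [pow_zero, Submodule.mem_one] at hξ
      obtain ⟨c, rfl⟩ := hξ
      refine ⟨c • b, ?_⟩
      rw [Algebra.algebraMap_eq_smul_one, tmul_smul, smul_tmul']
      rfl

/-- A cocycle `θ` on a cocommutative Hopf algebra `B` defines a strongly bicovariant differential
graded algebra over `B`. -/
theorem isStronglyBicovariantDGA :
    HopfOps.IsStronglyBicovariantDGA (extTensorGrading k W B) Y (rightCrossOps Y act₀)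
      ((TensorProduct.mk k B Λ).flip 1) (cocycleDiff θ) where
  base_hopf := h.hopf
  super_hopf := h.isSuperHopf
  incl_injective := by
    refine Function.LeftInverse.injective
      (g := TensorProduct.rid k B ∘ LinearMap.lTensor B (extCounit k W)) fun b => ?_
    simp
  range_incl := IsRightAction.range_incl
  incl_one := rfl
  incl_mul a b := (h.tmul_one_mul a b 1).symm
  incl_comul a := by
    refine (rightCrossOps_comul_tmul a 1).trans ?_
    rw [extComul_one]
    generalize Y.comul a = t
    induction t with
    | zero => simp
    | add s t hs ht => simp only [map_add, add_tmul, hs, ht]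
    | tmul c d => rfl
  incl_counit a := by
    refine (rightCrossOps_counit_tmul a 1).trans ?_
    simp
  d_mem _ _ hx := cocycleDiff_mem θ hx
  d_d := cocycleDiff_cocycleDiff θ
  d_mul _ _ hx y := h.cocycleDiff_mul hθ hx y
  comul_d := h.comul_cocycleDiff

omit hθ in
/-- If `θ` is surjective, then the forms of degree one are recovered from the differential as
`1 ⊗ θ(b) = S(b₁) d(b₂)`. -/
theorem isStandard (hsurj : Function.Surjective θ) :
    (rightCrossOps Y act₀).IsStandard ((TensorProduct.mk k B Λ).flip 1) (cocycleDiff θ) := by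
  intro T h1 hb hd hmul
  obtain ⟨S, hS, -⟩ := h.hopf.exists_antipode
  have hι : ∀ w, Y.one ⊗ₜ[k] ExteriorAlgebra.ι k w ∈ T := by
    intro w
    obtain ⟨b, rfl⟩ := hsurj w
    let G : (B ⊗[k] B) ⊗[k] B →ₗ[k] B ⊗[k] Λ :=
      map (Y.mulT ∘ₗ LinearMap.rTensor B S) (ExteriorAlgebra.ι k ∘ₗ θ)
    -- `T` contains `S(b₁) d(b₂)`
    have key : ∀ t : B ⊗[k] B, ∃ x ∈ T, x =
        G ((TensorProduct.assoc k B B B).symm (LinearMap.lTensor B comul t)) := by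
      intro t
      induction t with
      | zero => exact ⟨0, T.zero_mem, by simp⟩
      | add s t hs ht =>
        obtain ⟨x, hx, hs⟩ := hs
        obtain ⟨y, hy, ht⟩ := ht
        exact ⟨x + y, T.add_mem hx hy, by simp only [map_add, hs, ht]⟩
      | tmul c d =>
        refine ⟨_, hmul _ (hb (S c)) _ (hd d), ?_⟩
        change rightCrossMul Y.mul (extDiagonalAct act₀) (S c ⊗ₜ 1)
          (wedgeLeft B W (LinearMap.lTensor B θ (comul d) ⊗ₜ 1)) = _
        rw [LinearMap.lTensor_tmul]
        generalize comul (R := k) d = s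
        induction s with
        | zero => simp
        | add s t hs ht => simp only [map_add, add_tmul, tmul_add, hs, ht]
        | tmul p q =>
          rw [LinearMap.lTensor_tmul, wedgeLeft_tmul, mul_one, h.tmul_one_mul]
          rfl
    obtain ⟨x, hx, hx'⟩ := key (comul b)
    -- and this is `1 ⊗ θ(b)`
    have key2 : ∀ t : B ⊗[k] B, G (LinearMap.rTensor B comul t) =
        Y.one ⊗ₜ[k] ExteriorAlgebra.ι k
          (θ (TensorProduct.lid k B (LinearMap.rTensor B counit t))) := by
      intro t
      induction t with
      | zero => simp
      | add s t hs ht => simp only [map_add, tmul_add, hs, ht]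
      | tmul c d =>
        change Y.mulT (LinearMap.rTensor B S (comul c)) ⊗ₜ[k] ExteriorAlgebra.ι k (θ d) = _
        rw [← h.comul_eq, hS, h.counit_eq]
        simp [smul_tmul]
    rw [coassoc_symm_apply, key2, rTensor_counit_comul] at hx'
    simpa [hx'] using hx
  rw [eq_top_iff]
  rintro x -
  induction x with
  | zero => exact T.zero_mem
  | add x y hx hy => exact T.add_mem hx hy
  | tmul b η =>
    suffices hη : Y.one ⊗ₜ[k] η ∈ T by
      have := hmul _ (hb b) _ hη
      change rightCrossMul Y.mul (extDiagonalAct act₀) (b ⊗ₜ 1) (Y.one ⊗ₜ η) ∈ T at this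
      rwa [h.tmul_one_mul, h.hopf.mul_one] at this
    induction η using extAlg_induction with
    | one => exact h1
    | smul c x hx => rw [tmul_smul]; exact T.smul_mem c hx
    | add x y hx hy => rw [tmul_add]; exact T.add_mem hx hy
    | ι_mul w x hx =>
      have := hmul _ (hι w) _ hx
      change rightCrossMul Y.mul (extDiagonalAct act₀) (Y.one ⊗ₜ _) (Y.one ⊗ₜ x) ∈ T at this
      rwa [h.mul_one_tmul, LinearMap.lTensor_tmul, LinearMap.mulRight_apply] at this

end IsRightAction

end Differential

/-! ### The antipode of a cocommutative Hopf algebra -/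

section Antipode

variable {k H : Type*} [Field k] [Ring H] [HopfAlgebra k H] [IsCocomm k H]

theorem map_algebraMap_counit_comul (h : H) :
    map (Algebra.linearMap k H ∘ₗ counit) (Algebra.linearMap k H ∘ₗ counit)
      (comul (R := k) h) = counit (R := k) h • ((1 : H) ⊗ₜ[k] (1 : H)) := by
  have key : ∀ t : H ⊗[k] H, map (Algebra.linearMap k H ∘ₗ counit)
      (Algebra.linearMap k H ∘ₗ counit) t =
        counit (R := k) (TensorProduct.lid k H (LinearMap.rTensor H counit t)) •
          ((1 : H) ⊗ₜ[k] (1 : H)) := by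
    intro t
    induction t with
    | zero => simp
    | add s t hs ht => simp only [map_add, hs, ht, add_smul]
    | tmul c d =>
      simp [Algebra.algebraMap_eq_smul_one, ← smul_tmul', tmul_smul, smul_smul, mul_comm]
  rw [key, rTensor_counit_comul]
  simp

/-- The antipode of a cocommutative Hopf algebra is a coalgebra map: `Δ ∘ S` and `(S ⊗ S) ∘ Δ`
are both inverse to `Δ` for the convolution product. -/
theorem comul_antipode (h : H) : comul (R := k) (HopfAlgebra.antipode k h) =
    map (HopfAlgebra.antipode k) (HopfAlgebra.antipode k) (comul h) := by
  let F : WithConv (H →ₗ[k] H ⊗[k] H) := WithConv.toConv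
    (map (HopfAlgebra.antipode k) (HopfAlgebra.antipode k) ∘ₗ comul)
  let f : H ⊗[k] H →ₗ[k] H := LinearMap.mul' k H ∘ₗ LinearMap.rTensor H (HopfAlgebra.antipode k)
  have hf : f ∘ₗ comul = Algebra.linearMap k H ∘ₗ counit := by
    ext c
    exact HopfAlgebra.mul_antipode_rTensor_comul_apply c
  have hF : F * WithConv.toConv comul = 1 := by
    ext c
    have key : ∀ t : H ⊗[k] H, LinearMap.mul' k (H ⊗[k] H) (map F.ofConv comul t) =
        map f f (tensorTensorTensorComm k H H H H (map comul comul t)) := by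
      intro t
      induction t with
      | zero => simp
      | add s t hs ht => simp only [map_add, hs, ht]
      | tmul c d =>
        change map (HopfAlgebra.antipode k) (HopfAlgebra.antipode k) (comul c) * comul d =
          map f f (tensorTensorTensorComm k H H H H (comul c ⊗ₜ comul d))
        generalize comul (R := k) c = u
        generalize comul (R := k) d = v
        induction u with
        | zero => simp
        | add u u' h h' => simp only [map_add, add_mul, add_tmul, h, h']
        | tmul a b =>
          induction v with
          | zero => simp
          | add u u' h h' => simp only [map_add, mul_add, tmul_add, h, h']
          | tmul a' b' => simp [f]
    rw [LinearMap.convMul_apply]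
    refine (key _).trans ?_
    rw [tensorTensorTensorComm_comul_comul, ← LinearMap.comp_apply, ← map_comp, hf,
      map_algebraMap_counit_comul, LinearMap.convOne_apply, Algebra.algebraMap_eq_smul_one]
    rfl
  have := left_inv_eq_right_inv hF LinearMap.comul_right_inv
  exact (DFunLike.congr_fun (congrArg WithConv.ofConv this) h).symm

/-- For a module algebra over a cocommutative Hopf algebra,
`S(h₂) ▷ ((h₁ ▷ x) y) = x (S(h) ▷ y)`. -/
theorem antipode_act_mul {A : Type*} [Ring A] [Algebra k A] {act : H →ₗ[k] Module.End k A}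
    (hact : IsModuleAlg (LinearMap.mul k H) 1 act) (x y : A) (h : H) :
    TensorProduct.lift ((act ∘ₗ HopfAlgebra.antipode k).flip ∘ₗ LinearMap.mulRight k y ∘ₗ
        act.flip x) (comul (R := k) h) = x * act (HopfAlgebra.antipode k h) y := by
  let F : (H ⊗[k] H) ⊗[k] H →ₗ[k] A := LinearMap.mul' k A ∘ₗ
    map (act.flip x ∘ₗ LinearMap.mul' k H ∘ₗ LinearMap.rTensor H (HopfAlgebra.antipode k))
      (act.flip y ∘ₗ HopfAlgebra.antipode k)
  have h1 : ∀ t : H ⊗[k] H, TensorProduct.lift ((act ∘ₗ HopfAlgebra.antipode k).flip ∘ₗ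
      LinearMap.mulRight k y ∘ₗ act.flip x) t =
        F (LinearMap.rTensor H (TensorProduct.comm k H H).toLinearMap
          ((TensorProduct.assoc k H H H).symm (LinearMap.lTensor H comul t))) := by
    intro t
    induction t with
    | zero => simp
    | add s t hs ht => simp only [map_add, hs, ht]
    | tmul c d =>
      change act (HopfAlgebra.antipode k d) (act c x * y) = _
      rw [← LinearMap.mul'_apply (R := k), hact.map_mul, tensorAct_apply, comul_antipode,
        pairMap_apply_tmul, LinearMap.lTensor_tmul]
      generalize comul (R := k) d = s
      induction s with
      | zero => simp
      | add s t hs ht => simp only [map_add, tmul_add, hs, ht]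
      | tmul p q =>
        change act _ (act c x) * act _ y = act (HopfAlgebra.antipode k p * c) x * act _ y
        congr 1
        exact (LinearMap.congr_fun (hact.act_mul _ _) x).symm
  have h2 : ∀ t : H ⊗[k] H, F (LinearMap.rTensor H comul t) =
      x * act (HopfAlgebra.antipode k
        (TensorProduct.lid k H (LinearMap.rTensor H counit t))) y := by
    intro t
    induction t with
    | zero => simp
    | add s t hs ht => simp only [map_add, LinearMap.add_apply, mul_add, hs, ht]
    | tmul c d =>
      change act (LinearMap.mul' k H (LinearMap.rTensor H (HopfAlgebra.antipode k) (comul c))) x *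
        act (HopfAlgebra.antipode k d) y = _
      rw [HopfAlgebra.mul_antipode_rTensor_comul_apply, Algebra.algebraMap_eq_smul_one, map_smul,
        hact.act_one]
      simp
  have h3 : (TensorProduct.comm k H H).toLinearMap ∘ₗ comul = comul :=
    LinearMap.ext fun c => comm_comul k c
  rw [h1, coassoc_symm_apply, ← LinearMap.comp_apply (LinearMap.rTensor H _),
    ← LinearMap.rTensor_comp, h3, h2, rTensor_counit_comul]
  simp

end Antipode

/-! ### The symmetric algebra as a module algebra -/

section Symmetric

variable {k M H : Type*} [Field k] [AddCommGroup M] [Module k M]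


/-- The antipode of the symmetric algebra. -/
def symAntipode (k M : Type*) [Field k] [AddCommGroup M] [Module k M] :
    SymmetricAlgebra k M →ₐ[k] SymmetricAlgebra k M :=
  SymmetricAlgebra.lift (-SymmetricAlgebra.ι k M)

theorem symAntipode_left (Φ : SymmetricAlgebra k M) :
    LinearMap.mul' k _ (LinearMap.rTensor _ (symAntipode k M).toLinearMap (comul (R := k) Φ)) =
      counit (R := k) Φ • (1 : SymmetricAlgebra k M) := by
  have : ((Algebra.TensorProduct.lmul' k).comp (Algebra.TensorProduct.map (symAntipode k M)
      (AlgHom.id k _))).comp (Bialgebra.comulAlgHom k (SymmetricAlgebra k M)) =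
      (Algebra.ofId k _).comp (Bialgebra.counitAlgHom k (SymmetricAlgebra k M)) := by
    apply SymmetricAlgebra.algHom_ext
    ext w
    simp [symAntipode, SymmetricAlgebra.algebraMapInv_ι]
  have := DFunLike.congr_fun this Φ
  simp only [AlgHom.comp_apply, Bialgebra.counitAlgHom_apply, Algebra.ofId_apply,
    Algebra.algebraMap_eq_smul_one] at this
  exact this

theorem symAntipode_right (Φ : SymmetricAlgebra k M) :
    LinearMap.mul' k _ (LinearMap.lTensor _ (symAntipode k M).toLinearMap (comul (R := k) Φ)) =
      counit (R := k) Φ • (1 : SymmetricAlgebra k M) := by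
  have : ((Algebra.TensorProduct.lmul' k).comp (Algebra.TensorProduct.map
      (AlgHom.id k _) (symAntipode k M))).comp (Bialgebra.comulAlgHom k (SymmetricAlgebra k M)) =
      (Algebra.ofId k _).comp (Bialgebra.counitAlgHom k (SymmetricAlgebra k M)) := by
    apply SymmetricAlgebra.algHom_ext
    ext w
    simp [symAntipode, SymmetricAlgebra.algebraMapInv_ι]
  have := DFunLike.congr_fun this Φ
  simp only [AlgHom.comp_apply, Bialgebra.counitAlgHom_apply, Algebra.ofId_apply,
    Algebra.algebraMap_eq_smul_one] at this
  exact this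

variable [Ring H] [HopfAlgebra k H] [IsCocomm k H] (act : H →ₗ[k] Module.End k M)

theorem symDiagonalAct_eq : symDiagonalAct act = transposeAct (SymmetricAlgebra.lift
    ((WithConv.linearEquiv k (H →ₗ[k] SymmetricAlgebra k M)).symm.toLinearMap ∘ₗ
        (act.compr₂ (SymmetricAlgebra.ι k M)).flip)) := rfl

theorem symDiagonalAct_ι (h : H) (w : M) :
    symDiagonalAct act h (SymmetricAlgebra.ι k M w) = SymmetricAlgebra.ι k M (act h w) := by
  rw [symDiagonalAct_eq, transposeAct_apply, SymmetricAlgebra.lift_ι_apply]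
  rfl

variable {act} (hone : act 1 = LinearMap.id) (hmul : ∀ g h, act (g * h) = act g ∘ₗ act h)

include hone hmul in
theorem isModuleAlg_symDiagonalAct : IsModuleAlg (LinearMap.mul k H) 1 (symDiagonalAct act) := by
  rw [symDiagonalAct_eq]
  refine isModuleAlg_transposeAct ⟨bialgebra_comul_mul, fun c d => Bialgebra.counit_mul c d,
    Bialgebra.comul_one, Bialgebra.counit_one⟩ _
    (s := Set.range (SymmetricAlgebra.ι k M)) ?_ ?_ ?_
  · rw [eq_top_iff]
    rintro x -
    induction x using SymmetricAlgebra.induction with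
    | algebraMap r => exact Subalgebra.algebraMap_mem _ r
    | ι x => exact Algebra.subset_adjoin ⟨x, rfl⟩
    | mul a b ha hb => exact Subalgebra.mul_mem _ ha hb
    | add a b ha hb => exact Subalgebra.add_mem _ ha hb
  · rintro _ ⟨w, rfl⟩
    rw [← symDiagonalAct_eq, symDiagonalAct_ι, hone]
    rfl
  · rintro _ ⟨w, rfl⟩ c d
    rw [← symDiagonalAct_eq, symDiagonalAct_ι, symDiagonalAct_ι, symDiagonalAct_ι]
    exact congrArg _ (LinearMap.congr_fun (hmul c d) w)

theorem symDiagonalAct_one (h : H) :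
    symDiagonalAct act h 1 = counit (R := k) h • (1 : SymmetricAlgebra k M) :=
  transposeAct_one _ h

theorem symDiagonalAct_mul' (h : H) (x : SymmetricAlgebra k M ⊗[k] SymmetricAlgebra k M) :
    symDiagonalAct act h (LinearMap.mul' k _ x) =
      LinearMap.mul' k _ (tensorAct (symDiagonalAct act) (symDiagonalAct act) h x) :=
  transposeAct_mul' _ h x

theorem symDiagonalAct_algebraMap (h : H) (r : k) :
    symDiagonalAct act h (algebraMap k _ r) =
      (counit (R := k) h * r) • (1 : SymmetricAlgebra k M) := by
  rw [Algebra.algebraMap_eq_smul_one, map_smul, symDiagonalAct_one, smul_smul, mul_comm]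

theorem symDiagonalAct_mul (h : H) (x y : SymmetricAlgebra k M) :
    symDiagonalAct act h (x * y) =
      LinearMap.mul' k _ (map ((symDiagonalAct act).flip x) ((symDiagonalAct act).flip y)
        (comul h)) := by
  rw [← LinearMap.mul'_apply (R := k), symDiagonalAct_mul', tensorAct_apply, pairMap_apply_tmul]

theorem mul'_algHom {A B : Type*} [Ring A] [Algebra k A] [Ring B] [Algebra k B] (F : A →ₐ[k] B)
    (x : A ⊗[k] A) : F (LinearMap.mul' k A x) =
      LinearMap.mul' k B (map F.toLinearMap F.toLinearMap x) := by
  induction x with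
  | zero => simp
  | add x y hx hy => simp only [map_add, hx, hy]
  | tmul a b => simp

/-- If `A` is a module algebra over a cocommutative coalgebra, then so is `A ⊗ A`. -/
theorem mul'_tensorAct_tensorAct {A : Type*} [Ring A] [Algebra k A] {a : H →ₗ[k] Module.End k A}
    (ha : ∀ c x, a c (LinearMap.mul' k A x) = LinearMap.mul' k A (tensorAct a a c x)) (h : H)
    (t : (A ⊗[k] A) ⊗[k] (A ⊗[k] A)) :
    LinearMap.mul' k (A ⊗[k] A) (tensorAct (tensorAct a a) (tensorAct a a) h t) =
      tensorAct a a h (LinearMap.mul' k (A ⊗[k] A) t) := by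
  have h1 : ∀ t, LinearMap.mul' k (A ⊗[k] A) t =
      map (LinearMap.mul' k A) (LinearMap.mul' k A) (tensorTensorTensorComm k A A A A t) := by
    have : LinearMap.mul' k (A ⊗[k] A) = map (LinearMap.mul' k A) (LinearMap.mul' k A) ∘ₗ
        (tensorTensorTensorComm k A A A A).toLinearMap := by
      refine TensorProduct.ext_fourfold' fun a b a' b' => ?_
      simp
    exact LinearMap.congr_fun this
  rw [h1, h1, tensorTensorTensorComm_tensorAct]
  exact map_tensorAct (fun c x => (ha c x).symm) (fun c x => (ha c x).symm) h _

/-- The elements on which a module algebra action is compatible with the coproduct are closed under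
multiplication. -/
theorem comul_act_mul {A : Type*} [Ring A] [Bialgebra k A] {act : H →ₗ[k] Module.End k A}
    (hact : ∀ c x, act c (LinearMap.mul' k A x) = LinearMap.mul' k A (tensorAct act act c x))
    {a b : A} (ha : ∀ h, comul (R := k) (act h a) = tensorAct act act h (comul a))
    (hb : ∀ h, comul (R := k) (act h b) = tensorAct act act h (comul b)) (h : H) :
    comul (R := k) (act h (a * b)) = tensorAct act act h (comul (a * b)) := by
  have h2 : comul ∘ₗ act.flip a = (tensorAct act act).flip (comul a) := LinearMap.ext ha
  have h3 : comul ∘ₗ act.flip b = (tensorAct act act).flip (comul b) := LinearMap.ext hb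
  calc comul (act h (a * b))
      = LinearMap.mul' k _ (map comul comul (map (act.flip a) (act.flip b) (comul h))) := by
        rw [← LinearMap.mul'_apply (R := k), hact, tensorAct_apply, pairMap_apply_tmul]
        exact mul'_algHom (Bialgebra.comulAlgHom k A) _
    _ = LinearMap.mul' k _ (tensorAct (tensorAct act act) (tensorAct act act) h
          (comul a ⊗ₜ comul b)) := by
        rw [← LinearMap.comp_apply (map comul comul), ← map_comp, h2, h3, tensorAct_apply,
          pairMap_apply_tmul]
    _ = tensorAct act act h (LinearMap.mul' k _ (comul a ⊗ₜ comul b)) :=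
        mul'_tensorAct_tensorAct hact h _
    _ = tensorAct act act h (comul (a * b)) := by rw [LinearMap.mul'_apply, Bialgebra.comul_mul]

theorem counit_symDiagonalAct (h : H) (x : SymmetricAlgebra k M) :
    counit (R := k) (symDiagonalAct act h x) = counit (R := k) h * counit (R := k) x := by
  induction x using SymmetricAlgebra.induction generalizing h with
  | algebraMap r =>
    rw [symDiagonalAct_algebraMap]
    simp
  | ι w => rw [symDiagonalAct_ι]; simp
  | add a b ha hb => rw [map_add, map_add, map_add, ha, hb, mul_add]
  | mul a b ha hb =>
    rw [symDiagonalAct_mul, Bialgebra.counit_mul]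
    have key : ∀ t : H ⊗[k] H, counit (R := k) (LinearMap.mul' k _
        (map ((symDiagonalAct act).flip a) ((symDiagonalAct act).flip b) t)) =
        counit (R := k) (TensorProduct.lid k H (LinearMap.rTensor H counit t)) *
          (counit (R := k) a * counit (R := k) b) := by
      intro t
      induction t with
      | zero => simp
      | add s t hs ht => simp only [map_add, hs, ht, add_mul]
      | tmul c d =>
        simp [ha, hb]
        ring
    rw [key, rTensor_counit_comul]
    simp

theorem comul_symDiagonalAct (h : H) (x : SymmetricAlgebra k M) :
    comul (R := k) (symDiagonalAct act h x) =
      tensorAct (symDiagonalAct act) (symDiagonalAct act) h (comul x) := by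
  induction x using SymmetricAlgebra.induction generalizing h with
  | algebraMap r =>
    have key : ∀ t : H ⊗[k] H, pairMap (symDiagonalAct act) (symDiagonalAct act) t (1 ⊗ₜ 1) =
        counit (R := k) (TensorProduct.lid k H (LinearMap.rTensor H counit t)) •
          ((1 : SymmetricAlgebra k M) ⊗ₜ[k] (1 : SymmetricAlgebra k M)) := by
      intro t
      induction t with
      | zero => simp
      | add s t hs ht => simp only [map_add, LinearMap.add_apply, hs, ht, add_smul]
      | tmul c d =>
        simp [symDiagonalAct_one, smul_tmul', tmul_smul, smul_smul, mul_comm]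
    rw [symDiagonalAct_algebraMap, Algebra.algebraMap_eq_smul_one, map_smul, map_smul,
      Bialgebra.comul_one, map_smul, Algebra.TensorProduct.one_def, tensorAct_apply, key,
      rTensor_counit_comul]
    simp [smul_smul, mul_comm]
  | ι w =>
    -- the part `1 ⊗ (c₂ ▷ w)` of the coproduct carries the counit on the left, the other part
    -- carries it on the right
    have key : ∀ t : H ⊗[k] H, pairMap (symDiagonalAct act) (symDiagonalAct act) t
        (comul (SymmetricAlgebra.ι k M w)) =
        comul (R := k) (SymmetricAlgebra.ι k M (act
          (TensorProduct.rid k H (LinearMap.lTensor H counit t)) w)) -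
          1 ⊗ₜ[k] SymmetricAlgebra.ι k M (act
          (TensorProduct.rid k H (LinearMap.lTensor H counit t)) w) +
          1 ⊗ₜ[k] SymmetricAlgebra.ι k M (act
          (TensorProduct.lid k H (LinearMap.rTensor H counit t)) w) := by
      intro t
      induction t with
      | zero => simp
      | add s t hs ht =>
        simp only [map_add, LinearMap.add_apply, hs, ht, tmul_add]
        abel
      | tmul c d =>
        simp [symDiagonalAct_one, symDiagonalAct_ι, tmul_smul, smul_tmul]
    rw [symDiagonalAct_ι, tensorAct_apply, key, rTensor_counit_comul, lTensor_counit_comul]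
    simp
  | add a b ha hb => rw [map_add, map_add, map_add, map_add, ha, hb]
  | mul a b ha hb =>
    have h1 := comul_act_mul (act := symDiagonalAct act) (fun c x => symDiagonalAct_mul' c x)
      ha hb h
    convert h1 using 1

end Symmetric

/-! ### The action on the dual algebra -/

section Dual

variable {k H V : Type*} [Field k] [Ring H] [HopfAlgebra k H] [IsCocomm k H]
  [AddCommGroup V] [Module k V] [Coalgebra k V] [IsCocomm k V] [Module H V] [IsScalarTower k H V]

theorem dualAct_apply (h : H) (φ : DualAlg k V) (v : V) :
    dualAct k H V h φ v = φ (HopfAlgebra.antipode k h • v) := rfl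

theorem dualAct_one : dualAct k H V 1 = LinearMap.id := by
  ext φ v
  change dualAct k H V 1 φ v = φ v
  rw [dualAct_apply, HopfAlgebra.antipode_one, one_smul]

theorem dualAct_mul (g h : H) : dualAct k H V (g * h) = dualAct k H V g ∘ₗ dualAct k H V h := by
  ext φ v
  change dualAct k H V (g * h) φ v = dualAct k H V g (dualAct k H V h φ) v
  rw [dualAct_apply, dualAct_apply, dualAct_apply, HopfAlgebra.antipode_mul_antidistrib, mul_smul]

theorem isModuleAlg_dualAct (hV : IsModuleCoalgebra k H V) :
    IsModuleAlg (LinearMap.mul k H) 1 (dualAct k H V) where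
  act_one := dualAct_one
  act_mul := dualAct_mul
  map_one h := by
    ext v
    change dualAct k H V h 1 v = _
    rw [dualAct_apply]
    simp [LinearMap.convOne_def, hV.counit_smul]
  map_mul h x := by
    induction x with
    | zero => simp
    | add x y hx hy => simp only [map_add, hx, hy]
    | tmul φ ψ =>
      ext v
      change dualAct k H V h (φ * ψ) v = _
      rw [dualAct_apply, LinearMap.convMul_apply, hV.comul_smul, TensorProduct.comul_tmul,
        comul_antipode, tensorAct_apply, pairMap_apply_tmul]
      generalize comul (R := k) h = s
      change _ = WithConv.ofConv (LinearMap.mul' k (DualAlg k V) (map _ _ s)) v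
      induction s with
      | zero => simp
      | add s t hs ht =>
        simp only [map_add, add_tmul, WithConv.ofConv_add, LinearMap.add_apply, ← hs, ← ht]
      | tmul p q =>
        change _ = LinearMap.mul' k k (map (WithConv.ofConv (dualAct k H V p φ))
          (WithConv.ofConv (dualAct k H V q ψ)) (comul v))
        generalize comul (R := k) v = t
        induction t with
        | zero => simp
        | add s t hs ht => simp only [map_add, tmul_add, hs, ht]
        | tmul x y => rfl

theorem coHopf_eq : coHopf k H V = leftCrossOps (symDiagonalAct (dualAct k H V)) := rfl

theorem coHopf_isHopf : (coHopf k H V).IsHopf :=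
  leftCrossOps_isHopf (S := (symAntipode k (DualAlg k V)).toLinearMap)
    (isModuleAlg_symDiagonalAct dualAct_one dualAct_mul)
    (fun h x => comul_symDiagonalAct h x) (fun h x => counit_symDiagonalAct h x)
    (fun a => symAntipode_left a) (fun a => symAntipode_right a)

variable (k V) in
/-- The algebra map `S(V*) → V*` which sends `φ₁ ⋯ φₙ` to `(-1)ⁿ φ₁ * ⋯ * φₙ`. -/
def signedEval : SymmetricAlgebra k (DualAlg k V) →ₐ[k] DualAlg k V :=
  SymmetricAlgebra.lift ((-1 : k) • (LinearMap.id : DualAlg k V →ₗ[k] DualAlg k V))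

theorem signedEval_ι (φ : DualAlg k V) :
    signedEval k V (SymmetricAlgebra.ι k _ φ) = (-1 : k) • φ := by
  rw [signedEval, SymmetricAlgebra.lift_ι_apply]
  rfl

theorem formAct_tmul (Φ : SymmetricAlgebra k (DualAlg k V)) (h : H) (w : DualAlg k V × V) :
    formAct k H V (Φ ⊗ₜ h) w =
      (dualAct k H V (HopfAlgebra.antipode k h) (signedEval k V Φ * w.1),
        counit (R := k) Φ • HopfAlgebra.antipode k h • w.2) := by
  change ((_, 0) : DualAlg k V × V) + (0, _) = _
  rw [Prod.mk_add_mk, add_zero, zero_add]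
  rfl

/-- The map `signedEval` is equivariant. -/
theorem signedEval_symDiagonalAct (hV : IsModuleCoalgebra k H V) (h : H)
    (Φ : SymmetricAlgebra k (DualAlg k V)) :
    signedEval k V (symDiagonalAct (dualAct k H V) h Φ) =
      dualAct k H V h (signedEval k V Φ) := by
  induction Φ using SymmetricAlgebra.induction generalizing h with
  | algebraMap r =>
    rw [symDiagonalAct_algebraMap, map_smul, map_one, AlgHom.commutes,
      Algebra.algebraMap_eq_smul_one, map_smul, (isModuleAlg_dualAct hV).map_one, smul_smul,
      mul_comm]
  | ι w => rw [symDiagonalAct_ι, signedEval_ι, signedEval_ι, map_smul]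
  | add a b ha hb => simp only [map_add, ha, hb]
  | mul a b ha hb =>
    have h2 : (signedEval k V).toLinearMap ∘ₗ (symDiagonalAct (dualAct k H V)).flip a =
        (dualAct k H V).flip (signedEval k V a) := LinearMap.ext ha
    have h3 : (signedEval k V).toLinearMap ∘ₗ (symDiagonalAct (dualAct k H V)).flip b =
        (dualAct k H V).flip (signedEval k V b) := LinearMap.ext hb
    rw [symDiagonalAct_mul, mul'_algHom, ← LinearMap.comp_apply (map _ _), ← map_comp, h2, h3,
      map_mul, ← LinearMap.mul'_apply (R := k), (isModuleAlg_dualAct hV).map_mul, tensorAct_apply,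
      pairMap_apply_tmul]

variable (k H V) in
/-- The projection `Φ h ↦ ε(Φ) h`, a homomorphism onto `H`. -/
def coProj : CoSpace k H V →ₗ[k] H :=
  (TensorProduct.lid k H).toLinearMap ∘ₗ LinearMap.rTensor H counit

theorem coProj_tmul (Φ : SymmetricAlgebra k (DualAlg k V)) (h : H) :
    coProj k H V (Φ ⊗ₜ h) = counit (R := k) Φ • h := rfl

theorem counit_coProj (a : CoSpace k H V) :
    counit (R := k) (coProj k H V a) = counit (R := k) a := by
  induction a using TensorProduct.induction_on with
  | zero => simp
  | add x y hx hy => simp only [map_add, hx, hy]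
  | tmul Φ h => simp [coProj_tmul, mul_comm]

theorem coHopf_mul_tmul (Φ Ψ : SymmetricAlgebra k (DualAlg k V)) (h g : H) :
    (coHopf k H V).mul (Φ ⊗ₜ h) (Ψ ⊗ₜ g) = LinearMap.rTensor H (LinearMap.mulLeft k Φ)
      (pairMap (symDiagonalAct (dualAct k H V)) (LinearMap.mul k H) (comul h) (Ψ ⊗ₜ g)) := rfl

theorem coProj_mul (a b : CoSpace k H V) :
    coProj k H V ((coHopf k H V).mul a b) = coProj k H V a * coProj k H V b := by
  induction a using TensorProduct.induction_on with
  | zero => simp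
  | add x y hx hy => simp only [map_add, LinearMap.add_apply, hx, hy, add_mul]
  | tmul Φ h =>
    induction b using TensorProduct.induction_on with
    | zero => simp
    | add x y hx hy => simp only [map_add, hx, hy, mul_add]
    | tmul Ψ g =>
      have key : ∀ t : H ⊗[k] H, coProj k H V (LinearMap.rTensor H (LinearMap.mulLeft k Φ)
          (pairMap (symDiagonalAct (dualAct k H V)) (LinearMap.mul k H) t (Ψ ⊗ₜ g))) =
          (counit (R := k) Φ * counit (R := k) Ψ) •
            (TensorProduct.lid k H (LinearMap.rTensor H counit t) * g) := by
        intro t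
        induction t with
        | zero => simp
        | add s t hs ht =>
          simp only [map_add, LinearMap.add_apply, hs, ht, smul_add, add_mul]
        | tmul c d =>
          rw [pairMap_tmul, map_tmul, LinearMap.rTensor_tmul, coProj_tmul, LinearMap.mulLeft_apply,
            Bialgebra.counit_mul, counit_symDiagonalAct, LinearMap.rTensor_tmul,
            TensorProduct.lid_tmul, smul_mul_assoc, smul_smul, LinearMap.mul_apply']
          congr 1
          ring
      rw [coHopf_mul_tmul, key, rTensor_counit_comul, coProj_tmul, coProj_tmul,
        TensorProduct.lid_tmul, one_smul, smul_mul_smul_comm]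

theorem formAct_snd (a : CoSpace k H V) (w : DualAlg k V × V) :
    (formAct k H V a w).2 = HopfAlgebra.antipode k (coProj k H V a) • w.2 := by
  induction a using TensorProduct.induction_on with
  | zero => simp
  | add x y hx hy => simp only [map_add, LinearMap.add_apply, Prod.snd_add, hx, hy, add_smul]
  | tmul Φ h => rw [formAct_tmul, coProj_tmul, map_smul, smul_assoc]

theorem formAct_fst (a : CoSpace k H V) (w : DualAlg k V × V) :
    (formAct k H V a w).1 = (formAct k H V a (w.1, 0)).1 := by
  induction a using TensorProduct.induction_on with
  | zero => simp
  | add x y hx hy => simp only [map_add, LinearMap.add_apply, Prod.fst_add, hx, hy]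
  | tmul Φ h => rw [formAct_tmul, formAct_tmul]

/-- The space `V* ⊕ V` is a right module: on `V*`, the two sides are
`S(h₂ g) ▷ ((h₁ ▷ χ(Ψ)) * χ(Φ) * ψ)` and `S(g) ▷ (χ(Ψ) * S(h) ▷ (χ(Φ) * ψ))` with
`χ = signedEval k V`. -/
theorem formAct_mul (hV : IsModuleCoalgebra k H V) (a b : CoSpace k H V) :
    formAct k H V ((coHopf k H V).mul a b) = formAct k H V b ∘ₗ formAct k H V a := by
  refine LinearMap.ext fun w => Prod.ext ?_ ?_
  · induction a using TensorProduct.induction_on with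
    | zero => simp
    | add x y hx hy =>
      simp only [map_add, LinearMap.add_apply, LinearMap.comp_add, Prod.fst_add, hx, hy]
    | tmul Φ h =>
      induction b using TensorProduct.induction_on with
      | zero => simp
      | add x y hx hy =>
        simp only [map_add, LinearMap.add_apply, LinearMap.add_comp, Prod.fst_add, hx, hy]
      | tmul Ψ g =>
        have key : ∀ t : H ⊗[k] H,
            (formAct k H V (LinearMap.rTensor H (LinearMap.mulLeft k Φ)
              (pairMap (symDiagonalAct (dualAct k H V)) (LinearMap.mul k H) t (Ψ ⊗ₜ g))) w).1 =
            dualAct k H V (HopfAlgebra.antipode k g) (TensorProduct.lift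
              ((dualAct k H V ∘ₗ HopfAlgebra.antipode k).flip ∘ₗ
                LinearMap.mulRight k (signedEval k V Φ * w.1) ∘ₗ
                  (dualAct k H V).flip (signedEval k V Ψ)) t) := by
          intro t
          induction t with
          | zero => simp
          | add s t hs ht =>
            simp only [map_add, LinearMap.add_apply, Prod.fst_add, hs, ht]
          | tmul c d =>
            rw [pairMap_tmul, map_tmul, LinearMap.rTensor_tmul, formAct_tmul,
              LinearMap.mulLeft_apply, map_mul (signedEval k V), signedEval_symDiagonalAct hV,
              LinearMap.mul_apply', HopfAlgebra.antipode_mul_antidistrib, dualAct_mul,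
              LinearMap.comp_apply, TensorProduct.lift.tmul, mul_comm (signedEval k V Φ), mul_assoc]
            rfl
        rw [coHopf_mul_tmul, key, antipode_act_mul (isModuleAlg_dualAct hV), LinearMap.comp_apply,
          formAct_tmul, formAct_tmul]
  · rw [LinearMap.comp_apply, formAct_snd, formAct_snd, formAct_snd, coProj_mul,
      HopfAlgebra.antipode_mul_antidistrib, mul_smul]

theorem isRightAction (hV : IsModuleCoalgebra k H V) :
    IsRightAction (coHopf k H V) (formAct k H V) where
  hopf := coHopf_isHopf
  comul_eq := rfl
  counit_eq := rfl
  act_one := by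
    refine LinearMap.ext fun w => (formAct_tmul 1 1 w).trans ?_
    rw [HopfAlgebra.antipode_one, dualAct_one, map_one, one_mul, Bialgebra.counit_one, one_smul,
      one_smul]
    rfl
  act_mul := formAct_mul hV

/-! ### The cocycle of the cotangent construction -/

variable (ω : Aug k H →ₗ[k] V)

/-- The cocycle `θ(Φ h) = (ε(Φ) ε(h) 1 - 1 ◁ (Φ h), ε(Φ) ω(π(h)))`. Its component in `V*` is the
coboundary of `-1`, where `1` is the unit of the convolution algebra. -/
def cotangentCocycle : CoSpace k H V →ₗ[k] DualAlg k V × V :=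
  LinearMap.prod
    (LinearMap.toSpanSingleton k (DualAlg k V) 1 ∘ₗ counit -
      LinearMap.fst k _ _ ∘ₗ (formAct k H V).flip (1, 0))
    (ω ∘ₗ augProj k H ∘ₗ coProj k H V)

theorem cotangentCocycle_tmul (Φ : SymmetricAlgebra k (DualAlg k V)) (h : H) :
    cotangentCocycle ω (Φ ⊗ₜ h) =
      ((counit (R := k) Φ * counit (R := k) h) • 1 -
        dualAct k H V (HopfAlgebra.antipode k h) (signedEval k V Φ),
        counit (R := k) Φ • ω (augProj k H h)) := by
  ext1
  · change counit (R := k) (Φ ⊗ₜ[k] h) • 1 - (formAct k H V (Φ ⊗ₜ h) (1, 0)).1 = _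
    rw [formAct_tmul, mul_one]
    simp [mul_comm]
  · change ω (augProj k H (coProj k H V (Φ ⊗ₜ h))) = _
    rw [coProj_tmul, map_smul, map_smul]

theorem coe_augProj (h : H) : (augProj k H h : H) = h - counit (R := k) h • 1 := by
  rw [← Algebra.algebraMap_eq_smul_one]
  rfl

theorem augProj_one : augProj k H (1 : H) = 0 := by
  apply Subtype.ext
  rw [coe_augProj, Bialgebra.counit_one, one_smul, sub_self]
  rfl

variable {ω} (hω : IsRightModuleMap k H V ω)
include hω

theorem omega_augProj_mul (g h : H) : ω (augProj k H (g * h)) =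
    HopfAlgebra.antipode k h • ω (augProj k H g) + counit (R := k) g • ω (augProj k H h) := by
  have hmem : (augProj k H g : H) * h ∈ Aug k H := by
    rw [LinearMap.mem_ker, Bialgebra.counit_mul, LinearMap.mem_ker.1 (augProj k H g).2, zero_mul]
  rw [← hω (augProj k H g) ⟨_, hmem⟩ h rfl, ← map_smul, ← map_add]
  congr 1
  apply Subtype.ext
  change _ = (augProj k H g : H) * h + counit (R := k) g • (augProj k H h : H)
  rw [coe_augProj, coe_augProj, coe_augProj, Bialgebra.counit_mul, sub_mul, smul_sub, smul_smul,
    smul_mul_assoc, one_mul]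
  abel

/-- The cocycle identity. It holds for coboundaries because `B` acts on `V*`, and for the component
in `V` because `ω` is a module map. -/
theorem cotangentCocycle_mul (hV : IsModuleCoalgebra k H V) (a b : CoSpace k H V) :
    cotangentCocycle ω ((coHopf k H V).mul a b) =
      formAct k H V b (cotangentCocycle ω a) + counit (R := k) a • cotangentCocycle ω b := by
  have hε : counit (R := k) ((coHopf k H V).mul a b) = counit (R := k) a * counit (R := k) b :=
    coHopf_isHopf.counit_mul a b
  ext1
  · have h1 : ∀ c, (cotangentCocycle ω c).1 =
        counit (R := k) c • 1 - (formAct k H V c (1, 0)).1 := fun c => rfl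
    rw [Prod.fst_add, Prod.smul_fst, formAct_fst, h1, h1, h1, hε, formAct_mul hV,
      LinearMap.comp_apply, formAct_fst b (formAct k H V a (1, 0))]
    have h2 : ∀ x y : DualAlg k V, ((x - y, 0) : DualAlg k V × V) = (x, 0) - (y, 0) := by simp
    have h3 : ∀ (c : k) (x : DualAlg k V), ((c • x, 0) : DualAlg k V × V) = c • (x, 0) := by simp
    rw [h2, h3, map_sub, map_smul, Prod.fst_sub, Prod.smul_fst, smul_sub, smul_smul]
    abel
  · rw [Prod.snd_add, Prod.smul_snd, formAct_snd, ← counit_coProj a]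
    change ω (augProj k H (coProj k H V _)) = _ • ω (augProj k H _) + _ • ω (augProj k H _)
    rw [coProj_mul, omega_augProj_mul hω]

omit hω in
/-- The values `θ(φ) = (φ, 0)` and `θ(x) = (0, ω(x))`, for `φ` in `V*` and `x` in `H⁺`, exhaust
`V* ⊕ V`. -/
theorem cotangentCocycle_surjective (hV : IsModuleCoalgebra k H V)
    (hs : Function.Surjective ω) : Function.Surjective (cotangentCocycle ω) := by
  rintro ⟨ψ, v⟩
  obtain ⟨x, rfl⟩ := hs v
  have hx : counit (R := k) (x : H) = 0 := x.2
  have hx' : augProj k H (x : H) = x := by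
    apply Subtype.ext
    rw [coe_augProj, hx, zero_smul, sub_zero]
  refine ⟨SymmetricAlgebra.ι k (DualAlg k V) ψ ⊗ₜ 1 + 1 ⊗ₜ (x : H), ?_⟩
  rw [map_add, cotangentCocycle_tmul, cotangentCocycle_tmul, hx, hx', augProj_one, signedEval_ι,
    HopfAlgebra.antipode_one, dualAct_one, map_one (signedEval k V),
    (isModuleAlg_dualAct hV).map_one, HopfAlgebra.counit_antipode, hx, Bialgebra.counit_one]
  simp

end Dual

/-! ### Shuffles and subsets -/

section Shuffles

theorem mem_shuffles {p n : ℕ} {σ : Equiv.Perm (Fin n)} : σ ∈ shuffles p n ↔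
    (∀ i j : Fin n, i < j → (j : ℕ) < p → σ i < σ j) ∧
    (∀ i j : Fin n, i < j → p ≤ (i : ℕ) → σ i < σ j) := by
  simp [shuffles]

theorem compl_firstIdx (p n : ℕ) : (firstIdx p n)ᶜ = lastIdx p n := by
  ext i
  simp [firstIdx, lastIdx]

theorem card_firstIdx (p q : ℕ) : (firstIdx p (p + q)).card = p := by
  have : firstIdx p (p + q) = Finset.univ.map (Fin.castAddEmb q) := by
    ext i
    simp only [firstIdx, Finset.mem_filter, Finset.mem_univ, true_and, Finset.mem_map]
    exact ⟨fun h => ⟨⟨i, h⟩, rfl⟩, by rintro ⟨j, rfl⟩; exact j.2⟩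
  rw [this, Finset.card_map, Finset.card_fin]

theorem card_lastIdx {p n : ℕ} (h : p ≤ n) : (lastIdx p n).card = n - p := by
  obtain ⟨q, rfl⟩ := Nat.exists_eq_add_of_le h
  rw [← compl_firstIdx, Finset.card_compl, card_firstIdx, Fintype.card_fin]

/-- The permutation which enumerates increasingly first `s` and then its complement. -/
def shuffleOfFinset {p q : ℕ} (s : Finset (Fin (p + q))) (hs : s.card = p) :
    Equiv.Perm (Fin (p + q)) :=
  finSumFinEquiv.symm.trans (finSumEquivOfFinset (n := q) hs
    (by rw [Finset.card_compl, hs, Fintype.card_fin, Nat.add_sub_cancel_left]))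

theorem shuffleOfFinset_mem {p q : ℕ} (s : Finset (Fin (p + q))) (hs : s.card = p) :
    shuffleOfFinset s hs ∈ shuffles p (p + q) := by
  rw [mem_shuffles]
  constructor
  · intro i j hij hj
    obtain ⟨i, rfl⟩ : ∃ i' : Fin p, i = Fin.castAdd q i' := ⟨⟨i, lt_trans hij hj⟩, rfl⟩
    obtain ⟨j, rfl⟩ : ∃ j' : Fin p, j = Fin.castAdd q j' := ⟨⟨j, hj⟩, rfl⟩
    have hij' : (i : ℕ) < j := hij
    simpa [shuffleOfFinset] using hij'
  · intro i j hij hi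
    obtain ⟨i, rfl⟩ : ∃ i' : Fin q, i = Fin.natAdd p i' :=
      ⟨⟨i - p, by omega⟩, by ext; simp; omega⟩
    obtain ⟨j, rfl⟩ : ∃ j' : Fin q, j = Fin.natAdd p j' :=
      ⟨⟨j - p, by omega⟩, by ext; simp; omega⟩
    simpa [shuffleOfFinset] using hij

theorem map_shuffleOfFinset {p q : ℕ} (s : Finset (Fin (p + q))) (hs : s.card = p) :
    (firstIdx p (p + q)).map (shuffleOfFinset s hs).toEmbedding = s := by
  refine Finset.eq_of_subset_of_card_le ?_ (by rw [Finset.card_map, card_firstIdx, hs])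
  intro x hx
  obtain ⟨i, hi, rfl⟩ := Finset.mem_map.1 hx
  simp only [firstIdx, Finset.mem_filter, Finset.mem_univ, true_and] at hi
  obtain ⟨i, rfl⟩ : ∃ i' : Fin p, i = Fin.castAdd q i' := ⟨⟨i, hi⟩, rfl⟩
  simp [shuffleOfFinset]

theorem eq_shuffleOfFinset {p q : ℕ} {σ : Equiv.Perm (Fin (p + q))} (hσ : σ ∈ shuffles p (p + q))
    {s : Finset (Fin (p + q))} (hs : s.card = p)
    (h : (firstIdx p (p + q)).map σ.toEmbedding = s) : σ = shuffleOfFinset s hs := by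
  rw [mem_shuffles] at hσ
  have hmem : ∀ i, σ i ∈ s ↔ (i : ℕ) < p := by
    intro i
    simp [← h, firstIdx]
  have hq : sᶜ.card = q := by
    rw [Finset.card_compl, hs, Fintype.card_fin, Nat.add_sub_cancel_left]
  have h1 := Finset.orderEmbOfFin_unique hs (f := σ ∘ Fin.castAdd q)
    (fun i => (hmem _).2 i.2) (fun i j hij => hσ.1 _ _ hij j.2)
  have h2 := Finset.orderEmbOfFin_unique hq (f := σ ∘ Fin.natAdd p)
    (fun i => Finset.mem_compl.2 fun h => absurd ((hmem _).1 h) (by simp))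
    (fun i j hij => hσ.2 _ _ (by simpa using hij) (by simp))
  refine Equiv.ext fun i => ?_
  induction i using Fin.addCases with
  | left i => simpa [shuffleOfFinset] using congrFun h1 i
  | right i => simpa [shuffleOfFinset] using congrFun h2 i

/-- Subsets of `p` elements correspond to shuffles. -/
theorem sum_shuffles {M : Type*} [AddCommMonoid M] {p n : ℕ} (hp : p ≤ n)
    (G : Finset (Fin n) → M) :
    ∑ σ ∈ shuffles p n, G ((firstIdx p n).map σ.toEmbedding) =
      ∑ s ∈ Finset.univ.powersetCard p, G s := by
  obtain ⟨q, rfl⟩ := Nat.exists_eq_add_of_le hp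
  refine Finset.sum_bij (fun σ _ => (firstIdx p (p + q)).map σ.toEmbedding) ?_ ?_ ?_ ?_
  · intro σ _
    simp [Finset.mem_powersetCard, card_firstIdx]
  · intro σ hσ τ hτ h
    have hs : ((firstIdx p (p + q)).map τ.toEmbedding).card = p := by simp [card_firstIdx]
    rw [eq_shuffleOfFinset hσ hs h, ← eq_shuffleOfFinset hτ hs rfl]
  · intro s hs
    have hs := (Finset.mem_powersetCard.1 hs).2
    exact ⟨shuffleOfFinset s hs, shuffleOfFinset_mem s hs, map_shuffleOfFinset s hs⟩
  · intro σ _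
    rfl

/-- A sum over subsets as a sum over shuffles, with the full set split off. -/
theorem sum_finset_eq_sum_shuffles {M : Type*} [AddCommMonoid M] {n : ℕ}
    (G : Finset (Fin n) → M) :
    ∑ s, G s = ∑ p ∈ Finset.range n, ∑ σ ∈ shuffles p n,
      G ((firstIdx p n).map σ.toEmbedding) + G Finset.univ := by
  rw [← Finset.powerset_univ, Finset.sum_powerset, Finset.card_fin, Finset.sum_range_succ]
  congr 1
  · exact Finset.sum_congr rfl fun p hp => (sum_shuffles (Finset.mem_range.1 hp).le G).symm
  · have : Finset.univ.powersetCard n = {(Finset.univ : Finset (Fin n))} := by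
      have := Finset.powersetCard_self (Finset.univ : Finset (Fin n))
      rwa [Finset.card_fin] at this
    rw [this, Finset.sum_singleton]

end Shuffles

/-! ### Products in the symmetric algebra -/

section Products

variable {k V : Type*} [Field k] [AddCommGroup V] [Module k V] [Coalgebra k V] [IsCocomm k V]
  {n : ℕ} (φ : Fin n → DualAlg k V)

theorem symProd_map (σ : Equiv.Perm (Fin n)) (s : Finset (Fin n)) :
    symProd φ (s.map σ.toEmbedding) = symProd (φ ∘ σ) s := by
  simp [symProd]

theorem symProd_map_compl (σ : Equiv.Perm (Fin n)) (s : Finset (Fin n)) :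
    symProd φ (s.map σ.toEmbedding)ᶜ = symProd (φ ∘ σ) sᶜ := by
  rw [← symProd_map]
  congr 1
  ext i
  simp

theorem comul_symProd : comul (R := k) (symProd φ Finset.univ) =
    ∑ s : Finset (Fin n), symProd φ s ⊗ₜ[k] symProd φ sᶜ := by
  have h1 := map_prod (Bialgebra.comulAlgHom k (SymmetricAlgebra k (DualAlg k V)))
    (fun i => SymmetricAlgebra.ι k (DualAlg k V) (φ i)) Finset.univ
  simp only [Bialgebra.comulAlgHom_apply, SymmetricAlgebra.comul_ι] at h1
  rw [symProd, h1, Finset.prod_add, Finset.powerset_univ]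
  refine Finset.sum_congr rfl fun s _ => ?_
  have hl := map_prod (Algebra.TensorProduct.includeLeft (R := k) (S := k)
    (A := SymmetricAlgebra k (DualAlg k V)) (B := SymmetricAlgebra k (DualAlg k V)))
    (fun i => SymmetricAlgebra.ι k (DualAlg k V) (φ i)) s
  have hr := map_prod (Algebra.TensorProduct.includeRight (R := k)
    (A := SymmetricAlgebra k (DualAlg k V)) (B := SymmetricAlgebra k (DualAlg k V)))
    (fun i => SymmetricAlgebra.ι k (DualAlg k V) (φ i)) sᶜ
  simp only [Algebra.TensorProduct.includeLeft_apply,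
    Algebra.TensorProduct.includeRight_apply] at hl hr
  rw [← hl, ← Finset.compl_eq_univ_sdiff, ← hr, Algebra.TensorProduct.tmul_mul_tmul, mul_one,
    one_mul]
  rfl

theorem signedEval_symProd (s : Finset (Fin n)) :
    signedEval k V (symProd φ s) = (-1 : k) ^ s.card • ∏ i ∈ s, φ i := by
  rw [symProd, map_prod]
  simp only [signedEval_ι]
  induction s using Finset.cons_induction with
  | empty => simp
  | cons i s hi ih =>
    rw [Finset.prod_cons, Finset.prod_cons, Finset.card_cons, ih, pow_succ', smul_mul_smul_comm]

theorem counit_symProd {s : Finset (Fin n)} (hs : s.Nonempty) :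
    counit (R := k) (symProd φ s) = 0 := by
  obtain ⟨i, hi⟩ := hs
  rw [symProd, ← Bialgebra.counitAlgHom_apply, map_prod]
  exact Finset.prod_eq_zero hi (SymmetricAlgebra.counit_ι _ _ _)

end Products

/-! ### Explicit formulas for the differential -/

section Formulas

variable {k H V : Type*} [Field k] [Ring H] [HopfAlgebra k H] [IsCocomm k H]
  [AddCommGroup V] [Module k V] [Coalgebra k V] [IsCocomm k V] [Module H V] [IsScalarTower k H V]

theorem coForm_smul (c : k) (φ : DualAlg k V) : coForm (c • φ) = c • coForm φ := by
  rw [coForm, coForm, ← map_smul, Prod.smul_mk, smul_zero]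

theorem omegaElt_smul (Φ : SymmetricAlgebra k (DualAlg k V)) (h : H) (c : k) (η : Forms k V) :
    omegaElt Φ h (c • η) = c • omegaElt Φ h η := tmul_smul _ _ _

variable (ω : Aug k H →ₗ[k] V)

theorem cotangentCocycle_one_tmul (hV : IsModuleCoalgebra k H V) (h : H) :
    cotangentCocycle ω (1 ⊗ₜ h) = (0, ω (augProj k H h)) := by
  rw [cotangentCocycle_tmul, map_one (signedEval k V), (isModuleAlg_dualAct hV).map_one,
    HopfAlgebra.counit_antipode, Bialgebra.counit_one, one_mul, one_smul, sub_self]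

theorem cotangentCocycle_symProd {n : ℕ} (φ : Fin n → DualAlg k V) {s : Finset (Fin n)}
    (hs : s.Nonempty) (h : H) : cotangentCocycle ω (symProd φ s ⊗ₜ h) =
      ((-1 : k) ^ (s.card - 1) • dualAct k H V (HopfAlgebra.antipode k h) (∏ i ∈ s, φ i), 0) := by
  rw [cotangentCocycle_tmul, counit_symProd φ hs, signedEval_symProd, zero_mul, zero_smul,
    zero_smul, map_smul, zero_sub, ← neg_smul]
  obtain ⟨m, hm⟩ := Nat.exists_eq_succ_of_ne_zero hs.card_pos.ne'
  rw [hm, pow_succ, mul_neg_one, neg_neg]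
  rfl

theorem cocycleDiff_omegaElt_symProd {n : ℕ} (φ : Fin n → DualAlg k V) {h : H} {ι : Type*}
    (r : Coalgebra.Repr k h ι) (η : Forms k V) :
    cocycleDiff (cotangentCocycle ω) (omegaElt (symProd φ Finset.univ) h η) =
      ∑ s : Finset (Fin n), ∑ i ∈ r.index, omegaElt (symProd φ s) (r.left i)
        (ExteriorAlgebra.ι k (cotangentCocycle ω (symProd φ sᶜ ⊗ₜ r.right i)) * η) := by
  rw [omegaElt, cocycleDiff_tmul, tensor_comul_apply, map_tmul, comul_symProd, ← r.eq]
  simp only [sum_tmul, tmul_sum, map_sum]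
  rw [Finset.sum_comm]
  rfl

theorem symProd_compl_univ {n : ℕ} (φ : Fin n → DualAlg k V) :
    symProd φ (Finset.univ : Finset (Fin n))ᶜ = 1 := by
  simp [symProd]

/-- The differential of `φ₁ ⋯ φₙ h ⊗ η`. The term of the coproduct of `φ₁ ⋯ φₙ` in which all
factors are on the left contributes the cocycle `ω ∘ π`, the others are indexed by shuffles. -/
theorem cocycleDiff_omegaElt (hV : IsModuleCoalgebra k H V) {n : ℕ} (φ : Fin n → DualAlg k V)
    {h : H} {ι : Type*} (r : Coalgebra.Repr k h ι) (η : Forms k V) :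
    cocycleDiff (cotangentCocycle ω) (omegaElt (symProd φ Finset.univ) h η) =
      ∑ p ∈ Finset.range n, ∑ σ ∈ shuffles p n, (-1 : k) ^ (n - p - 1) •
        ∑ i ∈ r.index, omegaElt (symProd (φ ∘ σ) (firstIdx p n)) (r.left i)
          (coForm (dualAct k H V (HopfAlgebra.antipode k (r.right i))
            (∏ j ∈ lastIdx p n, φ (σ j))) * η) +
      ∑ i ∈ r.index, omegaElt (symProd φ Finset.univ) (r.left i)
        (vForm (ω (augProj k H (r.right i))) * η) := by
  rw [cocycleDiff_omegaElt_symProd ω φ r, sum_finset_eq_sum_shuffles]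
  congr 1
  · refine Finset.sum_congr rfl fun p hp => Finset.sum_congr rfl fun σ _ => ?_
    rw [Finset.mem_range] at hp
    have hcard := card_lastIdx hp.le
    have hne : (lastIdx p n).Nonempty := by
      rw [← Finset.card_pos, hcard]
      omega
    rw [Finset.smul_sum, symProd_map, symProd_map_compl, compl_firstIdx]
    refine Finset.sum_congr rfl fun i _ => ?_
    rw [cotangentCocycle_symProd ω _ hne, hcard, ← omegaElt_smul, ← smul_mul_assoc, ← coForm_smul]
    rfl
  · rw [symProd_compl_univ]
    simp only [cotangentCocycle_one_tmul ω hV]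
    rfl

/-- The representation `Δ(1) = 1 ⊗ 1`. -/
def reprOne : Coalgebra.Repr k (1 : H) Unit where
  index := {()}
  left _ := 1
  right _ := 1
  eq := by rw [Finset.sum_singleton, Bialgebra.comul_one]; rfl

theorem cocycleDiff_symProd_one (hV : IsModuleCoalgebra k H V) {n : ℕ}
    (φ : Fin n → DualAlg k V) :
    cocycleDiff (cotangentCocycle ω) (omegaElt (symProd φ Finset.univ) 1 1) =
      ∑ p ∈ Finset.range n, ∑ σ ∈ shuffles p n, (-1 : k) ^ (n - p - 1) •
        omegaElt (symProd (φ ∘ σ) (firstIdx p n)) 1 (coForm (∏ j ∈ lastIdx p n, φ (σ j))) := by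
  rw [cocycleDiff_omegaElt ω hV φ reprOne]
  have h0 : vForm (k := k) (0 : V) = 0 := map_zero (ExteriorAlgebra.ι k)
  have h1 : ∀ (Φ : SymmetricAlgebra k (DualAlg k V)) (h : H), omegaElt Φ h 0 = 0 :=
    fun Φ h => tmul_zero _ _
  simp only [reprOne, Finset.sum_singleton, mul_one, HopfAlgebra.antipode_one, dualAct_one,
    augProj_one, map_zero, h0, h1, add_zero]
  rfl

theorem cocycleDiff_ι (hV : IsModuleCoalgebra k H V) (φ : DualAlg k V) :
    cocycleDiff (cotangentCocycle ω) (omegaElt (SymmetricAlgebra.ι k (DualAlg k V) φ) 1 1) =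
      omegaElt 1 1 (coForm φ) := by
  have h1 : cotangentCocycle ω (SymmetricAlgebra.ι k (DualAlg k V) φ ⊗ₜ 1) = (φ, 0) := by
    rw [cotangentCocycle_tmul, signedEval_ι, HopfAlgebra.antipode_one, dualAct_one,
      SymmetricAlgebra.counit_ι]
    simp
  rw [omegaElt, cocycleDiff_tmul, tensor_comul_apply, map_tmul, SymmetricAlgebra.comul_ι,
    Bialgebra.comul_one, Algebra.TensorProduct.one_def, add_tmul, map_add,
    tensorTensorTensorComm_tmul, tensorTensorTensorComm_tmul, map_add, LinearMap.lTensor_tmul,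
    LinearMap.lTensor_tmul, h1, cotangentCocycle_one_tmul ω hV, augProj_one, map_zero,
    add_tmul, map_add, wedgeLeft_tmul, wedgeLeft_tmul, mul_one]
  have h2 : ExteriorAlgebra.ι k ((0, 0) : DualAlg k V × V) = 0 := map_zero _
  rw [h2, tmul_zero, zero_add, mul_one]
  rfl

/-! ### Commutators -/

theorem mul_coForm (hV : IsModuleCoalgebra k H V) (Φ Ψ : SymmetricAlgebra k (DualAlg k V))
    (ψ : DualAlg k V) :
    (omegaHopf k H V).mul (omegaElt Φ 1 1) (omegaElt Ψ 1 (coForm ψ)) =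
      omegaElt (Φ * Ψ) 1 (coForm ψ) := by
  refine ((isRightAction hV).tmul_one_mul (Φ ⊗ₜ 1) (Ψ ⊗ₜ 1) (coForm ψ)).trans ?_
  rw [coHopf_eq]
  exact congrArg (· ⊗ₜ[k] coForm ψ) (leftCrossMul_tmul_tmul_one
    (isModuleAlg_symDiagonalAct dualAct_one dualAct_mul) Φ Ψ 1)

variable (H) in
/-- The map `Φ₁ ⊗ Φ₂ ↦ Ψ Φ₁ ⊗ (ψ ◁ Φ₂)`. -/
def coFormMul (Ψ : SymmetricAlgebra k (DualAlg k V)) (ψ : DualAlg k V) :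
    SymmetricAlgebra k (DualAlg k V) ⊗[k] SymmetricAlgebra k (DualAlg k V) →ₗ[k]
      OmegaSpace k H V :=
  map ((TensorProduct.mk k _ H).flip 1 ∘ₗ LinearMap.mulLeft k Ψ)
    (ExteriorAlgebra.ι k ∘ₗ LinearMap.inl k _ V ∘ₗ LinearMap.mulRight k ψ ∘ₗ
      (signedEval k V).toLinearMap)

theorem coFormMul_tmul (Φ Φ' Ψ : SymmetricAlgebra k (DualAlg k V)) (ψ : DualAlg k V) :
    coFormMul H Ψ ψ (Φ ⊗ₜ Φ') = omegaElt (Ψ * Φ) 1 (coForm (signedEval k V Φ' * ψ)) := rfl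

theorem coForm_mul (Φ Ψ : SymmetricAlgebra k (DualAlg k V))
    (ψ : DualAlg k V) :
    (omegaHopf k H V).mul (omegaElt Ψ 1 (coForm ψ)) (omegaElt Φ 1 1) =
      coFormMul H Ψ ψ (comul Φ) := by
  have key : (pairMap (coHopf k H V).mul.flip (extDiagonalAct (formAct k H V))).flip
      (omegaElt Ψ 1 (coForm ψ)) ∘ₗ (tensorTensorTensorComm k _ _ H H).toLinearMap ∘ₗ
        (TensorProduct.mk k _ _).flip (1 ⊗ₜ 1) = coFormMul H Ψ ψ := by
    refine TensorProduct.ext' fun p q => ?_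
    have h1 : (coHopf k H V).mul (Ψ ⊗ₜ 1) (p ⊗ₜ 1) = (Ψ * p) ⊗ₜ 1 := leftCrossMul_tmul_tmul_one
      (isModuleAlg_symDiagonalAct dualAct_one dualAct_mul) Ψ p 1
    have h2 : extDiagonalAct (formAct k H V) (q ⊗ₜ 1) (coForm ψ) =
        coForm (signedEval k V q * ψ) := by
      rw [coForm, extDiagonalAct_ι, formAct_tmul, HopfAlgebra.antipode_one, dualAct_one, smul_zero,
        smul_zero]
      rfl
    change (coHopf k H V).mul (Ψ ⊗ₜ 1) (p ⊗ₜ 1) ⊗ₜ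
      extDiagonalAct (formAct k H V) (q ⊗ₜ 1) (coForm ψ) = _
    rw [h1, h2]
    rfl
  change formMul k _ 1 (rightAct (coHopf k H V) (formAct k H V) (Φ ⊗ₜ 1) (omegaElt Ψ 1 _)) = _
  rw [formMul_one, tensorAct_apply, tensor_comul_apply, map_tmul, Bialgebra.comul_one,
    Algebra.TensorProduct.one_def]
  exact LinearMap.congr_fun key (comul Φ)

theorem sub_sum_add {G α β : Type*} [AddCommGroup G] (s : Finset α) (t : α → Finset β)
    (f : α → β → G) (a : G) :
    a - (∑ p ∈ s, ∑ σ ∈ t p, f p σ + a) = ∑ p ∈ s, ∑ σ ∈ t p, -f p σ := by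
  simp only [Finset.sum_neg_distrib]
  abel

theorem neg_smul_eq_mul_neg_one_smul {M : Type*} [AddCommGroup M] [Module k M] (c : k) (x : M) :
    -(c • x) = (c * -1) • x := by simp

/-- The commutator of `φ₁ ⋯ φₙ` with a form `Ψ ⊗ ψ`: the term of the coproduct of `φ₁ ⋯ φₙ` in which
all factors are on the left cancels. -/
theorem omegaComm_symProd_coForm (hV : IsModuleCoalgebra k H V) {n : ℕ} (φ : Fin n → DualAlg k V)
    (Ψ : SymmetricAlgebra k (DualAlg k V)) (ψ : DualAlg k V) :
    omegaComm (omegaElt (H := H) (symProd φ Finset.univ) 1 1) (omegaElt Ψ 1 (coForm ψ)) =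
      ∑ q ∈ Finset.range n, ∑ τ ∈ shuffles q n, (-1 : k) ^ (n - q + 1) •
        omegaElt (Ψ * symProd (φ ∘ τ) (firstIdx q n)) 1
          (coForm ((∏ j ∈ lastIdx q n, φ (τ j)) * ψ)) := by
  rw [omegaComm, mul_coForm hV, coForm_mul, comul_symProd, map_sum,
    sum_finset_eq_sum_shuffles, symProd_compl_univ, coFormMul_tmul, map_one (signedEval k V),
    one_mul, mul_comm Ψ]
  refine (sub_sum_add (G := OmegaSpace k H V) _ _ _ _).trans
    (Finset.sum_congr rfl fun q hq => Finset.sum_congr rfl fun τ _ => ?_)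
  rw [symProd_map, symProd_map_compl, compl_firstIdx, coFormMul_tmul, signedEval_symProd,
    card_lastIdx (Finset.mem_range.1 hq).le, smul_mul_assoc, coForm_smul, omegaElt_smul, pow_succ]
  exact neg_smul_eq_mul_neg_one_smul (M := OmegaSpace k H V) _ _

theorem omegaComm_ι (hV : IsModuleCoalgebra k H V) (φ ψ : DualAlg k V) :
    omegaComm (omegaElt (H := H) (SymmetricAlgebra.ι k (DualAlg k V) φ) 1 1)
      (omegaElt 1 1 (coForm ψ)) = omegaElt 1 1 (coForm (φ * ψ)) := by
  rw [omegaComm, mul_coForm hV, coForm_mul, SymmetricAlgebra.comul_ι, map_add, coFormMul_tmul,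
    coFormMul_tmul, map_one (signedEval k V), signedEval_ι, smul_mul_assoc, coForm_smul,
    omegaElt_smul, one_mul, one_mul, mul_one]
  refine (sub_add_cancel_left (G := OmegaSpace k H V) _ _).trans
    ((neg_smul_eq_mul_neg_one_smul (M := OmegaSpace k H V) _ _).trans ?_)
  rw [mul_neg_one, neg_neg, one_smul, one_mul]

/-- The commutator with `x` as a linear map. -/
def commutatorMap {A : Type*} [AddCommGroup A] [Module k A] (X : HopfOps k A) (x : A) :
    A →ₗ[k] A := X.mul x - X.mul.flip x

theorem omegaComm_eq_commutatorMap (x y : OmegaSpace k H V) :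
    omegaComm x y = commutatorMap (omegaHopf k H V) x y := rfl

theorem omegaComm_cocycleDiff (hV : IsModuleCoalgebra k H V) {n m : ℕ} (φ : Fin n → DualAlg k V)
    (ψ : Fin m → DualAlg k V) :
    omegaComm (omegaElt (symProd φ Finset.univ) 1 1)
        (cocycleDiff (cotangentCocycle ω) (omegaElt (symProd ψ Finset.univ) 1 1)) =
      ∑ p ∈ Finset.range m, ∑ q ∈ Finset.range n,
        ∑ σ ∈ shuffles p m, ∑ τ ∈ shuffles q n, (-1 : k) ^ ((m - p) + (n - q)) •
          omegaElt (symProd (ψ ∘ σ) (firstIdx p m) * symProd (φ ∘ τ) (firstIdx q n)) 1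
            (coForm ((∏ j ∈ lastIdx q n, φ (τ j)) * ∏ j ∈ lastIdx p m, ψ (σ j))) := by
  rw [cocycleDiff_symProd_one ω hV, omegaComm_eq_commutatorMap, map_sum]
  refine Finset.sum_congr rfl fun p hp => ?_
  rw [map_sum, Finset.sum_comm]
  refine Finset.sum_congr rfl fun σ _ => ?_
  rw [map_smul, ← omegaComm_eq_commutatorMap, omegaComm_symProd_coForm hV, Finset.smul_sum]
  refine Finset.sum_congr rfl fun q _ => ?_
  rw [Finset.smul_sum]
  refine Finset.sum_congr rfl fun τ _ => ?_
  rw [smul_smul, ← pow_add]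
  congr 2
  have := Finset.mem_range.1 hp
  omega

end Formulas

end Cotangent

end

theorem mainTheorem12 {k H V : Type*} [Field k] [Ring H] [HopfAlgebra k H]
    [Coalgebra.IsCocomm k H] [AddCommGroup V] [Module k V] [Coalgebra k V]
    [Coalgebra.IsCocomm k V] [Module H V] [IsScalarTower k H V]
    (hV : IsModuleCoalgebra k H V)
    (ω : Aug k H →ₗ[k] V) (hω : IsRightModuleMap k H V ω) :
    ∃ d : OmegaSpace k H V →ₗ[k] OmegaSpace k H V,
      -- `(S(V*) ⋊ H) ⋉ Λ(V* ⊕ V)` is a strongly bicovariant differential graded algebra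
      HopfOps.IsStronglyBicovariantDGA (omegaGrading k H V) (coHopf k H V) (omegaHopf k H V)
        (omegaIncl k H V) d ∧
      -- which is standard if `ω` is surjective
      (Function.Surjective ω → (omegaHopf k H V).IsStandard (omegaIncl k H V) d) ∧
      -- `d h = h₁ ⊗ ω(π(h₂))`
      (∀ (h : H) (ι : Type) (r : Coalgebra.Repr k h ι),
        d (omegaElt 1 h 1) =
          ∑ i ∈ r.index, omegaElt 1 (r.left i) (vForm (ω (augProj k H (r.right i))))) ∧
      -- `d φ = 1 ⊗ φ`
      (∀ φ : DualAlg k V,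
        d (omegaElt (SymmetricAlgebra.ι k (DualAlg k V) φ) 1 1) = omegaElt 1 1 (coForm φ)) ∧
      -- `d (φ₁ ⋯ φₙ h)`
      (∀ (n : ℕ) (φ : Fin n → DualAlg k V) (h : H) (ι : Type) (r : Coalgebra.Repr k h ι),
        d (omegaElt (symProd φ Finset.univ) h 1) =
          (∑ p ∈ Finset.range n, ∑ σ ∈ shuffles p n, (-1 : k) ^ (n - p - 1) •
            ∑ i ∈ r.index, omegaElt (symProd (φ ∘ σ) (firstIdx p n)) (r.left i)
              (coForm (dualAct k H V (HopfAlgebra.antipode k (r.right i))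
                (∏ j ∈ lastIdx p n, φ (σ j))))) +
          ∑ i ∈ r.index, omegaElt (symProd φ Finset.univ) (r.left i)
            (vForm (ω (augProj k H (r.right i))))) ∧
      -- `d (φ₁ ⋯ φₙ h ⊗ f₁ ∧ ⋯ ∧ fₐ ∧ e₁ ∧ ⋯ ∧ e_b)`
      (∀ (n a b : ℕ) (φ : Fin n → DualAlg k V) (f : Fin a → DualAlg k V) (e : Fin b → V)
        (h : H) (ι : Type) (r : Coalgebra.Repr k h ι),
        d (omegaElt (symProd φ Finset.univ) h
            ((List.ofFn fun j => coForm (f j)).prod * (List.ofFn fun j => vForm (e j)).prod)) =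
          (∑ i ∈ r.index, omegaElt (symProd φ Finset.univ) (r.left i)
            (vForm (ω (augProj k H (r.right i))) *
              (List.ofFn fun j => coForm (f j)).prod * (List.ofFn fun j => vForm (e j)).prod)) +
          ∑ p ∈ Finset.range n, ∑ σ ∈ shuffles p n, (-1 : k) ^ (n - p - 1) •
            ∑ i ∈ r.index, omegaElt (symProd (φ ∘ σ) (firstIdx p n)) (r.left i)
              (coForm (dualAct k H V (HopfAlgebra.antipode k (r.right i))
                  (∏ j ∈ lastIdx p n, φ (σ j))) *
                (List.ofFn fun j => coForm (f j)).prod *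
                (List.ofFn fun j => vForm (e j)).prod)) ∧
      -- `[φ₁ ⋯ φₙ, d (ψ₁ ⋯ ψₘ)]`
      (∀ (n m : ℕ) (φ : Fin n → DualAlg k V) (ψ : Fin m → DualAlg k V),
        omegaComm (omegaElt (symProd φ Finset.univ) 1 1)
            (d (omegaElt (symProd ψ Finset.univ) 1 1)) =
          ∑ p ∈ Finset.range m, ∑ q ∈ Finset.range n,
            ∑ σ ∈ shuffles p m, ∑ τ ∈ shuffles q n, (-1 : k) ^ ((m - p) + (n - q)) •
              omegaElt (symProd (ψ ∘ σ) (firstIdx p m) * symProd (φ ∘ τ) (firstIdx q n)) 1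
                (coForm ((∏ j ∈ lastIdx q n, φ (τ j)) * ∏ j ∈ lastIdx p m, ψ (σ j)))) ∧
      -- `[φ, d ψ] = 1 ⊗ φ * ψ`
      (∀ φ ψ : DualAlg k V,
        omegaComm (omegaElt (SymmetricAlgebra.ι k (DualAlg k V) φ) 1 1)
            (d (omegaElt (SymmetricAlgebra.ι k (DualAlg k V) ψ) 1 1)) =
          omegaElt 1 1 (coForm (φ * ψ))) := by
  open Cotangent in
  have hR := isRightAction hV
  have hθ := cotangentCocycle_mul hω hV
  refine ⟨cocycleDiff (cotangentCocycle ω), hR.isStronglyBicovariantDGA hθ,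
    fun hs => hR.isStandard (cotangentCocycle_surjective hV hs), ?_, cocycleDiff_ι ω hV,
    ?_, ?_, ?_, ?_⟩
  · intro h ι r
    -- the case without factors `φᵢ`
    have := cocycleDiff_omegaElt ω hV (Fin.elim0 : Fin 0 → DualAlg k V) r 1
    simpa [symProd] using this
  · intro n φ h ι r
    simpa using cocycleDiff_omegaElt ω hV φ r 1
  · intro n a b φ f e h ι r
    rw [cocycleDiff_omegaElt ω hV φ r, add_comm]
    simp only [mul_assoc]
  · intro n m φ ψ
    exact omegaComm_cocycleDiff ω hV φ ψ
  · intro φ ψ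
    rw [cocycleDiff_ι ω hV, omegaComm_ι hV]
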